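/- **Setting.** Let $\Gamma\subset\mathbb R^3$ be a lattice with dual lattice $\Gamma^*=\{\gamma^*:\gamma^*\cdot\gamma\in2\pi\mathbb Z\ \forall\gamma\in\Gamma\}$, $\mathbb T^3=\mathbb R^3/\Gamma$, and let $W^{-1}=\begin{pmatrix}\varepsilon&\chi\\ \chi^*&\mu\end{pmatrix}\in L^\infty(\mathbb R^3,\mathrm{Mat}_{\mathbb C}(6))$ be $\Gamma$-periodic, hermitian and positive with inverse $W\in L^\infty$. Let $\tau_\varepsilon,\tau_\mu\in C_b^\infty(\mathbb R^3)$ be positive, bounded away from $0$, with $\tau_\varepsilon(0)=\tau_\mu(0)=1$; assume $\chi=0$ or $\tau_\varepsilon=\tau_\mu$, and put $\tau=\sqrt{\tau_\varepsilon\tau_\mu}$. For $k\in\mathbb R^3$ let $$M_{\mathrm{per}}(k)=W\begin{pmatrix}0&-(-i\nabla_y+k)^\times\\(-i\nabla_y+k)^\times&0\end{pmatrix}$$ on $L^2(\mathbb T^3,\mathbb C^6)$, with its $k$-independent maximal domain $\mathfrak d$ (with the graph norm); here $v^\times\psi=v\times\psi$. Let $$\mathcal M_\lambda(r,k)=\tau(r)^2M_{\mathrm{per}}(k)-\lambda\,\tau(r)^2\,\tfrac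 i2\bigl(\nabla_r\ln\tfrac{\tau_\varepsilon}{\tau_\mu}\bigr)(r)\cdot\Sigma,\qquad \Sigma_j=W\begin{pmatrix}0&e_j^\times\\e_j^\times&0\end{pmatrix}.$$ Let $\omega$ be a (continuous, $\Gamma^*$-periodic) non-degenerate frequency band of $M_{\mathrm{per}}$, isolated in the sense that $\inf_k\mathrm{dist}(\{\omega(k)\},\sigma(M_{\mathrm{per}}(k))\setminus\{\omega(k)\})>0$, and not a ground state band ($\lim_{k\to0}\omega(k)\neq0$), with Bloch functions $\varphi(k)=(\varphi^E(k),\varphi^H(k))$ normalized for $\langle\varphi,\psi\rangle_W=\langle\varphi,W^{-1}\psi\rangle_{L^2}$, and let $\pi_0(k)=|\varphi(k)\rangle\langle\varphi(k)|_W$. Put $$\mathcal P(k)=\mathrm{Im}\int_{\mathbb T^3}\overline{\varphi^E(k,y)}\times\varphi^H(k,y)\,dy .$$ Call $f:\mathbb R^6\to V$ ($V$ a Banach space) a symbol of order $m$ if it is smooth and every derivative is $O((1+k^2)^{m/2})$ uniformly in $(r,k)$. A semiclassical symbol $f_\lambda\asymp\sum_n\lambda^nf_n$ is a family, $\lambda\in[0,\lambda_0)$,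 of symbols of order $m$ such that all derivatives of $f_\lambda-\sum_{n<N}\lambda^nf_n$ are $O(\lambda^N(1+k^2)^{m/2})$ uniformly in $(\lambda,r,k)$, for every $N$. An operator-valued symbol is equivariant if $f(r,k-\gamma^*)=e^{i\gamma^*\cdot y}f(r,k)e^{-i\gamma^*\cdot y}$ for all $\gamma^*\in\Gamma^*$. The Weyl product $f\sharp g$ is the oscillatory integral $$(f\sharp g)(X)=(\pi\lambda)^{-6}\iint e^{\frac{2i}\lambda(r'\cdot k''-r''\cdot k')}f(X+X')\,g(X+X'')\,dX'\,dX'',\qquad X'=(r',k'),\ X''=(r'',k'').$$ Let $\pi_\lambda$ be an equivariant semiclassical symbol, of order $0$ with values in $\mathcal B(L^2(\mathbb T^3,\mathbb C^6))$ and of order $1$ with values in $\mathcal B(L^2(\mathbb T^3,\mathbb C^6),\mathfrak d)$, with leading coefficient $\pi_0$; for example, the symbol of the superadiabatic projection associated to the band. **Statement.** 1. Put $\Omega_0=\tau^2\omega$ and $\Omega_1=-\tau^2\,\mathcal P\cdot\nabla_r\ln\frac{\tau_\varepsilon}{\tau_\mu}$. These are $\Gamma^*$-periodic scalar symbols of order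 $0$, and $\Omega=\Omega_0+\lambda\Omega_1$ satisfies $$\pi_\lambda\,\sharp\,(\Omega-\mathcal M_\lambda)\,\sharp\,\pi_\lambda=O(\lambda^2),\qquad(\ast)$$ that is, the left-hand side is, for $\lambda\in(0,\lambda_0)$, an equivariant symbol of order $0$ with values in $\mathcal B(L^2(\mathbb T^3,\mathbb C^6))$, all of whose derivatives are $O(\lambda^2)$ uniformly on $\mathbb R^6$. 2. Relation $(\ast)$ characterizes this $\Omega$ up to $O(\lambda^2)$: for every $\Gamma^*$-periodic scalar semiclassical symbol $\Omega\asymp\sum_n\lambda^nc_n$ of order $0$, the product in $(\ast)$ exists as an equivariant symbol of order $0$, and $(\ast)$ holds if and only if $c_0=\tau^2\omega$ and $c_1=-\tau^2\,\mathcal P\cdot\nabla_r\ln\frac{\tau_\varepsilon}{\tau_\mu}$. 3. If $\tau_\varepsilon=\tau_\mu$, then $\Omega_1=0$. -/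

import Mathlib

open MeasureTheory Filter Topology
open scoped ContDiff ENNReal SchwartzMap ComplexOrder

namespace RayOptics

noncomputable section

/-! ### Position space, field values, lattices -/

/-- `ℝ³` with the Euclidean norm. -/
abbrev E3 := EuclideanSpace ℝ (Fin 3)

/-- `ℂ⁶ = ℂ³ ⊕ ℂ³`: the value `(ψ^E, ψ^H)` of an electromagnetic field. -/
abbrev C6 := EuclideanSpace ℂ (Fin 3 ⊕ Fin 3)

/-- Complex `6 × 6` matrices in `3 × 3` blocks. -/
abbrev Mat6 := Matrix (Fin 3 ⊕ Fin 3) (Fin 3 ⊕ Fin 3) ℂ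

/-- Slow phase space `ℝ³_r × ℝ³_k`; a point is `X = (r, k)`. -/
abbrev Phase := E3 × E3

/-- The lattice `Γ` spanned by a basis of `ℝ³`. -/
def lattice (b : Module.Basis (Fin 3) ℝ E3) : Submodule ℤ E3 := Submodule.span ℤ (Set.range b)

/-- The dual lattice `Γ* = {γ* | γ* · γ ∈ 2πℤ for all γ ∈ Γ}`. -/
def dualLattice (b : Module.Basis (Fin 3) ℝ E3) : Set E3 :=
  {g | ∀ γ ∈ lattice b, ∃ n : ℤ, inner ℝ g γ = 2 * Real.pi * n}

/-- Lebesgue measure on a unit cell of `Γ`, i.e. on the torus `𝕋³ = ℝ³ / Γ`. -/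
abbrev cellMeasure (b : Module.Basis (Fin 3) ℝ E3) : Measure E3 :=
  volume.restrict (ZSpan.fundamentalDomain b)

/-- The Hilbert space `L²(𝕋³, ℂ⁶)` (with the unweighted scalar product). -/
abbrev Hcell (b : Module.Basis (Fin 3) ℝ E3) := Lp C6 2 (cellMeasure b)

/-- The action of a matrix on `ℂ⁶`. -/
def matCLM (A : Mat6) : C6 →L[ℂ] C6 := Matrix.toEuclideanCLM (𝕜 := ℂ) A

open Classical in
/-- Multiplication on `L²(𝕋³, ℂ⁶)` by an essentially bounded matrix-valued function
(and `0` if `A` is not essentially bounded on the unit cell). -/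
def mulOp (b : Module.Basis (Fin 3) ℝ E3) (A : E3 → Mat6) : Hcell b →L[ℂ] Hcell b :=
  if h : MemLp (fun y => matCLM (A y)) ∞ (cellMeasure b) then
    (ContinuousLinearMap.id ℂ (C6 →L[ℂ] C6)).holderL (cellMeasure b) ∞ 2 2 h.toLp
  else 0

/-- The operator of a constant matrix on `L²(𝕋³, ℂ⁶)`. -/
def constOp (b : Module.Basis (Fin 3) ℝ E3) (A : Mat6) : Hcell b →L[ℂ] Hcell b :=
  (matCLM A).compLpL 2 (cellMeasure b)

/-- Multiplication by `e^{i g · y}`. -/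
def phaseOp (b : Module.Basis (Fin 3) ℝ E3) (g : E3) : Hcell b →L[ℂ] Hcell b :=
  mulOp b fun y => Complex.exp (Complex.I * (inner ℝ g y : ℝ)) • (1 : Mat6)

/-! ### Material weights and slow modulation -/

/-- `Winv = (ε χ; χ* μ)` is a `Γ`-periodic material weight: essentially bounded, positive
(hermitian), with essentially bounded inverse `W`. -/
structure IsMaterialWeight (b : Module.Basis (Fin 3) ℝ E3) (Winv : E3 → Mat6) : Prop where
  periodic : ∀ γ ∈ lattice b, ∀ y, Winv (y + γ) = Winv y
  posDef : ∀ᵐ y, (Winv y).PosDef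
  memLp_Winv : MemLp (fun y => matCLM (Winv y)) ∞ volume
  memLp_W : MemLp (fun y => matCLM (Winv y)⁻¹) ∞ volume

/-- A modulation function: positive, in `C_b^∞(ℝ³)`, bounded away from `0`, equal to `1` at `0`. -/
structure IsModulation (t : E3 → ℝ) : Prop where
  smooth : ContDiff ℝ ∞ t
  bounded : ∀ n : ℕ, ∃ C : ℝ, ∀ r, ‖iteratedFDeriv ℝ n t r‖ ≤ C
  lower : ∃ c : ℝ, 0 < c ∧ ∀ r, c ≤ t r
  at_zero : t 0 = 1

/-- `τ = √(τ_ε τ_μ)`. -/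
def tau (te tm : E3 → ℝ) (r : E3) : ℝ := Real.sqrt (te r * tm r)

/-- `∇_r ln (τ_ε / τ_μ)`. -/
def gradLog (te tm : E3 → ℝ) (r : E3) : E3 := gradient (fun s => Real.log (te s / tm s)) r

/-! ### The periodic Maxwell operator -/

/-- The matrix `v^×` of `ψ ↦ v × ψ`. -/
def crossMat (v : Fin 3 → ℂ) : Matrix (Fin 3) (Fin 3) ℂ :=
  !![0, -v 2, v 1; v 2, 0, -v 0; -v 1, v 0, 0]

/-- The matrix `(0, -v^×; v^×, 0)`; the free Maxwell operator `Rot` is obtained for `v = -i∇`. -/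
def rotMat (v : Fin 3 → ℂ) : Mat6 := Matrix.fromBlocks 0 (-crossMat v) (crossMat v) 0

/-- `Rot θ = (+i ∇ × θ^H, -i ∇ × θ^E) = ∑ⱼ rotMat(eⱼ) (-i ∂ⱼ θ)` for a differentiable `θ`. -/
def rotFun (θ : E3 → C6) (y : E3) : C6 :=
  ∑ j : Fin 3, (-Complex.I) •
    matCLM (rotMat (Pi.single j 1)) (fderiv ℝ θ y (EuclideanSpace.single j 1))

/-- Smooth `Γ`-periodic vector fields. -/
def IsTestField (b : Module.Basis (Fin 3) ℝ E3) (θ : E3 → C6) : Prop :=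
  ContDiff ℝ ∞ θ ∧ ∀ γ ∈ lattice b, ∀ y, θ (y + γ) = θ y

/-- The domain `𝔡` of the periodic Maxwell operators, presented as the graph of the weak `Rot` on
`L²(𝕋³, ℂ⁶)`: the pairs `(ψ, η)` with `Rot ψ = η` in the sense of distributions on the torus.
The norm induced from the product is (equivalent to) the graph norm. -/
def MaxwellDomain (b : Module.Basis (Fin 3) ℝ E3) : Submodule ℂ (Hcell b × Hcell b) where
  carrier := {p | ∀ θ : E3 → C6, IsTestField b θ → ∀ u v : Hcell b,
    u =ᵐ[cellMeasure b] θ → v =ᵐ[cellMeasure b] rotFun θ → inner ℂ v p.1 = inner ℂ u p.2}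
  add_mem' := by
    intro p q hp hq θ hθ u v hu hv
    simp only [Prod.fst_add, Prod.snd_add, inner_add_right]
    rw [hp θ hθ u v hu hv, hq θ hθ u v hu hv]
  zero_mem' := by
    intro θ hθ u v hu hv
    simp
  smul_mem' := by
    intro c p hp θ hθ u v hu hv
    simp only [Prod.smul_fst, Prod.smul_snd, inner_smul_right]
    rw [hp θ hθ u v hu hv]

/-- The domain as a normed space. -/
abbrev Dom (b : Module.Basis (Fin 3) ℝ E3) := MaxwellDomain b

/-- The embedding of the domain into `L²(𝕋³, ℂ⁶)`. -/
def incl (b : Module.Basis (Fin 3) ℝ E3) : Dom b →L[ℂ] Hcell b :=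
  (ContinuousLinearMap.fst ℂ (Hcell b) (Hcell b)).comp (MaxwellDomain b).subtypeL

/-- The weak `Rot` on its domain. -/
def rotOp (b : Module.Basis (Fin 3) ℝ E3) : Dom b →L[ℂ] Hcell b :=
  (ContinuousLinearMap.snd ℂ (Hcell b) (Hcell b)).comp (MaxwellDomain b).subtypeL

/-- The multiplication operator `W`. -/
def Wop (b : Module.Basis (Fin 3) ℝ E3) (Winv : E3 → Mat6) : Hcell b →L[ℂ] Hcell b :=
  mulOp b fun y => (Winv y)⁻¹

/-- The weighted (energy) scalar product `⟨ψ, W⁻¹ η⟩` on the fast space. -/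
def wInner (b : Module.Basis (Fin 3) ℝ E3) (Winv : E3 → Mat6) (ψ η : Hcell b) : ℂ :=
  inner ℂ ψ (mulOp b Winv η)

/-- `M_per(k) = W (0, -(-i∇+k)^×; (-i∇+k)^×, 0)`. -/
def Mper (b : Module.Basis (Fin 3) ℝ E3) (Winv : E3 → Mat6) (k : E3) : Dom b →L[ℂ] Hcell b :=
  (Wop b Winv).comp (rotOp b + (constOp b (rotMat fun j => (k j : ℂ))).comp (incl b))

/-- The spectrum of `M_per(k)`, as an unbounded operator with domain `𝔡`. -/
def specMper (b : Module.Basis (Fin 3) ℝ E3) (Winv : E3 → Mat6) (k : E3) : Set ℂ :=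
  {z | ¬ Function.Bijective (Mper b Winv k - z • incl b)}

/-- `Σⱼ = W (0, eⱼ^×; eⱼ^×, 0)`. -/
def SigmaOp (b : Module.Basis (Fin 3) ℝ E3) (Winv : E3 → Mat6) (j : Fin 3) :
    Hcell b →L[ℂ] Hcell b :=
  (Wop b Winv).comp
    (constOp b (Matrix.fromBlocks 0 (crossMat (Pi.single j 1)) (crossMat (Pi.single j 1)) 0))

/-- The symbol of the Maxwell operator,
`𝓜_λ(r,k) = τ(r)² M_per(k) - λ τ(r)² (i/2) (∇_r ln(τ_ε/τ_μ))(r) · Σ`. -/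
def maxwellSymbol (b : Module.Basis (Fin 3) ℝ E3) (Winv : E3 → Mat6) (te tm : E3 → ℝ) (lam : ℝ)
    (X : Phase) : Dom b →L[ℂ] Hcell b :=
  ((tau te tm X.1 ^ 2 : ℝ) : ℂ) • Mper b Winv X.2
    - (((lam * tau te tm X.1 ^ 2 : ℝ) : ℂ) * (Complex.I / 2)) •
      ∑ j : Fin 3, ((gradLog te tm X.1 j : ℝ) : ℂ) • (SigmaOp b Winv j).comp (incl b)

/-! ### The frequency band -/

/-- `om` (the function `ω`) is a non-degenerate isolated frequency band of `k ↦ M_per(k)` which is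
not a ground state band, and `φ(k)` are normalized Bloch functions (no continuity of `φ` is required). -/
structure IsIsolatedBand (b : Module.Basis (Fin 3) ℝ E3) (Winv : E3 → Mat6) (om : E3 → ℝ)
    (φ : E3 → Dom b) : Prop where
  eigen : ∀ k, Mper b Winv k (φ k) = (om k : ℂ) • incl b (φ k)
  normalized : ∀ k, wInner b Winv (incl b (φ k)) (incl b (φ k)) = 1
  simple : ∀ k (ψ : Dom b), Mper b Winv k ψ = (om k : ℂ) • incl b ψ → ∃ c : ℂ, ψ = c • φ k
  continuous : Continuous om
  periodic : ∀ g ∈ dualLattice b, ∀ k, om (k - g) = om k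
  gap : ∃ d : ℝ, 0 < d ∧ ∀ k, ∀ z ∈ specMper b Winv k, z ≠ (om k : ℂ) → d ≤ ‖z - (om k : ℂ)‖
  not_ground : ¬ Tendsto om (𝓝[≠] 0) (𝓝 0)

/-- The spectral projection `π₀(k) = |φ(k)⟩⟨φ(k)|`, `ψ ↦ ⟨φ(k), W⁻¹ ψ⟩ φ(k)`, as a bounded operator
from `L²(𝕋³, ℂ⁶)` into the domain. -/
def bandProj (b : Module.Basis (Fin 3) ℝ E3) (Winv : E3 → Mat6) (φ : E3 → Dom b) (X : Phase) :
    Hcell b →L[ℂ] Dom b :=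
  ((innerSL ℂ (incl b (φ X.2))).comp (mulOp b Winv)).smulRight (φ X.2)

/-- The imaginary part of the complex Poynting vector of the Bloch function,
`𝒫(k) = Im ∫_{𝕋³} conj(φ^E(k,y)) × φ^H(k,y) dy`. -/
def poynting (b : Module.Basis (Fin 3) ℝ E3) (φ : E3 → Dom b) (k : E3) (j : Fin 3) : ℝ :=
  (∫ y, crossProduct (fun i => star (incl b (φ k) y (Sum.inl i)))
    (fun i => incl b (φ k) y (Sum.inr i)) j ∂(cellMeasure b)).im

/-- `Ω₀ = τ² ω`. -/
def Omega0 (te tm : E3 → ℝ) (om : E3 → ℝ) (X : Phase) : ℝ := tau te tm X.1 ^ 2 * om X.2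

/-- `Ω₁ = -τ² 𝒫 · ∇_r ln(τ_ε/τ_μ)`. -/
def Omega1 (b : Module.Basis (Fin 3) ℝ E3) (te tm : E3 → ℝ) (φ : E3 → Dom b) (X : Phase) : ℝ :=
  -(tau te tm X.1 ^ 2 * ∑ j : Fin 3, poynting b φ X.2 j * gradLog te tm X.1 j)

/-! ### Symbols -/

section Symbols

variable {V : Type*} [NormedAddCommGroup V] [NormedSpace ℝ V]

/-- Hörmander symbols of order `m` and type `ρ = 0`: smooth functions all of whose derivatives are
bounded by a multiple of `√(1 + k²)^m`. (For `ρ = 0` all derivatives of a given total order carry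
the same weight, so they are collected in the full Fréchet derivative.) -/
def IsSymbol (m : ℝ) (f : Phase → V) : Prop :=
  ContDiff ℝ ∞ f ∧ ∀ n : ℕ, ∃ C : ℝ, ∀ X : Phase,
    ‖iteratedFDeriv ℝ n f X‖ ≤ C * Real.sqrt (1 + ‖X.2‖ ^ 2) ^ m

/-- `f_λ = O(λ^N)` in the symbol class of order `m` and type `0`: every seminorm is bounded by
`C λ^N`, uniformly for `λ ∈ (0, λ₀)`. -/
def SymbolBigO (lam0 m : ℝ) (N : ℕ) (f : ℝ → Phase → V) : Prop :=
  ∀ n : ℕ, ∃ C : ℝ, ∀ lam ∈ Set.Ioo 0 lam0, ∀ X : Phase,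
    ‖iteratedFDeriv ℝ n (f lam) X‖ ≤ C * lam ^ N * Real.sqrt (1 + ‖X.2‖ ^ 2) ^ m

/-- `λ ↦ f_λ`, `λ ∈ [0, λ₀)`, is a semiclassical symbol of order `m` and type `0` with asymptotic
expansion `f_λ ≍ ∑ₙ λⁿ cₙ`. -/
structure IsSemiclassical (lam0 m : ℝ) (f : ℝ → Phase → V) (c : ℕ → Phase → V) : Prop where
  symbol : ∀ lam ∈ Set.Ico 0 lam0, IsSymbol m (f lam)
  coeff : ∀ n, IsSymbol m (c n)
  expansion : ∀ N n : ℕ, ∃ C : ℝ, ∀ lam ∈ Set.Ico 0 lam0, ∀ X : Phase,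
    ‖iteratedFDeriv ℝ n (fun Y => f lam Y - ∑ j ∈ Finset.range N, lam ^ j • c j Y) X‖
      ≤ C * lam ^ N * Real.sqrt (1 + ‖X.2‖ ^ 2) ^ m

end Symbols

/-- Equivariance, `f(r, k - γ*) = e^{iγ*·y} f(r,k) e^{-iγ*·y}`. -/
def IsEquivariant (b : Module.Basis (Fin 3) ℝ E3) (f : Phase → Hcell b →L[ℂ] Hcell b) : Prop :=
  ∀ g ∈ dualLattice b, ∀ r k : E3,
    f (r, k - g) = (phaseOp b g).comp ((f (r, k)).comp (phaseOp b (-g)))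

/-- `Γ*`-periodic scalar functions. -/
def IsPeriodicScalar (b : Module.Basis (Fin 3) ℝ E3) (f : Phase → ℂ) : Prop :=
  ∀ g ∈ dualLattice b, ∀ r k : E3, f (r, k - g) = f (r, k)

/-- Periodic scalar semiclassical symbols of order `0`. -/
structure IsScalarSemiclassical (b : Module.Basis (Fin 3) ℝ E3) (lam0 : ℝ)
    (Ω : ℝ → Phase → ℂ) (c : ℕ → Phase → ℂ) : Prop where
  semiclassical : IsSemiclassical lam0 0 Ω c
  periodic : ∀ lam ∈ Set.Ico 0 lam0, IsPeriodicScalar b (Ω lam)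
  coeff_periodic : ∀ n, IsPeriodicScalar b (c n)

/-- `π_λ` is an equivariant semiclassical symbol with principal symbol `π₀`, both of order `0` with
values in `𝓑(L²)` and of order `1` with values in `𝓑(L², 𝔡)`. (Equivariance is tested in `𝓑(L²)`;
this loses nothing as `𝔡` embeds into `L²`.) The symbol of the superadiabatic projection of the
band, which moreover is a Moyal projection commuting with `𝓜_λ` up to `O(λ^∞)`, is of this kind. -/
def IsBandSymbol (b : Module.Basis (Fin 3) ℝ E3) (Winv : E3 → Mat6) (φ : E3 → Dom b) (lam0 : ℝ)
    (P : ℝ → Phase → Hcell b →L[ℂ] Dom b) : Prop :=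
  ∃ c : ℕ → Phase → Hcell b →L[ℂ] Dom b,
    c 0 = bandProj b Winv φ ∧
    IsSemiclassical lam0 1 P c ∧
    IsSemiclassical lam0 0 (fun lam X => (incl b).comp (P lam X))
      (fun n X => (incl b).comp (c n X)) ∧
    (∀ lam ∈ Set.Ico 0 lam0, IsEquivariant b fun X => (incl b).comp (P lam X)) ∧
    ∀ n, IsEquivariant b fun X => (incl b).comp (c n X)

/-! ### The Weyl (Moyal) product -/

/-- `h = f ♯ g` is the Weyl product of two operator-valued functions, given by the oscillatory
integral
`(f♯g)(X) = (πλ)⁻⁶ ∫∫ e^{(2i/λ)(r'·k'' - r''·k')} f(X + X') g(X + X'') dX' dX''`,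
`X' = (r',k')`, `X'' = (r'',k'')`. As usual, the oscillatory integral is the limit of the
absolutely convergent integrals in which a Schwartz cutoff `χ(ε·)`, `χ(0) = 1`, has been inserted,
as `ε ↓ 0`; the limit has to exist and must not depend on the cutoff. The phase is the one that
belongs to `r ↦ iλ∇_k`, `k ↦ k̂`, so that `f♯g = fg - λ(i/2){f,g} + O(λ²)` with
`{f,g} = ∑ⱼ (∂_{kⱼ}f ∂_{rⱼ}g - ∂_{rⱼ}f ∂_{kⱼ}g)`. -/
def IsWeylProduct {F₁ F₂ F₃ : Type*} [NormedAddCommGroup F₁] [NormedSpace ℂ F₁]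
    [NormedAddCommGroup F₂] [NormedSpace ℂ F₂] [NormedAddCommGroup F₃] [NormedSpace ℂ F₃]
    (lam : ℝ) (f : Phase → F₂ →L[ℂ] F₃) (g : Phase → F₁ →L[ℂ] F₂) (h : Phase → F₁ →L[ℂ] F₃) :
    Prop :=
  ∀ (X : Phase) (χ : 𝓢(Phase × Phase, ℂ)), χ 0 = 1 →
    Tendsto (fun ε : ℝ => (((Real.pi * lam) ^ 6)⁻¹ : ℝ) •
      ∫ Z : Phase × Phase,
        (Complex.exp (Complex.I *
            ((2 / lam * (inner ℝ Z.1.1 Z.2.2 - inner ℝ Z.2.1 Z.1.2) : ℝ) : ℂ)) * χ (ε • Z)) •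
          (f (X + Z.1)).comp (g (X + Z.2)))
      (𝓝[>] 0) (𝓝 (h X))

/-- The symbol `Ω - 𝓜_λ`, with `Ω` standing for `Ω · id`. -/
def defect (b : Module.Basis (Fin 3) ℝ E3) (Winv : E3 → Mat6) (te tm : E3 → ℝ)
    (Ω : ℝ → Phase → ℂ) (lam : ℝ) (X : Phase) : Dom b →L[ℂ] Hcell b :=
  Ω lam X • incl b - maxwellSymbol b Winv te tm lam X

/-- `R = π_λ ♯ (Ω - 𝓜_λ) ♯ π_λ`, as an equivariant symbol in `S⁰₀(𝓑(L²(𝕋³, ℂ⁶)))`,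
for every `λ ∈ (0, λ₀)`. -/
def IsSandwich (b : Module.Basis (Fin 3) ℝ E3) (Winv : E3 → Mat6) (te tm : E3 → ℝ) (lam0 : ℝ)
    (P : ℝ → Phase → Hcell b →L[ℂ] Dom b) (Ω : ℝ → Phase → ℂ)
    (R : ℝ → Phase → Hcell b →L[ℂ] Hcell b) : Prop :=
  ∀ lam ∈ Set.Ioo 0 lam0,
    IsSymbol 0 (R lam) ∧ IsEquivariant b (R lam) ∧
    ∃ G : Phase → Hcell b →L[ℂ] Hcell b,
      IsWeylProduct lam (defect b Winv te tm Ω lam) (P lam) G ∧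
      IsWeylProduct lam (fun X => (incl b).comp (P lam X)) G (R lam)

end

end RayOptics

open RayOptics

/-! Write J for the embedding `incl`, π₀ for `bandProj`, M for `Mper`, and D = Ω - 𝓜 for `defect`.
The proof is a first-order computation with the Weyl product, once this product is known to exist
and to have an expansion whose remainders are controlled in every derivative, uniformly in λ.

Expansion. Rescaling by s = √(λ/2) gives (f♯g)(X) = (2π)⁻⁶ ∫ e^{iQ(Z)} a((X,X) + sZ) dZ with
a(X',X'') = f(X')g(X'') and Q a nondegenerate quadratic form. Each integration by parts against
e^{iQ} (`ibpOp`) lowers the growth of the amplitude by one power, so the regularised integrals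
converge, independently of the cutoff, and the limit is bounded uniformly over families of
amplitudes (`norm_oscReg_sub_le`, `UniformSymbol.norm_oscInt_le`). As a function of s the integral
starts at a and has derivative i s times the integral of a constant-coefficient second-order
operator applied to a (`hasDerivAt_oscScaled`). Integrating this relation once or twice gives f♯g =
fg + O(λ) and f♯g = fg + (iλ/2) ∑ (∂_r f ∂_k g - ∂_k f ∂_r g) + O(λ²) (`UniformSymbol.weyl_sub`,
`UniformSymbol.weyl_sub_sub`).

Orders. The leading coefficient of R = Jπ_λ ♯ (D ♯ π_λ) is (c₀ - τ²ω)Jπ₀, since Mπ₀ = ωJπ₀. If it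
vanishes, D₀ = τ²(ωJ - M) satisfies D₀π₀ = 0 and π₀D₀ = 0. Hence D♯π_λ = O(λ), the outer product
contributes no bracket at order λ, and the next coefficient of π_λ drops out. So does the inner
bracket: π₀ does not depend on r, and ∂_r D₀ is a scalar multiple of ωJ - M, which π₀ annihilates
from the left. There remains π₀(c₁J + S)π₀ with S = τ²(i/2)∇ln(τ_ε/τ_μ)·Σ, and ⟨φ, Σⱼφ⟩_W = -2i𝒫ⱼ
(`wInner_SigmaOp`) makes it (c₁ - Ω₁)π₀. Since Jπ₀ ≠ 0, R = O(λ²) forces first c₀ and then c₁; the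
converse is the same computation (`exists_sandwich`).

Three points need care. The identity π₀D₀ = 0 is symmetry of M against φ on the whole weakly defined
domain (`wInner_Mper`). The estimates a priori allow R to grow like (1 + |k|)²; equivariance reduces
k to a bounded set and removes the growth (`UniformSymbol.of_equivariant`). Smoothness of ω and 𝒫,
and periodicity of 𝒫, are inherited from π₀ (`contDiff_of_eq_smul`, `poynting_periodic`). -/

set_option linter.unusedSectionVars false

namespace RayOptics

noncomputable section

/-! ### Families of smooth functions with weighted derivative bounds -/

section DerivBounds

variable {ι : Type*} {E F V V₁ V₂ : Type*}
  [NormedAddCommGroup E] [NormedSpace ℝ E] [NormedAddCommGroup F] [NormedSpace ℝ F]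
  [NormedAddCommGroup V] [NormedSpace ℝ V] [NormedAddCommGroup V₁] [NormedSpace ℝ V₁]
  [NormedAddCommGroup V₂] [NormedSpace ℝ V₂]

/-- The `n`-th derivatives of the family `a` are dominated by a multiple of the weight `w`. -/
def DerivBound (n : ℕ) (w : ι → E → ℝ) (a : ι → E → V) : Prop :=
  ∃ C : ℝ, 0 ≤ C ∧ ∀ i x, ‖iteratedFDeriv ℝ n (a i) x‖ ≤ C * w i x

/-- A family of smooth functions all of whose derivatives are dominated by the weight `w`,
uniformly in the family. -/
def UniformSymbol (w : ι → E → ℝ) (a : ι → E → V) : Prop :=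
  (∀ i, ContDiff ℝ ∞ (a i)) ∧ ∀ n, DerivBound n w a

/-- The engine of the later inductions on the number of derivatives: the derivative family takes
values in `E →L[ℝ] V`, so several of these inductions let the value space vary. -/
theorem derivBound_succ_iff {n : ℕ} {w : ι → E → ℝ} {a : ι → E → V} :
    DerivBound (n + 1) w a ↔ DerivBound n w (fun i => fderiv ℝ (a i)) := by
  simp only [DerivBound, norm_iteratedFDeriv_fderiv]

theorem derivBound_zero_iff {w : ι → E → ℝ} {a : ι → E → V} :
    DerivBound 0 w a ↔ ∃ C : ℝ, 0 ≤ C ∧ ∀ i x, ‖a i x‖ ≤ C * w i x := by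
  simp only [DerivBound, norm_iteratedFDeriv_zero]

theorem DerivBound.mono {n : ℕ} {w w' : ι → E → ℝ} {a : ι → E → V} (h : DerivBound n w a) (K : ℝ)
    (hK : 0 ≤ K) (hw : ∀ i x, w i x ≤ K * w' i x) : DerivBound n w' a := by
  obtain ⟨C, hC, hb⟩ := h
  refine ⟨C * K, by positivity, fun i x => (hb i x).trans ?_⟩
  rw [mul_assoc]
  exact mul_le_mul_of_nonneg_left (hw i x) hC

theorem DerivBound.add {n : ℕ} {w : ι → E → ℝ} {a b : ι → E → V}
    (ha : ∀ i, ContDiff ℝ ∞ (a i)) (hb : ∀ i, ContDiff ℝ ∞ (b i))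
    (h : DerivBound n w a) (h' : DerivBound n w b) :
    DerivBound n w (fun i x => a i x + b i x) := by
  obtain ⟨C, hC, h⟩ := h
  obtain ⟨C', hC', h'⟩ := h'
  refine ⟨C + C', by positivity, fun i x => ?_⟩
  have e : iteratedFDeriv ℝ n (fun x => a i x + b i x) x
      = iteratedFDeriv ℝ n (a i) x + iteratedFDeriv ℝ n (b i) x :=
    iteratedFDeriv_add_apply ((ha i).of_le (by exact_mod_cast le_top)).contDiffAt
      ((hb i).of_le (by exact_mod_cast le_top)).contDiffAt
  rw [e, add_mul]
  exact (norm_add_le _ _).trans (add_le_add (h i x) (h' i x))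

/-- The operator norm becomes part of the weight, so that a small parameter multiplying a derivative
is not lost. -/
theorem DerivBound.clm_comp {n : ℕ} {w : ι → E → ℝ} {c : ι → ℝ} {a : ι → E → V}
    (ha : ∀ i, ContDiff ℝ ∞ (a i)) (h : DerivBound n w a) (T : ι → V →L[ℝ] V₁)
    (hT : ∀ i, ‖T i‖ ≤ c i) :
    DerivBound n (fun i x => c i * w i x) (fun i x => T i (a i x)) := by
  obtain ⟨C, hC, h⟩ := h
  refine ⟨C, hC, fun i x => ?_⟩
  have h1 := (T i).norm_iteratedFDeriv_comp_left (n := n) (N := ∞) (ha i).contDiffAt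
    (x := x) (by exact_mod_cast le_top)
  have h2 : ‖T i‖ * ‖iteratedFDeriv ℝ n (a i) x‖ ≤ c i * (C * w i x) :=
    mul_le_mul (hT i) (h i x) (norm_nonneg _) ((norm_nonneg _).trans (hT i))
  calc _ ≤ _ := h1
    _ ≤ _ := h2
    _ = _ := by ring

theorem DerivBound.bilinear {n : ℕ} {w₁ w₂ : ι → E → ℝ} {a : ι → E → V₁} {b : ι → E → V₂}
    (B : V₁ →L[ℝ] V₂ →L[ℝ] V) (has : ∀ i, ContDiff ℝ ∞ (a i)) (hbs : ∀ i, ContDiff ℝ ∞ (b i))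
    (ha : ∀ k ≤ n, DerivBound k w₁ a) (hb : ∀ k ≤ n, DerivBound k w₂ b) :
    DerivBound n (fun i x => w₁ i x * w₂ i x) (fun i x => B (a i x) (b i x)) := by
  choose! Ca hCa ha' using ha
  choose! Cb hCb hb' using hb
  refine ⟨‖B‖ * ∑ i ∈ Finset.range (n + 1), (n.choose i : ℝ) * Ca i * Cb (n - i), ?_, ?_⟩
  · refine mul_nonneg (norm_nonneg B) (Finset.sum_nonneg fun i hi => ?_)
    exact mul_nonneg (mul_nonneg (by positivity) (hCa _ (Finset.mem_range_succ_iff.1 hi)))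
      (hCb _ (Nat.sub_le _ _))
  · intro i x
    refine (B.norm_iteratedFDeriv_le_of_bilinear (has i) (hbs i) x
      (n := n) (by exact_mod_cast le_top)).trans ?_
    rw [mul_assoc, Finset.sum_mul]
    refine mul_le_mul_of_nonneg_left (Finset.sum_le_sum fun j hj => ?_) (norm_nonneg B)
    have h1 := ha' j (Finset.mem_range_succ_iff.1 hj) i x
    have h2 := hb' (n - j) (Nat.sub_le _ _) i x
    calc _ = (n.choose j : ℝ) * (‖iteratedFDeriv ℝ j (a i) x‖ *
          ‖iteratedFDeriv ℝ (n - j) (b i) x‖) := by ring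
      _ ≤ (n.choose j : ℝ) * ((Ca j * w₁ i x) * (Cb (n - j) * w₂ i x)) :=
          mul_le_mul_of_nonneg_left (mul_le_mul h1 h2 (norm_nonneg _)
            ((norm_nonneg _).trans h1)) (by positivity)
      _ = _ := by ring

namespace UniformSymbol

theorem contDiff {w : ι → E → ℝ} {a : ι → E → V} (h : UniformSymbol w a) (i : ι) :
    ContDiff ℝ ∞ (a i) := h.1 i

theorem differentiable {w : ι → E → ℝ} {a : ι → E → V} (h : UniformSymbol w a) (i : ι) :
    Differentiable ℝ (a i) := (h.1 i).differentiable (by simp)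

theorem continuous {w : ι → E → ℝ} {a : ι → E → V} (h : UniformSymbol w a) (i : ι) :
    Continuous (a i) := (h.1 i).continuous

theorem bound {w : ι → E → ℝ} {a : ι → E → V} (h : UniformSymbol w a) :
    ∃ C : ℝ, 0 ≤ C ∧ ∀ i x, ‖a i x‖ ≤ C * w i x := derivBound_zero_iff.1 (h.2 0)

theorem fderiv {w : ι → E → ℝ} {a : ι → E → V} (h : UniformSymbol w a) :
    UniformSymbol w (fun i => fderiv ℝ (a i)) :=
  ⟨fun i => (h.1 i).fderiv_right (by simp), fun n => derivBound_succ_iff.1 (h.2 (n + 1))⟩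

theorem of_fderiv {w : ι → E → ℝ} {a : ι → E → V} (hs : ∀ i, ContDiff ℝ ∞ (a i))
    (h0 : ∃ C : ℝ, 0 ≤ C ∧ ∀ i x, ‖a i x‖ ≤ C * w i x)
    (h : UniformSymbol w (fun i => _root_.fderiv ℝ (a i))) : UniformSymbol w a := by
  refine ⟨hs, fun n => ?_⟩
  cases n with
  | zero => exact derivBound_zero_iff.2 h0
  | succ n => exact derivBound_succ_iff.2 (h.2 n)

theorem mono {w w' : ι → E → ℝ} {a : ι → E → V} (h : UniformSymbol w a) (K : ℝ)
    (hK : 0 ≤ K) (hw : ∀ i x, w i x ≤ K * w' i x) : UniformSymbol w' a :=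
  ⟨h.1, fun n => (h.2 n).mono K hK hw⟩

theorem congr {w : ι → E → ℝ} {a b : ι → E → V} (h : UniformSymbol w a)
    (hab : ∀ i x, b i x = a i x) : UniformSymbol w b := by
  have : b = a := by funext i x; exact hab i x
  rwa [this]

/-- Reindexing of a family. -/
theorem reindex {κ : Type*} {w : ι → E → ℝ} {a : ι → E → V} (h : UniformSymbol w a) (σ : κ → ι) :
    UniformSymbol (fun j => w (σ j)) (fun j => a (σ j)) :=
  ⟨fun j => h.1 (σ j), fun n => by
    obtain ⟨C, hC, hb⟩ := h.2 n
    exact ⟨C, hC, fun j => hb (σ j)⟩⟩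

theorem add {w : ι → E → ℝ} {a b : ι → E → V} (ha : UniformSymbol w a) (hb : UniformSymbol w b) :
    UniformSymbol w (fun i x => a i x + b i x) :=
  ⟨fun i => (ha.1 i).add (hb.1 i), fun n => (ha.2 n).add ha.1 hb.1 (hb.2 n)⟩

theorem clm_comp_of_le {w : ι → E → ℝ} {c : ι → ℝ} {a : ι → E → V} (h : UniformSymbol w a)
    (T : ι → V →L[ℝ] V₁) (hT : ∀ i, ‖T i‖ ≤ c i) :
    UniformSymbol (fun i x => c i * w i x) (fun i x => T i (a i x)) :=
  ⟨fun i => (T i).contDiff.comp (h.1 i), fun n => (h.2 n).clm_comp h.1 T hT⟩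

theorem clm_comp {w : ι → E → ℝ} {a : ι → E → V} (h : UniformSymbol w a) (T : V →L[ℝ] V₁) :
    UniformSymbol w (fun i x => T (a i x)) := by
  have h1 := h.clm_comp_of_le (c := fun _ => ‖T‖) (fun _ => T) (fun _ => le_rfl)
  refine ⟨h1.1, fun n => ?_⟩
  obtain ⟨C, hC, hb⟩ := h1.2 n
  exact ⟨C * ‖T‖, by positivity, fun i x => by simpa [mul_assoc] using hb i x⟩

theorem neg {w : ι → E → ℝ} {a : ι → E → V} (ha : UniformSymbol w a) :
    UniformSymbol w (fun i x => - a i x) :=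
  (ha.clm_comp (-ContinuousLinearMap.id ℝ V)).congr fun i x => by simp

theorem sub {w : ι → E → ℝ} {a b : ι → E → V} (ha : UniformSymbol w a) (hb : UniformSymbol w b) :
    UniformSymbol w (fun i x => a i x - b i x) :=
  (ha.add hb.neg).congr fun i x => by simp [sub_eq_add_neg]

theorem zero {w : ι → E → ℝ} :
    UniformSymbol w (fun _ _ => (0 : V)) :=
  ⟨fun _ => contDiff_const, fun n => ⟨0, le_rfl, fun i x => by
    have : (fun _ : E => (0 : V)) = 0 := rfl
    simp [this, iteratedFDeriv_zero]⟩⟩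

theorem sum {κ : Type*} {w : ι → E → ℝ} (s : Finset κ)
    {a : κ → ι → E → V} (ha : ∀ j ∈ s, UniformSymbol w (a j)) :
    UniformSymbol w (fun i x => ∑ j ∈ s, a j i x) := by
  classical
  induction s using Finset.induction_on with
  | empty => simpa using zero
  | insert j s hj ih =>
    have h1 := (ha j (Finset.mem_insert_self _ _)).add
      (ih fun k hk => ha k (Finset.mem_insert_of_mem hk))
    exact h1.congr fun i x => by rw [Finset.sum_insert hj]

theorem const {c : ι → ℝ} (v : ι → V) (hv : ∀ i, ‖v i‖ ≤ c i) :
    UniformSymbol (fun i (_ : E) => c i) (fun i (_ : E) => v i) := by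
  refine of_fderiv (fun i => contDiff_const) ⟨1, zero_le_one, fun i x => by simpa using hv i⟩ ?_
  exact (zero (E := E)).congr fun i x => by simp

theorem linear {c : ι → ℝ} (T : ι → E →L[ℝ] V) (hT : ∀ i, ‖T i‖ ≤ c i) :
    UniformSymbol (fun i (x : E) => c i * (1 + ‖x‖)) (fun i x => T i x) := by
  have hc : ∀ i, 0 ≤ c i := fun i => (norm_nonneg _).trans (hT i)
  refine of_fderiv (fun i => (T i).contDiff) ⟨1, zero_le_one, fun i x => ?_⟩ ?_
  · calc ‖T i x‖ ≤ ‖T i‖ * ‖x‖ := (T i).le_opNorm x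
      _ ≤ c i * (1 + ‖x‖) := mul_le_mul (hT i) (by linarith) (norm_nonneg _) (hc i)
      _ = _ := by ring
  · refine ((const (E := E) T hT).mono 1 zero_le_one fun i x => ?_).congr fun i x => ?_
    · have := mul_nonneg (hc i) (norm_nonneg x)
      linarith
    · exact (T i).fderiv

theorem bilinear {w₁ w₂ : ι → E → ℝ} {a : ι → E → V₁} {b : ι → E → V₂}
    (B : V₁ →L[ℝ] V₂ →L[ℝ] V) (ha : UniformSymbol w₁ a) (hb : UniformSymbol w₂ b) :
    UniformSymbol (fun i x => w₁ i x * w₂ i x) (fun i x => B (a i x) (b i x)) :=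
  ⟨fun i => B.isBoundedBilinearMap.contDiff.comp ((ha.1 i).prodMk (hb.1 i)), fun _ =>
    DerivBound.bilinear B ha.1 hb.1 (fun k _ => ha.2 k) (fun k _ => hb.2 k)⟩

/-- Composition with a family of affine maps with uniformly bounded linear parts. -/
theorem comp_affine {w : ι → F → ℝ} {a : ι → F → V} (h : UniformSymbol w a)
    (T : ι → E →L[ℝ] F) (y : ι → F) {K : ℝ} (hT : ∀ i, ‖T i‖ ≤ K) :
    UniformSymbol (fun i x => w i (y i + T i x)) (fun i x => a i (y i + T i x)) := by
  have hs : ∀ i, ContDiff ℝ ∞ (fun z => a i (y i + z)) := fun i =>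
    (h.1 i).comp (contDiff_const.add contDiff_id)
  refine ⟨fun i => (hs i).comp (T i).contDiff, fun n => ?_⟩
  obtain ⟨C, hC, hb⟩ := h.2 n
  refine ⟨C * |K| ^ n, by positivity, fun i x => ?_⟩
  have e := (T i).iteratedFDeriv_comp_right (f := fun z => a i (y i + z)) (hs i) x (i := n)
    (by exact_mod_cast le_top)
  have e' : iteratedFDeriv ℝ n (fun z => a i (y i + T i z)) x = _ := e
  rw [e', iteratedFDeriv_comp_add_left]
  refine (ContinuousMultilinearMap.norm_compContinuousLinearMap_le _ _).trans ?_
  rw [Finset.prod_const, Finset.card_univ, Fintype.card_fin]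
  calc _ ≤ (C * w i (y i + T i x)) * |K| ^ n :=
        mul_le_mul (hb i _) (pow_le_pow_left₀ (norm_nonneg _) ((hT i).trans (le_abs_self K)) n)
          (by positivity) ((norm_nonneg _).trans (hb i _))
    _ = _ := by ring

end UniformSymbol

end DerivBounds

/-! ### The quadratic phase on doubled phase space -/

/-- Doubled phase space: a point is `Z = (X', X'')`. -/
abbrev DPhase := Phase × Phase

instance : (volume : Measure Phase).IsAddHaarMeasure :=
  inferInstanceAs ((volume : Measure E3).prod volume).IsAddHaarMeasure

instance : (volume : Measure DPhase).IsAddHaarMeasure :=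
  Measure.prod.instIsAddHaarMeasure (volume : Measure Phase) (volume : Measure Phase)

/-- The phase `r' · k'' - r'' · k'`. -/
def phaseQ (Z : DPhase) : ℝ := inner ℝ Z.1.1 Z.2.2 - inner ℝ Z.2.1 Z.1.2

/-- Indices of the coordinate directions `r'`, `k'`, `r''`, `k''`. -/
abbrev DirIdx := Fin 3 ⊕ Fin 3 ⊕ Fin 3 ⊕ Fin 3

/-- The coordinate directions of doubled phase space. -/
def dir : DirIdx → DPhase
  | .inl j => ((EuclideanSpace.single j 1, 0), (0, 0))
  | .inr (.inl j) => ((0, EuclideanSpace.single j 1), (0, 0))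
  | .inr (.inr (.inl j)) => ((0, 0), (EuclideanSpace.single j 1, 0))
  | .inr (.inr (.inr j)) => ((0, 0), (0, EuclideanSpace.single j 1))

/-- The directions dual to `dir` with respect to the polarisation of `phaseQ`. -/
def codir : DirIdx → DPhase
  | .inl j => ((0, 0), (0, EuclideanSpace.single j 1))
  | .inr (.inl j) => -((0, 0), (EuclideanSpace.single j 1, 0))
  | .inr (.inr (.inl j)) => -((0, EuclideanSpace.single j 1), (0, 0))
  | .inr (.inr (.inr j)) => ((EuclideanSpace.single j 1, 0), (0, 0))

/-- The derivative of `phaseQ` in the direction `dir α`, a linear coordinate. -/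
def coord : DirIdx → DPhase →L[ℝ] ℝ
  | .inl j => (EuclideanSpace.proj j : E3 →L[ℝ] ℝ) ∘L .snd ℝ E3 E3 ∘L .snd ℝ Phase Phase
  | .inr (.inl j) => -((EuclideanSpace.proj j : E3 →L[ℝ] ℝ) ∘L .fst ℝ E3 E3 ∘L .snd ℝ Phase Phase)
  | .inr (.inr (.inl j)) =>
    -((EuclideanSpace.proj j : E3 →L[ℝ] ℝ) ∘L .snd ℝ E3 E3 ∘L .fst ℝ Phase Phase)
  | .inr (.inr (.inr j)) =>
    (EuclideanSpace.proj j : E3 →L[ℝ] ℝ) ∘L .fst ℝ E3 E3 ∘L .fst ℝ Phase Phase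

theorem sum_smul_single (x : E3) : ∑ j, x j • EuclideanSpace.single j (1 : ℝ) = x := by
  ext i
  simp [Finset.sum_apply, Pi.single_apply]

theorem sum_coord_smul_codir (Z : DPhase) : ∑ α, coord α Z • codir α = Z := by
  obtain ⟨⟨r, k⟩, ⟨r', k'⟩⟩ := Z
  simp only [Fintype.sum_sum_type, coord, codir]
  ext : 2 <;> simp [Prod.fst_sum, Prod.snd_sum, sum_smul_single]

/-- Each coordinate direction is isotropic for the phase, so moving a derivative along `dir α` past
the factor `coord α` leaves no zeroth-order term in the integrations by parts. -/
theorem coord_dir (α : DirIdx) : coord α (dir α) = 0 := by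
  rcases α with j | j | j | j <;> simp [coord, dir]

theorem contDiff_phaseQ : ContDiff ℝ ∞ phaseQ := by
  unfold phaseQ
  exact ((contDiff_fst.comp contDiff_fst).inner ℝ (contDiff_snd.comp contDiff_snd)).sub
    ((contDiff_fst.comp contDiff_snd).inner ℝ (contDiff_snd.comp contDiff_fst))

theorem fderiv_phaseQ_dir (Z : DPhase) (α : DirIdx) : fderiv ℝ phaseQ Z (dir α) = coord α Z := by
  have h : HasFDerivAt phaseQ _ Z :=
    ((hasFDerivAt_fst.comp Z hasFDerivAt_fst).inner ℝ (hasFDerivAt_snd.comp Z hasFDerivAt_snd)).sub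
    ((hasFDerivAt_fst.comp Z hasFDerivAt_snd).inner ℝ (hasFDerivAt_snd.comp Z hasFDerivAt_fst))
  rw [h.fderiv]
  rcases α with j | j | j | j <;>
    simp [coord, dir, EuclideanSpace.inner_single_left, EuclideanSpace.inner_single_right]

/-- The oscillating factor `e^{i (r' · k'' - r'' · k')}`. -/
def osc (Z : DPhase) : ℂ := Complex.exp (Complex.I * (phaseQ Z : ℂ))

theorem norm_osc (Z : DPhase) : ‖osc Z‖ = 1 := by
  rw [osc, mul_comm, Complex.norm_exp_ofReal_mul_I]

theorem contDiff_osc : ContDiff ℝ ∞ osc :=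
  (contDiff_const.mul (Complex.ofRealCLM.contDiff.comp contDiff_phaseQ)).cexp

theorem fderiv_osc_dir (Z : DPhase) (α : DirIdx) :
    fderiv ℝ osc Z (dir α) = Complex.I * (coord α Z : ℂ) * osc Z := by
  have hQ := (contDiff_phaseQ.differentiable (by simp) Z).hasFDerivAt
  have h1 : HasFDerivAt (fun Z => Complex.I * (phaseQ Z : ℂ)) _ Z :=
    (Complex.ofRealCLM.hasFDerivAt.comp Z hQ).const_mul Complex.I
  have h : HasFDerivAt osc _ Z := h1.cexp
  rw [h.fderiv]
  simp [fderiv_phaseQ_dir, osc]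
  ring

/-! ### The quadratic weight -/

/-- `1 + |Z|²`. -/
def quadWeight (Z : DPhase) : ℝ := 1 + ∑ α, coord α Z ^ 2

theorem one_le_quadWeight (Z : DPhase) : 1 ≤ quadWeight Z :=
  le_add_of_nonneg_right (Finset.sum_nonneg fun _ _ => sq_nonneg _)

theorem quadWeight_pos (Z : DPhase) : 0 < quadWeight Z := zero_lt_one.trans_le (one_le_quadWeight Z)

theorem contDiff_quadWeight : ContDiff ℝ ∞ quadWeight :=
  contDiff_const.add (ContDiff.sum fun α _ => (coord α).contDiff.pow 2)

/-- The derivative of `quadWeight` as a linear map. -/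
def quadWeightDeriv : DPhase →L[ℝ] DPhase →L[ℝ] ℝ :=
  ∑ α, (2 : ℝ) • (coord α).smulRight (coord α)

theorem fderiv_quadWeight (Z : DPhase) : fderiv ℝ quadWeight Z = quadWeightDeriv Z := by
  have h : HasFDerivAt quadWeight _ Z := (hasFDerivAt_const (1 : ℝ) Z).add
    (HasFDerivAt.fun_sum (u := Finset.univ) fun α _ => (coord α).hasFDerivAt.pow 2)
  rw [h.fderiv]
  ext H <;> simp [quadWeightDeriv, mul_assoc]

/-- The norm of a product is a maximum norm, whereas `quadWeight` is a sum of squares of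
coordinates; `sum_coord_smul_codir` mediates between them. -/
theorem exists_le_quadWeight : ∃ K : ℝ, 0 < K ∧ ∀ Z : DPhase, (1 + ‖Z‖) ^ 2 ≤ K * quadWeight Z := by
  set S : ℝ := ∑ α, ‖codir α‖ with hS
  have hS0 : 0 ≤ S := Finset.sum_nonneg fun _ _ => norm_nonneg _
  refine ⟨2 * (1 + S ^ 2), by positivity, fun Z => ?_⟩
  have h1 : ‖Z‖ ≤ Real.sqrt (∑ α, coord α Z ^ 2) * S := by
    conv_lhs => rw [← sum_coord_smul_codir Z]
    rw [hS, Finset.mul_sum]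
    refine (norm_sum_le _ _).trans (Finset.sum_le_sum fun α _ => ?_)
    rw [norm_smul, Real.norm_eq_abs]
    refine mul_le_mul_of_nonneg_right (Real.abs_le_sqrt ?_) (norm_nonneg _)
    exact Finset.single_le_sum (f := fun β => coord β Z ^ 2) (fun _ _ => sq_nonneg _)
      (Finset.mem_univ α)
  have hnn : (0 : ℝ) ≤ ∑ α, coord α Z ^ 2 := Finset.sum_nonneg fun _ _ => sq_nonneg _
  have h2 : ‖Z‖ ^ 2 ≤ (∑ α, coord α Z ^ 2) * S ^ 2 := by
    calc ‖Z‖ ^ 2 ≤ (Real.sqrt (∑ α, coord α Z ^ 2) * S) ^ 2 :=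
          pow_le_pow_left₀ (norm_nonneg _) h1 2
      _ = _ := by rw [mul_pow, Real.sq_sqrt hnn]
  have h3 : 0 ≤ S ^ 2 := sq_nonneg _
  rw [quadWeight]
  -- (1 + x)² ≤ 2(1 + x²).
  nlinarith [sq_nonneg (1 - ‖Z‖)]

theorem bracket_pos {E : Type*} [SeminormedAddCommGroup E] (Z : E) (r : ℝ) :
    0 < (1 + ‖Z‖) ^ r := by positivity

theorem bracket_le {E : Type*} [SeminormedAddCommGroup E] (Z : E) {r s : ℝ} (h : r ≤ s) :
    (1 + ‖Z‖) ^ r ≤ (1 + ‖Z‖) ^ s :=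
  Real.rpow_le_rpow_of_exponent_le (by linarith [norm_nonneg Z]) h

theorem bracket_mul {E : Type*} [SeminormedAddCommGroup E] (Z : E) (r s : ℝ) :
    (1 + ‖Z‖) ^ r * (1 + ‖Z‖) ^ s = (1 + ‖Z‖) ^ (r + s) :=
  (Real.rpow_add (by positivity) r s).symm

theorem contDiff_quadWeight_inv : ContDiff ℝ ∞ (fun Z => (quadWeight Z)⁻¹) :=
  contDiff_quadWeight.inv fun Z => (quadWeight_pos Z).ne'

theorem uniformSymbol_quadWeightDeriv {ι : Type*} :
    UniformSymbol (fun (_ : ι) (Z : DPhase) => (1 + ‖Z‖) ^ (1 : ℝ)) (fun _ Z => quadWeightDeriv Z) :=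
  (UniformSymbol.linear (ι := ι) (c := fun _ => ‖quadWeightDeriv‖) (fun _ => quadWeightDeriv)
    fun _ => le_rfl).mono ‖quadWeightDeriv‖ (norm_nonneg quadWeightDeriv) fun i x => by simp

theorem uniformSymbol_coord {ι : Type*} (α : DirIdx) :
    UniformSymbol (fun (_ : ι) (Z : DPhase) => (1 + ‖Z‖) ^ (1 : ℝ)) (fun _ Z => coord α Z) :=
  (UniformSymbol.linear (ι := ι) (c := fun _ => ‖coord α‖) (fun _ => coord α)
    fun _ => le_rfl).mono ‖coord α‖ (norm_nonneg _) fun i x => by simp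

/-- The derivative of q⁻¹ is -q⁻²q', of order -2 - 2 + 1 = -3. This is better than the order -2
asked for, so strong induction closes. -/
theorem uniformSymbol_quadWeight_inv {ι : Type*} :
    UniformSymbol (fun (_ : ι) (Z : DPhase) => (1 + ‖Z‖) ^ (-2 : ℝ))
      (fun _ Z => (quadWeight Z)⁻¹) := by
  refine ⟨fun _ => contDiff_quadWeight_inv, fun n => ?_⟩
  induction n using Nat.strong_induction_on with
  | _ n ih =>
    cases n with
    | zero =>
      obtain ⟨K, hK, hle⟩ := exists_le_quadWeight
      refine derivBound_zero_iff.2 ⟨K, hK.le, fun _ Z => ?_⟩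
      have hp : (0 : ℝ) < (1 + ‖Z‖) ^ 2 := by positivity
      rw [norm_inv, Real.norm_of_nonneg (quadWeight_pos Z).le, Real.rpow_neg (by positivity)]
      norm_cast
      rw [inv_eq_one_div, div_le_iff₀ (quadWeight_pos Z)]
      have := hle Z
      calc (1 : ℝ) = ((1 + ‖Z‖) ^ 2)⁻¹ * (1 + ‖Z‖) ^ 2 := (inv_mul_cancel₀ hp.ne').symm
        _ ≤ ((1 + ‖Z‖) ^ 2)⁻¹ * (K * quadWeight Z) := by gcongr
        _ = _ := by ring
    | succ n =>
      rw [derivBound_succ_iff]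
      have h1 : ∀ k ≤ n, DerivBound k (fun (_ : ι) (Z : DPhase) => (1 + ‖Z‖) ^ (-2 : ℝ))
        (fun _ Z => (quadWeight Z)⁻¹) := fun k hk => ih k (Nat.lt_succ_of_le hk)
      have h2 : ∀ k ≤ n, DerivBound k
          (fun (_ : ι) (Z : DPhase) => (1 + ‖Z‖) ^ (-2 : ℝ) * (1 + ‖Z‖) ^ (-2 : ℝ))
          (fun _ Z => (quadWeight Z)⁻¹ * (quadWeight Z)⁻¹) := fun k hk =>
        DerivBound.bilinear (ContinuousLinearMap.mul ℝ ℝ) (fun _ => contDiff_quadWeight_inv)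
          (fun _ => contDiff_quadWeight_inv) (fun j hj => h1 j (hj.trans hk))
          (fun j hj => h1 j (hj.trans hk))
      have h3 := DerivBound.bilinear (n := n)
        (-(ContinuousLinearMap.lsmul ℝ ℝ : ℝ →L[ℝ] (DPhase →L[ℝ] ℝ) →L[ℝ] (DPhase →L[ℝ] ℝ)))
        (fun _ => contDiff_quadWeight_inv.mul contDiff_quadWeight_inv)
        (uniformSymbol_quadWeightDeriv (ι := ι)).1 h2
        (fun k _ => (uniformSymbol_quadWeightDeriv (ι := ι)).2 k)
      have e : (fun _ : ι => fderiv ℝ fun Z => (quadWeight Z)⁻¹) = fun (_ : ι) Z =>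
          (-(ContinuousLinearMap.lsmul ℝ ℝ : ℝ →L[ℝ] (DPhase →L[ℝ] ℝ) →L[ℝ] (DPhase →L[ℝ] ℝ)))
            ((quadWeight Z)⁻¹ * (quadWeight Z)⁻¹) (quadWeightDeriv Z) := by
        funext _ Z
        have h := (contDiff_quadWeight.differentiable (by simp) Z).hasFDerivAt
        have h' : HasFDerivAt (fun Z => (quadWeight Z)⁻¹) _ Z :=
          (hasDerivAt_inv (quadWeight_pos Z).ne').comp_hasFDerivAt Z h
        rw [h'.fderiv, fderiv_quadWeight]
        ext <;> simp [pow_two]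
      rw [e]
      refine h3.mono 1 zero_le_one fun _ Z => ?_
      rw [bracket_mul, bracket_mul, one_mul]
      exact bracket_le Z (by norm_num)

/-! ### Integration by parts against the oscillating factor -/

section IntegrationByParts

variable {ι : Type*} {V : Type*} [NormedAddCommGroup V] [NormedSpace ℝ V] [NormedSpace ℂ V]
  [IsScalarTower ℝ ℂ V]

/-- Multiplication by a complex scalar as a real bilinear map. -/
def smulC (V : Type*) [NormedAddCommGroup V] [NormedSpace ℝ V] [NormedSpace ℂ V]
    [IsScalarTower ℝ ℂ V] : ℂ →L[ℝ] V →L[ℝ] V := ContinuousLinearMap.lsmul ℝ ℂ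

theorem smulC_apply (c : ℂ) (v : V) : smulC V c v = c • v := rfl

theorem real_smul_eq_coe_smul (r : ℝ) (v : V) : r • v = (r : ℂ) • v :=
  (algebraMap_smul ℂ r v).symm

theorem UniformSymbol.const_smul {E : Type*} [NormedAddCommGroup E] [NormedSpace ℝ E]
    {w : ι → E → ℝ} {a : ι → E → V} (h : UniformSymbol w a) (c : ℂ) :
    UniformSymbol w (fun i x => c • a i x) := h.clm_comp (smulC V c)

/-- Multiplication of a complex and a vector valued family. -/
theorem UniformSymbol.smul {E : Type*} [NormedAddCommGroup E] [NormedSpace ℝ E]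
    {w w' : ι → E → ℝ} {c : ι → E → ℂ} {a : ι → E → V} (hc : UniformSymbol w c)
    (ha : UniformSymbol w' a) :
    UniformSymbol (fun i x => w i x * w' i x) (fun i x => c i x • a i x) :=
  hc.bilinear (smulC V) ha

/-- Division by the quadratic weight. -/
def divQuad (b : DPhase → V) (Z : DPhase) : V := (quadWeight Z)⁻¹ • b Z

/-- The first-order differential operator whose transpose fixes the oscillating factor; it lowers
the order of an amplitude by one. -/
def ibpOp (b : DPhase → V) (Z : DPhase) : V :=
  divQuad b Z + Complex.I • ∑ α, coord α Z • fderiv ℝ (divQuad b) Z (dir α)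

theorem UniformSymbol.divQuad {c : ι → ℝ} {m : ℝ} {b : ι → DPhase → V}
    (h : UniformSymbol (fun i Z => c i * (1 + ‖Z‖) ^ m) b) :
    UniformSymbol (fun i Z => c i * (1 + ‖Z‖) ^ (m - 2)) (fun i => divQuad (b i)) := by
  have h1 := uniformSymbol_quadWeight_inv.bilinear (ContinuousLinearMap.lsmul ℝ ℝ) h
  refine (h1.mono 1 zero_le_one fun i Z => ?_)
  rw [one_mul, mul_left_comm, bracket_mul, show -2 + m = m - 2 by ring]

theorem UniformSymbol.coord_smul {c : ι → ℝ} {m : ℝ} {b : ι → DPhase → V} (α : DirIdx)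
    (h : UniformSymbol (fun i Z => c i * (1 + ‖Z‖) ^ m) b) :
    UniformSymbol (fun i Z => c i * (1 + ‖Z‖) ^ (m + 1)) (fun i Z => coord α Z • b i Z) := by
  refine ((uniformSymbol_coord α).bilinear (ContinuousLinearMap.lsmul ℝ ℝ) h).mono 1 zero_le_one
    fun i Z => ?_
  rw [one_mul, mul_left_comm, bracket_mul, show 1 + m = m + 1 by ring]

theorem UniformSymbol.fderiv_apply {E : Type*} [NormedAddCommGroup E] [NormedSpace ℝ E]
    {w : ι → E → ℝ} {a : ι → E → V} (h : UniformSymbol w a) (v : E) :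
    UniformSymbol w (fun i x => _root_.fderiv ℝ (a i) x v) :=
  h.fderiv.clm_comp (ContinuousLinearMap.apply ℝ V v)

theorem UniformSymbol.bracket_mono {c : ι → ℝ} (hc : ∀ i, 0 ≤ c i) {m m' : ℝ}
    {b : ι → DPhase → V} (h : UniformSymbol (fun i Z => c i * (1 + ‖Z‖) ^ m) b) (hm : m ≤ m') :
    UniformSymbol (fun i Z => c i * (1 + ‖Z‖) ^ m') b :=
  h.mono 1 zero_le_one fun i Z => by
    rw [one_mul]
    exact mul_le_mul_of_nonneg_left (bracket_le Z hm) (hc i)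

/-- Division by the weight gains two powers, a derivative gains nothing (symbols of type 0), and the
coordinate loses one. -/
theorem UniformSymbol.ibpOp {c : ι → ℝ} (hc : ∀ i, 0 ≤ c i) {m : ℝ} {b : ι → DPhase → V}
    (h : UniformSymbol (fun i Z => c i * (1 + ‖Z‖) ^ m) b) :
    UniformSymbol (fun i Z => c i * (1 + ‖Z‖) ^ (m - 1)) (fun i => ibpOp (b i)) := by
  have h1 := h.divQuad
  have h2 := (UniformSymbol.sum Finset.univ fun α _ =>
    (h1.fderiv_apply (dir α)).coord_smul α).const_smul Complex.I
  exact (h1.bracket_mono hc (by linarith)).add (h2.bracket_mono hc (by linarith))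

theorem UniformSymbol.ibpOp_iterate {c : ι → ℝ} (hc : ∀ i, 0 ≤ c i) {m : ℝ} (N : ℕ)
    {b : ι → DPhase → V} (h : UniformSymbol (fun i Z => c i * (1 + ‖Z‖) ^ m) b) :
    UniformSymbol (fun i Z => c i * (1 + ‖Z‖) ^ (m - N)) (fun i => RayOptics.ibpOp^[N] (b i)) := by
  induction N with
  | zero => simpa using h
  | succ N ih =>
    simp only [Function.iterate_succ_apply']
    have := ih.ibpOp hc
    push_cast
    rwa [show m - (N + 1 : ℝ) = m - N - 1 by ring]

theorem contDiff_divQuad {b : DPhase → V} (hb : ContDiff ℝ ∞ b) : ContDiff ℝ ∞ (divQuad b) :=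
  contDiff_quadWeight_inv.smul hb

theorem contDiff_ibpOp {b : DPhase → V} (hb : ContDiff ℝ ∞ b) : ContDiff ℝ ∞ (ibpOp b) := by
  have h1 := contDiff_divQuad hb
  have h2 : ContDiff ℝ ∞ (fderiv ℝ (divQuad b)) := h1.fderiv_right (by simp)
  have h3 : ContDiff ℝ ∞ (fun Z => ∑ α, coord α Z • fderiv ℝ (divQuad b) Z (dir α)) :=
    ContDiff.sum fun α _ => (coord α).contDiff.smul (h2.clm_apply contDiff_const)
  exact h1.add ((smulC V Complex.I).contDiff.comp h3)

theorem contDiff_ibpOp_iterate (N : ℕ) {b : DPhase → V} (hb : ContDiff ℝ ∞ b) :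
    ContDiff ℝ ∞ (ibpOp^[N] b) := by
  induction N with
  | zero => exact hb
  | succ N ih => rw [Function.iterate_succ_apply']; exact contDiff_ibpOp ih

theorem ibpOp_add {a b : DPhase → V} (ha : ContDiff ℝ ∞ a) (hb : ContDiff ℝ ∞ b) :
    ibpOp (a + b) = ibpOp a + ibpOp b := by
  have e : divQuad (a + b) = divQuad a + divQuad b := by
    funext Z; simp [divQuad]
  funext Z
  have e' : fderiv ℝ (divQuad a + divQuad b) Z = fderiv ℝ (divQuad a) Z + fderiv ℝ (divQuad b) Z :=
    fderiv_add ((contDiff_divQuad ha).differentiable (by simp) Z)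
      ((contDiff_divQuad hb).differentiable (by simp) Z)
  simp only [ibpOp, e, e', Pi.add_apply, add_apply, smul_add,
    Finset.sum_add_distrib]
  abel

theorem ibpOp_const_smul {a : DPhase → V} (ha : ContDiff ℝ ∞ a) (c : ℂ) :
    ibpOp (c • a) = c • ibpOp a := by
  have e : divQuad (c • a) = fun Z => smulC V c (divQuad a Z) := by
    funext Z; exact smul_comm _ _ _
  funext Z
  have e' : fderiv ℝ (divQuad (c • a)) Z = (smulC V c).comp (fderiv ℝ (divQuad a) Z) := by
    rw [e]
    exact ((smulC V c).hasFDerivAt.comp Z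
      ((contDiff_divQuad ha).differentiable (by simp) Z).hasFDerivAt).fderiv
  simp only [ibpOp, e', Pi.smul_apply, ContinuousLinearMap.comp_apply, smulC_apply, smul_add,
    Finset.smul_sum]
  rw [e]
  simp only [smulC_apply]
  congr 1
  refine Finset.sum_congr rfl fun α _ => ?_
  rw [smul_comm (coord α Z) c, smul_comm Complex.I c]

theorem ibpOp_iterate_add (N : ℕ) {a b : DPhase → V} (ha : ContDiff ℝ ∞ a)
    (hb : ContDiff ℝ ∞ b) : ibpOp^[N] (a + b) = ibpOp^[N] a + ibpOp^[N] b := by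
  induction N with
  | zero => rfl
  | succ N ih =>
    simp only [Function.iterate_succ_apply']
    rw [ih, ibpOp_add (contDiff_ibpOp_iterate N ha) (contDiff_ibpOp_iterate N hb)]

theorem ibpOp_iterate_const_smul (N : ℕ) {a : DPhase → V} (ha : ContDiff ℝ ∞ a) (c : ℂ) :
    ibpOp^[N] (c • a) = c • ibpOp^[N] a := by
  induction N with
  | zero => rfl
  | succ N ih =>
    simp only [Function.iterate_succ_apply']
    rw [ih, ibpOp_const_smul (contDiff_ibpOp_iterate N ha)]

/-- Doubled phase space has dimension 12, so any exponent below -12 would do; -13 is the one used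
throughout. -/
theorem integrable_bracket {r : ℝ} (hr : r ≤ -13) :
    Integrable (fun Z : DPhase => (1 + ‖Z‖) ^ r) := by
  have h : ((Module.finrank ℝ DPhase : ℕ) : ℝ) < -r := by
    have : Module.finrank ℝ DPhase = 12 := by simp
    rw [this]; push_cast; linarith
  simpa using integrable_one_add_norm (μ := (volume : Measure DPhase)) h

theorem integrable_osc_smul {b : DPhase → V} (hb : Continuous b) {C r : ℝ} (hr : r ≤ -13)
    (h : ∀ Z, ‖b Z‖ ≤ C * (1 + ‖Z‖) ^ r) : Integrable (fun Z => osc Z • b Z) := by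
  refine ((integrable_bracket hr).const_mul C).mono'
    (contDiff_osc.continuous.smul hb).aestronglyMeasurable (ae_of_all _ fun Z => ?_)
  rw [norm_smul, norm_osc, one_mul]
  exact h Z

theorem UniformSymbol.integrable_osc_smul {c : ι → ℝ} {r : ℝ} {b : ι → DPhase → V}
    (h : UniformSymbol (fun i Z => c i * (1 + ‖Z‖) ^ r) b) (hr : r ≤ -13) (i : ι) :
    Integrable (fun Z => osc Z • b i Z) := by
  obtain ⟨C, _, hC⟩ := h.bound
  exact RayOptics.integrable_osc_smul (h.continuous i) (C := C * c i) hr fun Z => by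
    simpa [mul_assoc] using hC i Z

theorem integral_osc_smul_fderiv {b : DPhase → V} (α : DirIdx)
    (hb : ContDiff ℝ ∞ b)
    (h0 : Integrable (fun Z => osc Z • b Z)) (h1 : Integrable (fun Z => osc Z • fderiv ℝ b Z (dir α)))
    (h2 : Integrable (fun Z => osc Z • coord α Z • b Z)) :
    ∫ Z, osc Z • fderiv ℝ b Z (dir α) = -(Complex.I • ∫ Z, osc Z • coord α Z • b Z) := by
  have e : ∀ Z, smulC V (fderiv ℝ osc Z (dir α)) (b Z) = Complex.I • osc Z • coord α Z • b Z := by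
    intro Z
    rw [fderiv_osc_dir, smulC_apply, real_smul_eq_coe_smul, ← mul_smul, ← mul_smul]
    congr 1
    ring
  have key := integral_bilinear_fderiv_right_eq_neg_left_of_integrable (μ := (volume : Measure DPhase))
    (f := osc) (g := b) (v := dir α) (B := smulC V)
    (by simp_rw [e]; exact h2.smul Complex.I) h1 h0
    (fun Z _ => contDiff_osc.differentiable (by simp) Z)
    (fun Z _ => hb.differentiable (by simp) Z)
  simp_rw [e] at key
  rw [integral_smul] at key
  exact key

/-- With c = b/q one has b = c + ∑ x_α² c and x_α e^{iQ} = -i ∂_α e^{iQ}. Moving ∂_α onto x_α c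
gives i x_α ∂_α c because ∂_α x_α = 0, and the sum is `ibpOp b`. -/
theorem integral_osc_smul_ibpOp {b : DPhase → V}
    (h : UniformSymbol (fun (_ : Unit) Z => (1 : ℝ) * (1 + ‖Z‖) ^ (-13 : ℝ)) fun _ => b) :
    ∫ Z, osc Z • ibpOp b Z = ∫ Z, osc Z • b Z := by
  have hc := h.divQuad
  have hs : ContDiff ℝ ∞ (divQuad b) := hc.1 ()
  have i0 : Integrable (fun Z => osc Z • divQuad b Z) := hc.integrable_osc_smul (by norm_num) ()
  have i1 : ∀ α, Integrable (fun Z => osc Z • coord α Z • fderiv ℝ (divQuad b) Z (dir α)) := fun α =>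
    ((hc.fderiv_apply (dir α)).coord_smul α).integrable_osc_smul (by norm_num) ()
  -- The order is -13 - 2 + 1 + 1 = -13, just integrable.
  have i2 : ∀ α, Integrable (fun Z => osc Z • coord α Z • coord α Z • divQuad b Z) := fun α =>
    ((hc.coord_smul α).coord_smul α).integrable_osc_smul (by norm_num) ()
  have i3 : ∀ α, Integrable (fun Z => osc Z • coord α Z • divQuad b Z) := fun α =>
    (hc.coord_smul α).integrable_osc_smul (by norm_num) ()
  have hd : ∀ α Z, fderiv ℝ (fun W => coord α W • divQuad b W) Z (dir α)
      = coord α Z • fderiv ℝ (divQuad b) Z (dir α) := fun α Z => by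
    have := ((coord α).hasFDerivAt (x := Z)).smul (hs.differentiable (by simp) Z).hasFDerivAt
    have e : fderiv ℝ (fun W => coord α W • divQuad b W) Z = _ := this.fderiv
    rw [e]
    simp [coord_dir]
  have key : ∀ α, ∫ Z, osc Z • coord α Z • fderiv ℝ (divQuad b) Z (dir α)
      = -(Complex.I • ∫ Z, osc Z • coord α Z • coord α Z • divQuad b Z) := fun α => by
    have := integral_osc_smul_fderiv α (b := fun W => coord α W • divQuad b W)
      ((coord α).contDiff.smul hs) (i3 α) (by simp_rw [hd]; exact i1 α) (i2 α)
    simpa only [hd] using this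
  have e1 : ∫ Z, osc Z • ibpOp b Z = (∫ Z, osc Z • divQuad b Z) +
      Complex.I • ∑ α, ∫ Z, osc Z • coord α Z • fderiv ℝ (divQuad b) Z (dir α) := by
    rw [← integral_finsetSum _ fun α _ => i1 α, ← integral_smul, ← integral_add i0]
    · refine integral_congr_ae (ae_of_all _ fun Z => ?_)
      simp only [ibpOp, smul_add, Finset.smul_sum]
      congr 1
      exact Finset.sum_congr rfl fun α _ => smul_comm _ _ _
    · exact (integrable_finsetSum _ fun α _ => i1 α).smul Complex.I
  have e2 : ∫ Z, osc Z • b Z = (∫ Z, osc Z • divQuad b Z) +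
      ∑ α, ∫ Z, osc Z • coord α Z • coord α Z • divQuad b Z := by
    rw [← integral_finsetSum _ fun α _ => i2 α, ← integral_add i0]
    · refine integral_congr_ae (ae_of_all _ fun Z => ?_)
      simp only [← Finset.smul_sum, ← smul_add]
      congr 1
      have : b Z = quadWeight Z • divQuad b Z := by
        rw [divQuad, smul_inv_smul₀ (quadWeight_pos Z).ne']
      conv_lhs => rw [this, quadWeight, add_smul, one_smul, Finset.sum_smul]
      simp only [pow_two, mul_smul]
    · exact integrable_finsetSum _ fun α _ => i2 α
  rw [e1, e2]
  congr 1
  simp_rw [key]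
  rw [Finset.smul_sum]
  refine Finset.sum_congr rfl fun α _ => ?_
  rw [smul_neg, ← mul_smul, Complex.I_mul_I, neg_smul, one_smul, neg_neg]

theorem integral_osc_smul_ibpOp_iterate (N : ℕ) {b : DPhase → V}
    (h : UniformSymbol (fun (_ : Unit) Z => (1 : ℝ) * (1 + ‖Z‖) ^ (-13 : ℝ)) fun _ => b) :
    ∫ Z, osc Z • ibpOp^[N] b Z = ∫ Z, osc Z • b Z := by
  induction N with
  | zero => rfl
  | succ N ih =>
    have h1 := h.ibpOp_iterate (fun _ => zero_le_one) N
    rw [← ih, Function.iterate_succ_apply']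
    exact integral_osc_smul_ibpOp (h1.bracket_mono (fun _ => zero_le_one) (by
      have : (0 : ℝ) ≤ N := by positivity
      linarith))

end IntegrationByParts

/-! ### Oscillatory integrals -/

/-- Smooth functions all of whose derivatives decay faster than any power. -/
def RapidDecay (χ : DPhase → ℂ) : Prop :=
  ∀ r : ℝ, UniformSymbol (fun (_ : Unit) (Z : DPhase) => (1 + ‖Z‖) ^ r) (fun _ => χ)

section Cutoff

variable {ι : Type*} {V : Type*} [NormedAddCommGroup V] [NormedSpace ℝ V] [NormedSpace ℂ V]
  [IsScalarTower ℝ ℂ V]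

theorem norm_smul_id_le {E : Type*} [NormedAddCommGroup E] [NormedSpace ℝ E] (t : ℝ) :
    ‖t • ContinuousLinearMap.id ℝ E‖ ≤ |t| := by
  rw [norm_smul, Real.norm_eq_abs]
  exact mul_le_of_le_one_right (abs_nonneg t) ContinuousLinearMap.norm_id_le

theorem fderiv_comp_smul {E W : Type*} [NormedAddCommGroup E] [NormedSpace ℝ E]
    [NormedAddCommGroup W] [NormedSpace ℝ W] {f : E → W} (hf : Differentiable ℝ f) (t : ℝ) (Z : E) :
    fderiv ℝ (fun Z => f (t • Z)) Z = t • fderiv ℝ f (t • Z) := by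
  have h1 : HasFDerivAt (fun Z : E => t • Z) (t • ContinuousLinearMap.id ℝ E) Z :=
    (hasFDerivAt_id Z).const_smul t
  have h : HasFDerivAt (fun Z => f (t • Z)) _ Z := (hf (t • Z)).hasFDerivAt.comp Z h1
  rw [h.fderiv]
  ext; simp

theorem UniformSymbol.comp_smul {E W : Type*} [NormedAddCommGroup E] [NormedSpace ℝ E]
    [NormedAddCommGroup W] [NormedSpace ℝ W] {w : ι → E → ℝ} {a : ι → E → W}
    (h : UniformSymbol w a) (t : ι → ℝ) {K : ℝ} (ht : ∀ i, |t i| ≤ K) :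
    UniformSymbol (fun i x => w i (t i • x)) (fun i x => a i (t i • x)) := by
  simpa using h.comp_affine (fun i => t i • ContinuousLinearMap.id ℝ E) (fun _ => 0)
    (fun i => (norm_smul_id_le (t i)).trans (ht i))

theorem RapidDecay.contDiff {χ : DPhase → ℂ} (hχ : RapidDecay χ) : ContDiff ℝ ∞ χ := (hχ 0).1 ()

/-- Opening the cutoff gains a factor ε at the cost of one power of growth: the mean value
inequality handles the function itself, the chain rule its derivatives. -/
theorem RapidDecay.uniformSymbol_sub {χ : DPhase → ℂ} (hχ : RapidDecay χ) :
    UniformSymbol (fun (ε : Set.Ioc (0 : ℝ) 1) (Z : DPhase) => (ε : ℝ) * (1 + ‖Z‖) ^ (1 : ℝ))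
      (fun ε Z => χ ((ε : ℝ) • Z) - χ 0) := by
  have hd : Differentiable ℝ χ := hχ.contDiff.differentiable (by simp)
  have hF : UniformSymbol (fun (_ : Set.Ioc (0 : ℝ) 1) (_ : DPhase) => (1 : ℝ))
      (fun _ => _root_.fderiv ℝ χ) := by
    simpa using (hχ 0).fderiv.reindex (fun _ : Set.Ioc (0 : ℝ) 1 => ())
  refine UniformSymbol.of_fderiv (fun ε => ?_) ?_ ?_
  · exact (hχ.contDiff.comp (contDiff_id.const_smul (ε : ℝ))).sub contDiff_const
  · obtain ⟨C, hC, hb⟩ := hF.bound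
    refine ⟨C, hC, fun ε Z => ?_⟩
    have h1 := convex_univ.norm_image_sub_le_of_norm_fderiv_le (𝕜 := ℝ) (f := χ) (C := C)
      (fun x _ => hd x) (fun x _ => by simpa using hb ε x) (Set.mem_univ 0)
      (Set.mem_univ ((ε : ℝ) • Z))
    refine h1.trans (mul_le_mul_of_nonneg_left ?_ hC)
    rw [sub_zero, norm_smul, Real.norm_of_nonneg ε.2.1.le, Real.rpow_one]
    exact mul_le_mul_of_nonneg_left (by linarith) ε.2.1.le
  · have h1 := (hF.comp_smul (fun ε => (ε : ℝ)) (K := 1)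
      (fun ε => by rw [abs_of_pos ε.2.1]; exact ε.2.2)).clm_comp_of_le
      (c := fun ε : Set.Ioc (0 : ℝ) 1 => (ε : ℝ))
      (fun ε => (ε : ℝ) • ContinuousLinearMap.id ℝ (DPhase →L[ℝ] ℂ))
      (fun ε => (norm_smul_id_le _).trans (by rw [abs_of_pos ε.2.1]))
    refine (h1.mono 1 zero_le_one fun ε Z => ?_).congr fun ε Z => ?_
    · rw [one_mul, mul_one, Real.rpow_one]
      exact le_mul_of_one_le_right ε.2.1.le (by linarith [norm_nonneg Z])
    · rw [fderiv_sub_const, fderiv_comp_smul hd]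
      simp

/-- The constant blows up as ε ↓ 0. This is harmless, since the statement serves integrability and
integration by parts at a fixed ε. -/
theorem RapidDecay.cutoff_smul {χ : DPhase → ℂ} (hχ : RapidDecay χ) {ε : ℝ}
    (hε : ε ∈ Set.Ioc (0 : ℝ) 1) {c m : ℝ} (hc : 0 ≤ c) {b : DPhase → V}
    (h : UniformSymbol (fun (_ : Unit) Z => c * (1 + ‖Z‖) ^ m) fun _ => b) (s : ℝ) :
    UniformSymbol (fun (_ : Unit) Z => (1 : ℝ) * (1 + ‖Z‖) ^ s) (fun _ Z => χ (ε • Z) • b Z) := by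
  -- The exponent is nonpositive so that ε(1 + ‖Z‖) ≤ 1 + ‖εZ‖ reverses under the power, and small
  -- enough that r + m ≤ s.
  set r : ℝ := min (s - m) 0 with hr
  have hr0 : r ≤ 0 := min_le_right _ _
  have hr1 : r + m ≤ s := by have := min_le_left (s - m) 0; linarith
  have h1 := ((hχ r).comp_smul (fun _ => ε) (K := 1)
    (fun _ => by rw [abs_of_pos hε.1]; exact hε.2)).smul h
  refine h1.mono (ε ^ r * c) (mul_nonneg (Real.rpow_nonneg hε.1.le _) hc) fun _ Z => ?_
  have e1 : (1 + ‖ε • Z‖) ^ r ≤ ε ^ r * (1 + ‖Z‖) ^ r := by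
    rw [← Real.mul_rpow hε.1.le (by positivity)]
    refine Real.rpow_le_rpow_of_nonpos (mul_pos hε.1 (by positivity)) ?_ hr0
    rw [norm_smul, Real.norm_of_nonneg hε.1.le, mul_add, mul_one]
    linarith [hε.2]
  have hpos := Real.rpow_pos_of_pos hε.1 r
  calc (1 + ‖ε • Z‖) ^ r * (c * (1 + ‖Z‖) ^ m)
      ≤ (ε ^ r * (1 + ‖Z‖) ^ r) * (c * (1 + ‖Z‖) ^ m) :=
        mul_le_mul_of_nonneg_right e1 (mul_nonneg hc (bracket_pos Z m).le)
    _ = ε ^ r * c * ((1 + ‖Z‖) ^ (r + m)) := by rw [← bracket_mul]; ring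
    _ ≤ _ := by
        rw [one_mul]
        exact mul_le_mul_of_nonneg_left (bracket_le Z hr1) (by positivity)

/-- The regularised oscillatory integral with the cutoff `χ(ε ·)`. -/
def oscReg (χ : DPhase → ℂ) (ε : ℝ) (b : DPhase → V) : V :=
  (((2 * Real.pi) ^ 6)⁻¹ : ℝ) • ∫ Z, (osc Z * χ (ε • Z)) • b Z

/-- The oscillatory integral after `N` integrations by parts. -/
def oscIbp (N : ℕ) (b : DPhase → V) : V :=
  (((2 * Real.pi) ^ 6)⁻¹ : ℝ) • ∫ Z, osc Z • ibpOp^[N] b Z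

theorem norm_oscIbp_le {c : ι → ℝ} (hc : ∀ i, 0 ≤ c i) {m : ℝ} {b : ι → DPhase → V}
    (h : UniformSymbol (fun i Z => c i * (1 + ‖Z‖) ^ m) b) {N : ℕ} (hN : m + 13 ≤ N) :
    ∃ C : ℝ, 0 ≤ C ∧ ∀ i, ‖oscIbp N (b i)‖ ≤ C * c i := by
  obtain ⟨C, hC, hb⟩ := (h.ibpOp_iterate hc N).bound
  set A : ℝ := ∫ Z : DPhase, (1 + ‖Z‖) ^ (m - N) with hA
  have hA0 : 0 ≤ A := integral_nonneg fun Z => (bracket_pos Z _).le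
  refine ⟨((2 * Real.pi) ^ 6)⁻¹ * (C * A), by positivity, fun i => ?_⟩
  rw [oscIbp, norm_smul, Real.norm_of_nonneg (by positivity), mul_assoc]
  refine mul_le_mul_of_nonneg_left ?_ (by positivity)
  have hInt : Integrable (fun Z : DPhase => C * c i * (1 + ‖Z‖) ^ (m - N)) :=
    (integrable_bracket (by linarith)).const_mul _
  refine (norm_integral_le_of_norm_le hInt (ae_of_all _ fun Z => ?_)).trans (le_of_eq ?_)
  · rw [norm_smul, norm_osc, one_mul, mul_assoc]
    exact hb i Z
  · rw [integral_const_mul]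
    ring

/-- Cutting off changes χ(0)b by a symbol of order m + 1 and size ε, so the regularised integrals
converge at rate ε to a limit that sees only χ(0). The extra order explains m + 14 here against m +
13 in `norm_oscIbp_le`. -/
theorem norm_oscReg_sub_le {χ : DPhase → ℂ} (hχ : RapidDecay χ) {c : ι → ℝ} (hc : ∀ i, 0 ≤ c i)
    {m : ℝ} {b : ι → DPhase → V} (h : UniformSymbol (fun i Z => c i * (1 + ‖Z‖) ^ m) b)
    {N : ℕ} (hN : m + 14 ≤ N) :
    ∃ C : ℝ, 0 ≤ C ∧ ∀ i, ∀ ε ∈ Set.Ioc (0 : ℝ) 1,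
      ‖oscReg χ ε (b i) - χ 0 • oscIbp N (b i)‖ ≤ C * c i * ε := by
  have hd : UniformSymbol
      (fun (p : Set.Ioc (0 : ℝ) 1 × ι) Z => ((p.1 : ℝ) * c p.2) * (1 + ‖Z‖) ^ (m + 1))
      (fun p Z => (χ ((p.1 : ℝ) • Z) - χ 0) • b p.2 Z) := by
    refine ((hχ.uniformSymbol_sub.reindex Prod.fst).smul (h.reindex Prod.snd)).mono 1 zero_le_one
      fun p Z => le_of_eq ?_
    rw [one_mul, add_comm m, ← bracket_mul]
    ring
  obtain ⟨C, hC, hb⟩ := norm_oscIbp_le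
    (c := fun p : Set.Ioc (0 : ℝ) 1 × ι => (p.1 : ℝ) * c p.2)
    (fun p => mul_nonneg p.1.2.1.le (hc p.2)) hd (N := N) (by linarith)
  refine ⟨C, hC, fun i ε hε => ?_⟩
  have h1 : UniformSymbol (fun (_ : Unit) Z => c i * (1 + ‖Z‖) ^ m) fun _ => b i :=
    h.reindex fun _ : Unit => i
  have hs : ContDiff ℝ ∞ (b i) := h.1 i
  have hds : ContDiff ℝ ∞ fun Z => (χ (ε • Z) - χ 0) • b i Z := hd.1 (⟨ε, hε⟩, i)
  have hcs : ContDiff ℝ ∞ (χ 0 • b i) := (smulC V (χ 0)).contDiff.comp hs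
  -- Integration by parts is carried out with the cutoff in place, where everything converges;
  -- linearity of `ibpOp` then splits off the limit.
  have e1 : ∫ Z, (osc Z * χ (ε • Z)) • b i Z = ∫ Z, osc Z • ibpOp^[N] (fun Z => χ (ε • Z) • b i Z) Z := by
    rw [integral_osc_smul_ibpOp_iterate N (hχ.cutoff_smul hε (hc i) h1 _)]
    simp only [mul_smul]
  have e2 : (fun Z => χ (ε • Z) • b i Z)
      = (fun Z => (χ (ε • Z) - χ 0) • b i Z) + χ 0 • b i := by
    funext Z
    simp [sub_smul]
  have e3 : ibpOp^[N] (fun Z => χ (ε • Z) • b i Z)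
      = ibpOp^[N] (fun Z => (χ (ε • Z) - χ 0) • b i Z) + χ 0 • ibpOp^[N] (b i) := by
    rw [e2, ibpOp_iterate_add N hds hcs, ibpOp_iterate_const_smul N hs]
  have i1 : Integrable (fun Z => osc Z • ibpOp^[N] (fun Z => (χ (ε • Z) - χ 0) • b i Z) Z) :=
    (hd.ibpOp_iterate (fun p => mul_nonneg p.1.2.1.le (hc p.2)) N).integrable_osc_smul
      (by linarith) (⟨ε, hε⟩, i)
  have i2 : Integrable (fun Z => osc Z • ibpOp^[N] (b i) Z) :=
    (h.ibpOp_iterate hc N).integrable_osc_smul (by linarith) i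
  have i3 : Integrable (fun Z => χ 0 • osc Z • ibpOp^[N] (b i) Z) := i2.smul (χ 0)
  have e4 : oscReg χ ε (b i) - χ 0 • oscIbp N (b i)
      = oscIbp N (fun Z => (χ (ε • Z) - χ 0) • b i Z) := by
    rw [oscReg, oscIbp, oscIbp, e1, e3, smul_comm (χ 0), ← smul_sub]
    congr 1
    rw [sub_eq_iff_eq_add, ← integral_smul, ← integral_add i1 i3]
    refine integral_congr_ae (ae_of_all _ fun Z => ?_)
    simp only [Pi.add_apply, Pi.smul_apply, smul_add]
    rw [smul_comm (χ 0)]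
  rw [e4]
  refine (hb (⟨ε, hε⟩, i)).trans (le_of_eq ?_)
  ring

theorem tendsto_oscReg {χ : DPhase → ℂ} (hχ : RapidDecay χ) {m : ℝ} {b : DPhase → V}
    (h : UniformSymbol (fun (_ : Unit) Z => (1 : ℝ) * (1 + ‖Z‖) ^ m) fun _ => b)
    {N : ℕ} (hN : m + 14 ≤ N) :
    Tendsto (fun ε => oscReg χ ε b) (𝓝[>] 0) (𝓝 (χ 0 • oscIbp N b)) := by
  obtain ⟨C, hC, hb⟩ := norm_oscReg_sub_le hχ (fun _ => zero_le_one) h hN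
  rw [tendsto_iff_norm_sub_tendsto_zero]
  have h0 : Tendsto (fun ε : ℝ => C * 1 * ε) (𝓝[>] 0) (𝓝 0) := by
    have : Tendsto (fun ε : ℝ => C * 1 * ε) (𝓝 0) (𝓝 (C * 1 * 0)) :=
      (continuous_const.mul continuous_id).tendsto 0
    rw [mul_zero] at this
    exact this.mono_left nhdsWithin_le_nhds
  refine squeeze_zero' (Eventually.of_forall fun _ => norm_nonneg _) ?_ h0
  filter_upwards [Ioc_mem_nhdsGT (zero_lt_one (α := ℝ))] with ε hε
  exact hb () ε hε

end Cutoff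

/-! ### The Gaussian cutoff -/

/-- The Gaussian cutoff. -/
def gaussCut (Z : DPhase) : ℂ := ((Real.exp (-(quadWeight Z - 1) / 2) : ℝ) : ℂ)

theorem gaussCut_zero : gaussCut 0 = 1 := by simp [gaussCut, quadWeight]

theorem contDiff_gaussReal : ContDiff ℝ ∞ fun Z => Real.exp (-(quadWeight Z - 1) / 2) :=
  (((contDiff_quadWeight.sub contDiff_const).neg).div_const 2).exp

/-- This is (y/2)^N / N! ≤ e^{y/2}, with e^{1/2} accounting for the shift by 1. -/
theorem exp_neg_le_inv_pow (N : ℕ) {y : ℝ} (hy : 1 ≤ y) :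
    Real.exp (-(y - 1) / 2) ≤ Real.exp (1 / 2) * N.factorial * 2 ^ N * (y ^ N)⁻¹ := by
  have h1 := Real.pow_div_factorial_le_exp (y / 2) (by linarith) N
  have hy0 : 0 < y := by linarith
  have e : Real.exp (-(y - 1) / 2) = Real.exp (1 / 2) * (Real.exp (y / 2))⁻¹ := by
    rw [← Real.exp_neg, ← Real.exp_add]; congr 1; ring
  rw [e, mul_assoc, mul_assoc]
  refine mul_le_mul_of_nonneg_left ?_ (Real.exp_pos _).le
  have h2 : 0 < (y / 2) ^ N / N.factorial := by positivity
  refine (inv_anti₀ h2 h1).trans (le_of_eq ?_)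
  rw [div_pow]
  field_simp

/-- The derivative is -1/2 times the Gaussian times the linear `quadWeightDeriv`. Its one power of
growth is absorbed by the induction hypothesis at the rate r - 1, which is why all rates are treated
together. -/
theorem rapidDecay_gaussCut : RapidDecay gaussCut := by
  have main : ∀ n : ℕ, ∀ r : ℝ, ∀ k ≤ n, DerivBound k
      (fun (_ : Unit) (Z : DPhase) => (1 + ‖Z‖) ^ r)
      (fun _ Z => Real.exp (-(quadWeight Z - 1) / 2)) := by
    have hzero : ∀ r : ℝ, DerivBound 0
      (fun (_ : Unit) (Z : DPhase) => (1 + ‖Z‖) ^ r)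
      (fun _ Z => Real.exp (-(quadWeight Z - 1) / 2)) := by
      intro r
      obtain ⟨K, hK, hle⟩ := exists_le_quadWeight
      obtain ⟨N, hN⟩ := exists_nat_ge (-r)
      refine derivBound_zero_iff.2 ⟨Real.exp (1 / 2) * N.factorial * 2 ^ N * K ^ N, by positivity,
        fun _ Z => ?_⟩
      rw [Real.norm_of_nonneg (Real.exp_pos _).le]
      refine (exp_neg_le_inv_pow N (one_le_quadWeight Z)).trans ?_
      rw [mul_assoc _ (K ^ N)]
      refine mul_le_mul_of_nonneg_left ?_ (by positivity)
      have hq := quadWeight_pos Z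
      have h1 : (1 + ‖Z‖) ^ N ≤ K ^ N * quadWeight Z ^ N := by
        rw [← mul_pow]
        refine pow_le_pow_left₀ (by positivity) (le_trans ?_ (hle Z)) N
        nlinarith [norm_nonneg Z]
      have h2 : ((1 + ‖Z‖) ^ N)⁻¹ ≤ (1 + ‖Z‖) ^ r := by
        rw [← Real.rpow_natCast, ← Real.rpow_neg (by positivity)]
        exact bracket_le Z (by linarith)
      have h3 : (0 : ℝ) < (1 + ‖Z‖) ^ N := by positivity
      calc (quadWeight Z ^ N)⁻¹ ≤ K ^ N * ((1 + ‖Z‖) ^ N)⁻¹ := by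
            rw [inv_eq_one_div, div_le_iff₀ (by positivity), ← div_eq_mul_inv, div_mul_eq_mul_div,
              le_div_iff₀ h3]
            linarith
        _ ≤ _ := mul_le_mul_of_nonneg_left h2 (by positivity)
    intro n
    induction n with
    | zero => intro r k hk; rw [Nat.le_zero.1 hk]; exact hzero r
    | succ n ih =>
      intro r k hk
      cases k with
      | zero => exact hzero r
      | succ k =>
        rw [derivBound_succ_iff]
        have h3 := DerivBound.bilinear (n := k)
          (ContinuousLinearMap.lsmul ℝ ℝ : ℝ →L[ℝ] (DPhase →L[ℝ] ℝ) →L[ℝ] (DPhase →L[ℝ] ℝ))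
          (fun _ => contDiff_gaussReal)
          (uniformSymbol_quadWeightDeriv (ι := Unit)).1
          (fun j hj => ih (r - 1) j (by omega))
          (fun k _ => (uniformSymbol_quadWeightDeriv (ι := Unit)).2 k)
        have h4 := DerivBound.clm_comp (c := fun _ => 1 / 2) (fun _ => ?_) h3
          (fun _ => (-(1 / 2 : ℝ)) • ContinuousLinearMap.id ℝ (DPhase →L[ℝ] ℝ))
          (fun _ => (norm_smul_id_le _).trans (by norm_num))
        · have e : (fun _ : Unit => fderiv ℝ fun Z => Real.exp (-(quadWeight Z - 1) / 2))
              = fun (_ : Unit) Z => ((-(1 / 2 : ℝ)) • ContinuousLinearMap.id ℝ (DPhase →L[ℝ] ℝ))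
                ((ContinuousLinearMap.lsmul ℝ ℝ : ℝ →L[ℝ] (DPhase →L[ℝ] ℝ) →L[ℝ] (DPhase →L[ℝ] ℝ))
                (Real.exp (-(quadWeight Z - 1) / 2)) (quadWeightDeriv Z)) := by
            funext _ Z
            have h := (contDiff_quadWeight.differentiable (by simp) Z).hasFDerivAt
            have h' : HasFDerivAt (fun Z => Real.exp (-(quadWeight Z - 1) / 2)) _ Z :=
              ((((h.sub_const 1).neg).mul_const (2⁻¹ : ℝ)).congr_of_eventuallyEq
                (Eventually.of_forall fun W => by simp [div_eq_mul_inv])).exp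
            rw [h'.fderiv, fderiv_quadWeight]
            ext <;> simp
          rw [e]
          refine h4.mono 1 zero_le_one fun _ Z => ?_
          rw [bracket_mul, one_mul, sub_add_cancel]
          linarith [bracket_pos Z r]
        · exact contDiff_gaussReal.smul quadWeightDeriv.contDiff
  intro r
  have h : UniformSymbol (fun (_ : Unit) (Z : DPhase) => (1 + ‖Z‖) ^ r)
      (fun _ Z => Real.exp (-(quadWeight Z - 1) / 2)) :=
    ⟨fun _ => contDiff_gaussReal, fun n => main n r n le_rfl⟩
  exact h.clm_comp Complex.ofRealCLM

theorem quadWeight_eq (Z : DPhase) :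
    quadWeight Z = 1 + (‖Z.1.1‖ ^ 2 + ‖Z.1.2‖ ^ 2 + ‖Z.2.1‖ ^ 2 + ‖Z.2.2‖ ^ 2) := by
  simp only [quadWeight, Fintype.sum_sum_type, coord, EuclideanSpace.norm_sq_eq, Real.norm_eq_abs,
    sq_abs]
  simp
  ring

theorem integral_gauss_E3 {t : ℝ} (ht : 0 < t) (c : ℂ) (w : E3) :
    ∫ v : E3, Complex.exp (-(t : ℂ) * (‖v‖ : ℂ) ^ 2 + c * (inner ℝ w v : ℝ))
      = (Real.pi / t : ℂ) ^ ((3 : ℂ) / 2) * Complex.exp (c ^ 2 * (‖w‖ : ℂ) ^ 2 / (4 * t)) := by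
  have := GaussianFourier.integral_cexp_neg_mul_sq_norm_add (V := E3) (b := (t : ℂ)) (by simpa) c w
  simpa using this

theorem osc_mul_gaussCut (ε : ℝ) (Z : DPhase) :
    osc Z * gaussCut (ε • Z) =
      (Complex.exp (-((ε ^ 2 / 2 : ℝ) : ℂ) * (‖Z.1.1‖ : ℂ) ^ 2) *
        Complex.exp (-((ε ^ 2 / 2 : ℝ) : ℂ) * (‖Z.1.2‖ : ℂ) ^ 2)) *
      (Complex.exp (-((ε ^ 2 / 2 : ℝ) : ℂ) * (‖Z.2.1‖ : ℂ) ^ 2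
          + (-Complex.I) * (inner ℝ Z.1.2 Z.2.1 : ℝ)) *
        Complex.exp (-((ε ^ 2 / 2 : ℝ) : ℂ) * (‖Z.2.2‖ : ℂ) ^ 2
          + Complex.I * (inner ℝ Z.1.1 Z.2.2 : ℝ))) := by
  rw [osc, gaussCut, quadWeight_eq, phaseQ, Complex.ofReal_exp]
  simp only [← Complex.exp_add]
  congr 1
  simp only [Prod.smul_fst, Prod.smul_snd, norm_smul, mul_pow, Real.norm_eq_abs, sq_abs,
    real_inner_comm Z.1.2 Z.2.1]
  push_cast
  ring

theorem cpow_three_half_sq {z : ℂ} (hz : z ≠ 0) :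
    z ^ ((3 : ℂ) / 2) * z ^ ((3 : ℂ) / 2) = z ^ 3 := by
  rw [← Complex.cpow_add _ _ hz]
  norm_num

theorem integrable_osc_mul_gaussCut {ε : ℝ} (hε : ε ∈ Set.Ioc (0 : ℝ) 1) :
    Integrable (fun Z => osc Z * gaussCut (ε • Z)) := by
  have h1 : UniformSymbol (fun (_ : Unit) (Z : DPhase) => (1 : ℝ) * (1 + ‖Z‖) ^ (0 : ℝ))
      fun _ _ => (1 : ℂ) := by
    simpa using UniformSymbol.const (E := DPhase) (c := fun _ : Unit => 1) (fun _ => (1 : ℂ))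
      (fun _ => by simp)
  have := (rapidDecay_gaussCut.cutoff_smul hε zero_le_one h1 (-13)).integrable_osc_smul le_rfl ()
  simpa using this

/-- The integral over X'' is a Gaussian Fourier transform and yields exp(-‖·‖²/(4t)) in both
components of X', t = ε²/2. The remaining Gaussians have parameter s = t + 1/(4t), and ts = t² +
1/4. -/
theorem integral_osc_mul_gaussCut {ε : ℝ} (hε : ε ∈ Set.Ioc (0 : ℝ) 1) :
    ∫ Z, osc Z * gaussCut (ε • Z) = ((Real.pi ^ 6 / ((ε ^ 2 / 2) ^ 2 + 1 / 4) ^ 3 : ℝ) : ℂ) := by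
  set t : ℝ := ε ^ 2 / 2 with ht
  have ht0 : 0 < t := by have := hε.1; positivity
  have hI := integrable_osc_mul_gaussCut hε
  rw [Measure.volume_eq_prod] at hI ⊢
  rw [integral_prod _ hI]
  simp only [osc_mul_gaussCut, ← ht]
  simp only [integral_const_mul]
  have inner_eq : ∀ X : Phase, ∫ Y : Phase, Complex.exp (-(t : ℂ) * (‖Y.1‖ : ℂ) ^ 2
          + (-Complex.I) * (inner ℝ X.2 Y.1 : ℝ)) *
        Complex.exp (-(t : ℂ) * (‖Y.2‖ : ℂ) ^ 2 + Complex.I * (inner ℝ X.1 Y.2 : ℝ))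
      = (Real.pi / t : ℂ) ^ 3 * (Complex.exp (-((1 / (4 * t) : ℝ) : ℂ) * (‖X.1‖ : ℂ) ^ 2)
        * Complex.exp (-((1 / (4 * t) : ℝ) : ℂ) * (‖X.2‖ : ℂ) ^ 2)) := by
    intro X
    rw [Measure.volume_eq_prod, integral_prod_mul (μ := (volume : Measure E3)) (ν := (volume : Measure E3))
      (fun y => Complex.exp (-(t : ℂ) * (‖y‖ : ℂ) ^ 2 + (-Complex.I) * (inner ℝ X.2 y : ℝ)))
      (fun y => Complex.exp (-(t : ℂ) * (‖y‖ : ℂ) ^ 2 + Complex.I * (inner ℝ X.1 y : ℝ))),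
      integral_gauss_E3 ht0, integral_gauss_E3 ht0, ← cpow_three_half_sq]
    · have e : ∀ x : ℝ, Complex.exp (-((1 / (4 * t) : ℝ) : ℂ) * (x : ℂ) ^ 2)
          = Complex.exp (Complex.I ^ 2 * (x : ℂ) ^ 2 / (4 * t)) := fun x => by
        congr 1; rw [Complex.I_sq]; push_cast; ring
      rw [e, e, neg_sq]
      ring
    · have h1 : (t : ℂ) ≠ 0 := by exact_mod_cast ht0.ne'
      have h2 : (Real.pi : ℂ) ≠ 0 := by exact_mod_cast Real.pi_ne_zero
      exact div_ne_zero h2 h1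
  simp only [inner_eq]
  set s : ℝ := t + 1 / (4 * t) with hs
  have hs0 : 0 < s := by positivity
  have e1 : ∀ X : Phase, Complex.exp (-(t : ℂ) * (‖X.1‖ : ℂ) ^ 2) *
        Complex.exp (-(t : ℂ) * (‖X.2‖ : ℂ) ^ 2) *
      ((Real.pi / t : ℂ) ^ 3 * (Complex.exp (-((1 / (4 * t) : ℝ) : ℂ) * (‖X.1‖ : ℂ) ^ 2)
        * Complex.exp (-((1 / (4 * t) : ℝ) : ℂ) * (‖X.2‖ : ℂ) ^ 2)))
      = (Real.pi / t : ℂ) ^ 3 * (Complex.exp (-(s : ℂ) * (‖X.1‖ : ℂ) ^ 2) *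
        Complex.exp (-(s : ℂ) * (‖X.2‖ : ℂ) ^ 2)) := by
    intro X
    have e2 : ∀ x : ℝ, Complex.exp (-(s : ℂ) * (x : ℂ) ^ 2)
        = Complex.exp (-(t : ℂ) * (x : ℂ) ^ 2)
          * Complex.exp (-((1 / (4 * t) : ℝ) : ℂ) * (x : ℂ) ^ 2) := fun x => by
      rw [← Complex.exp_add]; congr 1; rw [hs]; push_cast; ring
    rw [e2, e2]
    ring
  simp only [e1]
  have e3 : ∫ v : E3, Complex.exp (-(s : ℂ) * (‖v‖ : ℂ) ^ 2) = (Real.pi / s : ℂ) ^ ((3 : ℂ) / 2) := by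
    simpa using integral_gauss_E3 hs0 0 (0 : E3)
  rw [integral_const_mul, Measure.volume_eq_prod,
    integral_prod_mul (μ := (volume : Measure E3)) (ν := (volume : Measure E3))
      (fun y => Complex.exp (-(s : ℂ) * (‖y‖ : ℂ) ^ 2))
      (fun y => Complex.exp (-(s : ℂ) * (‖y‖ : ℂ) ^ 2)), e3, cpow_three_half_sq]
  · have : (Real.pi / t) ^ 3 * (Real.pi / s) ^ 3 = Real.pi ^ 6 / (t ^ 2 + 1 / 4) ^ 3 := by
      rw [hs]
      field_simp
    rw [← this]
    push_cast
    ring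
  · have h1 : (s : ℂ) ≠ 0 := by exact_mod_cast hs0.ne'
    have h2 : (Real.pi : ℂ) ≠ 0 := by exact_mod_cast Real.pi_ne_zero
    exact div_ne_zero h2 h1

/-! ### The oscillatory integral as a functional on amplitudes -/

section OscInt

variable {ι : Type*} {V W : Type*} [NormedAddCommGroup V] [NormedSpace ℝ V] [NormedSpace ℂ V]
  [IsScalarTower ℝ ℂ V] [NormedAddCommGroup W] [NormedSpace ℝ W] [NormedSpace ℂ W]
  [IsScalarTower ℝ ℂ W]

/-- Amplitudes for which the oscillatory integral is defined: smooth functions whose derivatives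
all grow at most like a fixed power. -/
def Tempered (b : DPhase → V) : Prop :=
  ∃ m : ℝ, UniformSymbol (fun (_ : Unit) Z => (1 : ℝ) * (1 + ‖Z‖) ^ m) fun _ => b

/-- The oscillatory integral `(2π)⁻⁶ ∫ e^{i (r' · k'' - r'' · k')} b(Z) dZ`. -/
def oscInt (b : DPhase → V) : V := limUnder (𝓝[>] (0 : ℝ)) fun ε => oscReg gaussCut ε b

theorem UniformSymbol.tempered {c : ι → ℝ} {m : ℝ} {b : ι → DPhase → V}
    (h : UniformSymbol (fun i Z => c i * (1 + ‖Z‖) ^ m) b) (i : ι) : Tempered (b i) :=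
  ⟨m, (h.reindex fun _ : Unit => i).mono |c i| (abs_nonneg _) fun _ Z => by
    rw [one_mul]
    exact mul_le_mul_of_nonneg_right (le_abs_self _) (bracket_pos Z m).le⟩

theorem oscInt_eq_oscIbp {m : ℝ} {b : DPhase → V}
    (h : UniformSymbol (fun (_ : Unit) Z => (1 : ℝ) * (1 + ‖Z‖) ^ m) fun _ => b)
    {N : ℕ} (hN : m + 14 ≤ N) : oscInt b = oscIbp N b := by
  have := tendsto_oscReg rapidDecay_gaussCut h hN
  rw [gaussCut_zero, one_smul] at this
  exact this.limUnder_eq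

theorem Tempered.tendsto_oscReg {b : DPhase → V} (hb : Tempered b) {χ : DPhase → ℂ}
    (hχ : RapidDecay χ) :
    Tendsto (fun ε => oscReg χ ε b) (𝓝[>] 0) (𝓝 (χ 0 • oscInt b)) := by
  obtain ⟨m, h⟩ := hb
  obtain ⟨N, hN⟩ := exists_nat_ge (m + 14)
  rw [oscInt_eq_oscIbp h hN]
  exact RayOptics.tendsto_oscReg hχ h hN

theorem Tempered.tendsto_gauss {b : DPhase → V} (hb : Tempered b) :
    Tendsto (fun ε => oscReg gaussCut ε b) (𝓝[>] 0) (𝓝 (oscInt b)) := by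
  simpa [gaussCut_zero] using hb.tendsto_oscReg rapidDecay_gaussCut

/-- The number of integrations by parts depends on m alone, so the constant serves the whole family.
Later uniformity in λ, in the base point and in Taylor parameters is obtained by enlarging the index
type. -/
theorem UniformSymbol.norm_oscInt_le {c : ι → ℝ} (hc : ∀ i, 0 ≤ c i) {m : ℝ}
    {b : ι → DPhase → V} (h : UniformSymbol (fun i Z => c i * (1 + ‖Z‖) ^ m) b) :
    ∃ C : ℝ, 0 ≤ C ∧ ∀ i, ‖oscInt (b i)‖ ≤ C * c i := by
  obtain ⟨N, hN⟩ := exists_nat_ge (m + 14)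
  obtain ⟨C, hC, hb⟩ := norm_oscIbp_le hc h (N := N) (by linarith)
  refine ⟨C, hC, fun i => ?_⟩
  have h1 : UniformSymbol (fun (_ : Unit) Z => (1 : ℝ) * (1 + ‖Z‖) ^ m) fun _ => b i :=
    (h.reindex fun _ : Unit => i).mono |c i| (abs_nonneg _) fun _ Z => by
      rw [one_mul]
      exact mul_le_mul_of_nonneg_right (le_abs_self _) (bracket_pos Z m).le
  rw [oscInt_eq_oscIbp h1 hN]
  exact hb i

theorem Tempered.contDiff {b : DPhase → V} (hb : Tempered b) : ContDiff ℝ ∞ b := by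
  obtain ⟨m, h⟩ := hb
  exact h.1 ()

theorem Tempered.add {a b : DPhase → V} (ha : Tempered a) (hb : Tempered b) :
    Tempered (fun Z => a Z + b Z) := by
  obtain ⟨m, h⟩ := ha
  obtain ⟨m', h'⟩ := hb
  exact ⟨max m m', (h.bracket_mono (fun _ => zero_le_one) (le_max_left _ _)).add
    (h'.bracket_mono (fun _ => zero_le_one) (le_max_right _ _))⟩

theorem Tempered.clm_comp {b : DPhase → V} (hb : Tempered b) (T : V →L[ℝ] W) :
    Tempered (fun Z => T (b Z)) := by
  obtain ⟨m, h⟩ := hb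
  exact ⟨m, h.clm_comp T⟩

theorem Tempered.const_smul {b : DPhase → V} (hb : Tempered b) (c : ℂ) :
    Tempered (fun Z => c • b Z) := hb.clm_comp (smulC V c)

theorem Tempered.coord_smul {b : DPhase → V} (hb : Tempered b) (α : DirIdx) :
    Tempered (fun Z => coord α Z • b Z) := by
  obtain ⟨m, h⟩ := hb
  exact ⟨m + 1, h.coord_smul α⟩

theorem Tempered.fderiv_apply {b : DPhase → V} (hb : Tempered b) (v : DPhase) :
    Tempered (fun Z => fderiv ℝ b Z v) := by
  obtain ⟨m, h⟩ := hb
  exact ⟨m, h.fderiv_apply v⟩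

theorem tempered_const (v : V) : Tempered (fun _ => v) :=
  ⟨0, (UniformSymbol.const (E := DPhase) (c := fun _ : Unit => ‖v‖) (fun _ => v)
    (fun _ => le_rfl)).mono ‖v‖ (norm_nonneg _) fun _ Z => by simp⟩

theorem Tempered.integrable {b : DPhase → V} (hb : Tempered b) {χ : DPhase → ℂ}
    (hχ : RapidDecay χ) {ε : ℝ} (hε : ε ∈ Set.Ioc (0 : ℝ) 1) :
    Integrable (fun Z => (osc Z * χ (ε • Z)) • b Z) := by
  obtain ⟨m, h⟩ := hb
  have := (hχ.cutoff_smul hε zero_le_one h (-13)).integrable_osc_smul le_rfl ()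
  simpa only [mul_smul] using this

theorem eventually_Ioc : ∀ᶠ ε : ℝ in 𝓝[>] 0, ε ∈ Set.Ioc (0 : ℝ) 1 :=
  Ioc_mem_nhdsGT zero_lt_one

theorem oscInt_add {a b : DPhase → V} (ha : Tempered a) (hb : Tempered b) :
    oscInt (fun Z => a Z + b Z) = oscInt a + oscInt b := by
  refine tendsto_nhds_unique (ha.add hb).tendsto_gauss
    ((ha.tendsto_gauss.add hb.tendsto_gauss).congr' ?_)
  filter_upwards [eventually_Ioc] with ε hε
  rw [oscReg, oscReg, oscReg, ← smul_add, ← integral_add (ha.integrable rapidDecay_gaussCut hε)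
    (hb.integrable rapidDecay_gaussCut hε)]
  simp only [smul_add]

/-- The oscillatory integral commutes with continuous complex-linear maps. -/
theorem oscInt_clm_comp [CompleteSpace V] [CompleteSpace W] {b : DPhase → V} (hb : Tempered b)
    (T : V →L[ℝ] W) (hT : ∀ (c : ℂ) v, T (c • v) = c • T v) :
    oscInt (fun Z => T (b Z)) = T (oscInt b) := by
  refine tendsto_nhds_unique (hb.clm_comp T).tendsto_gauss
    (((T.continuous.tendsto _).comp hb.tendsto_gauss).congr' ?_)
  filter_upwards [eventually_Ioc] with ε hε
  rw [Function.comp_apply, oscReg, oscReg, map_smul,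
    ← T.integral_comp_comm (hb.integrable rapidDecay_gaussCut hε)]
  simp only [hT]

theorem oscInt_const_smul [CompleteSpace V] {b : DPhase → V} (hb : Tempered b) (c : ℂ) :
    oscInt (fun Z => c • b Z) = c • oscInt b :=
  oscInt_clm_comp hb (smulC V c) fun d v => smul_comm c d v

theorem oscInt_sub [CompleteSpace V] {a b : DPhase → V} (ha : Tempered a) (hb : Tempered b) :
    oscInt (fun Z => a Z - b Z) = oscInt a - oscInt b := by
  have := oscInt_add ha (hb.const_smul (-1))
  rw [oscInt_const_smul hb] at this
  simpa [sub_eq_add_neg] using this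

theorem Tempered.sub {a b : DPhase → V} (ha : Tempered a) (hb : Tempered b) :
    Tempered (fun Z => a Z - b Z) := by
  simpa [sub_eq_add_neg] using ha.add (hb.const_smul (-1))

theorem Tempered.sum {κ : Type*} (s : Finset κ) {b : κ → DPhase → V} (hb : ∀ j ∈ s, Tempered (b j)) :
    Tempered (fun Z => ∑ j ∈ s, b j Z) := by
  classical
  induction s using Finset.induction_on with
  | empty => simpa using tempered_const (0 : V)
  | insert j s hj ih =>
    simp only [Finset.sum_insert hj]
    exact (hb j (Finset.mem_insert_self _ _)).add
      (ih fun k hk => hb k (Finset.mem_insert_of_mem hk))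

/-- The factor (2π)⁻⁶ is right because the Gaussian integrals tend to 4³π⁶ = (2π)⁶. This is where
the absolute normalisation of the Weyl product is verified. -/
theorem oscInt_const [CompleteSpace V] (v : V) : oscInt (fun _ => v) = v := by
  refine tendsto_nhds_unique (tempered_const v).tendsto_gauss ?_
  have h1 : Tendsto (fun ε : ℝ => ((2 * Real.pi) ^ 6)⁻¹ *
      (Real.pi ^ 6 / ((ε ^ 2 / 2) ^ 2 + 1 / 4) ^ 3)) (𝓝[>] 0) (𝓝 1) := by
    have hc : ContinuousAt (fun ε : ℝ => ((2 * Real.pi) ^ 6)⁻¹ *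
      (Real.pi ^ 6 / ((ε ^ 2 / 2) ^ 2 + 1 / 4) ^ 3)) 0 := by
      refine ContinuousAt.mul continuousAt_const (ContinuousAt.div continuousAt_const ?_ (by norm_num))
      fun_prop
    have := hc.tendsto
    have e : ((2 * Real.pi) ^ 6)⁻¹ * (Real.pi ^ 6 / (((0 : ℝ) ^ 2 / 2) ^ 2 + 1 / 4) ^ 3) = 1 := by
      have := Real.pi_pos
      field_simp
      norm_num
    rw [e] at this
    exact this.mono_left nhdsWithin_le_nhds
  have h2 := h1.smul_const v
  rw [one_smul] at h2
  refine h2.congr' ?_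
  filter_upwards [eventually_Ioc] with ε hε
  rw [oscReg, integral_smul_const, integral_osc_mul_gaussCut hε, mul_smul,
    ← real_smul_eq_coe_smul]

theorem oscInt_sum {κ : Type*} [CompleteSpace V] (s : Finset κ) {b : κ → DPhase → V}
    (hb : ∀ j ∈ s, Tempered (b j)) :
    oscInt (fun Z => ∑ j ∈ s, b j Z) = ∑ j ∈ s, oscInt (b j) := by
  classical
  induction s using Finset.induction_on with
  | empty => simpa using oscInt_const (0 : V)
  | insert j s hj ih =>
    simp only [Finset.sum_insert hj]
    rw [oscInt_add (hb j (Finset.mem_insert_self _ _))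
      (Tempered.sum s fun k hk => hb k (Finset.mem_insert_of_mem hk)),
      ih fun k hk => hb k (Finset.mem_insert_of_mem hk)]

theorem RapidDecay.fderiv_apply {χ : DPhase → ℂ} (hχ : RapidDecay χ) (v : DPhase) :
    RapidDecay (fun Z => fderiv ℝ χ Z v) := fun r => (hχ r).fderiv_apply v

/-- Multiplication by a coordinate turns into differentiation under the oscillatory integral. -/
theorem oscInt_coord_smul [CompleteSpace V] {b : DPhase → V} (hb : Tempered b) (α : DirIdx) :
    oscInt (fun Z => coord α Z • b Z) = Complex.I • oscInt (fun Z => fderiv ℝ b Z (dir α)) := by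
  -- The derivative of the Gaussian is again an admissible cutoff, so the term in which the
  -- derivative hits the cutoff is ε times a convergent quantity.
  have hg' := rapidDecay_gaussCut.fderiv_apply (dir α)
  have hε0 : Tendsto (fun ε : ℝ => ε) (𝓝[>] 0) (𝓝 0) := tendsto_id.mono_left nhdsWithin_le_nhds
  have lim : Tendsto (fun ε : ℝ => Complex.I • (oscReg gaussCut ε (fun Z => fderiv ℝ b Z (dir α))
      + ε • oscReg (fun Z => fderiv ℝ gaussCut Z (dir α)) ε b)) (𝓝[>] 0)
      (𝓝 (Complex.I • (oscInt (fun Z => fderiv ℝ b Z (dir α)) + (0 : ℝ) • _))) :=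
    ((hb.fderiv_apply (dir α)).tendsto_gauss.add
      (hε0.smul (hb.tendsto_oscReg hg'))).const_smul Complex.I
  rw [zero_smul, add_zero] at lim
  refine tendsto_nhds_unique (hb.coord_smul α).tendsto_gauss (lim.congr' ?_)
  filter_upwards [eventually_Ioc] with ε hε
  have hgd : Differentiable ℝ gaussCut := rapidDecay_gaussCut.contDiff.differentiable (by simp)
  have hgε : ContDiff ℝ ∞ (fun Z => gaussCut (ε • Z)) :=
    rapidDecay_gaussCut.contDiff.comp (contDiff_id.const_smul ε)
  have hbs := hb.contDiff
  have hbd : Differentiable ℝ b := hbs.differentiable (by simp)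
  have hd : ∀ Z, fderiv ℝ (fun Z => gaussCut (ε • Z) • b Z) Z (dir α)
      = gaussCut (ε • Z) • fderiv ℝ b Z (dir α)
        + ε • fderiv ℝ gaussCut (ε • Z) (dir α) • b Z := fun Z => by
    have h : HasFDerivAt (fun Z => smulC V (gaussCut (ε • Z)) (b Z)) _ Z :=
      (smulC V).hasFDerivAt_of_bilinear (hgε.differentiable (by simp) Z).hasFDerivAt
        (hbd Z).hasFDerivAt
    have h' : fderiv ℝ (fun Z => gaussCut (ε • Z) • b Z) Z = _ := h.fderiv
    rw [h', fderiv_comp_smul hgd]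
    simp [smulC_apply]
  have j0 := hb.integrable rapidDecay_gaussCut hε
  have j1 := (hb.coord_smul α).integrable rapidDecay_gaussCut hε
  have j2 := (hb.fderiv_apply (dir α)).integrable rapidDecay_gaussCut hε
  have j3 := hb.integrable hg' hε
  have e1 : ∀ Z, osc Z • fderiv ℝ (fun Z => gaussCut (ε • Z) • b Z) Z (dir α)
      = (osc Z * gaussCut (ε • Z)) • fderiv ℝ b Z (dir α)
        + ε • (osc Z * fderiv ℝ gaussCut (ε • Z) (dir α)) • b Z := fun Z => by
    rw [hd, smul_add, mul_smul, mul_smul, smul_comm (osc Z) ε]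
  have e2 : ∀ Z, osc Z • coord α Z • gaussCut (ε • Z) • b Z
      = (osc Z * gaussCut (ε • Z)) • coord α Z • b Z := fun Z => by
    rw [mul_smul, smul_comm (coord α Z)]
  have key := integral_osc_smul_fderiv α (b := fun Z => gaussCut (ε • Z) • b Z)
    ((smulC V).isBoundedBilinearMap.contDiff.comp (hgε.prodMk hbs))
    (by simpa only [mul_smul] using j0)
    (by simp only [e1]; exact j2.add (j3.smul ε)) (by simp only [e2]; exact j1)
  have j4 : Integrable (fun Z => ε • (osc Z * fderiv ℝ gaussCut (ε • Z) (dir α)) • b Z) := j3.smul ε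
  simp only [e1, e2] at key
  rw [integral_add j2 j4, integral_smul] at key
  rw [oscReg, oscReg, oscReg, smul_comm ε, ← smul_add, smul_comm Complex.I, key, smul_neg,
    ← mul_smul, Complex.I_mul_I, neg_smul, one_smul, neg_neg]

end OscInt

/-! ### Taylor remainders of families -/

section Taylor

universe u

variable {E : Type} [NormedAddCommGroup E] [NormedSpace ℝ E]
variable {V : Type u} [NormedAddCommGroup V] [NormedSpace ℝ V]

theorem fderiv_fderiv_symm {f : E → V} (hf : ContDiff ℝ ∞ f) (x v w : E) :
    fderiv ℝ (fderiv ℝ f) x v w = fderiv ℝ (fderiv ℝ f) x w v := by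
  have h : IsSymmSndFDerivAt ℝ f x := hf.contDiffAt.isSymmSndFDerivAt (by
    rw [minSmoothness_of_isRCLikeNormedField]; exact WithTop.coe_le_coe.2 le_top)
  exact h v w

theorem hasFDerivAt_fderiv_apply {f : E → V} (hf : ContDiff ℝ ∞ f) (x v : E) :
    HasFDerivAt (fun y => fderiv ℝ f y v) (fderiv ℝ (fderiv ℝ f) x v) x := by
  have h1 : ContDiff ℝ ∞ (fderiv ℝ f) := hf.fderiv_right (by simp)
  have h : HasFDerivAt (fun y => ContinuousLinearMap.apply ℝ V v (fderiv ℝ f y)) _ x :=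
    (ContinuousLinearMap.apply ℝ V v).hasFDerivAt.comp x (h1.differentiable (by simp) x).hasFDerivAt
  refine h.congr_fderiv ?_
  ext w
  exact fderiv_fderiv_symm hf x w v

theorem fderiv_fderiv_apply {f : E → V} (hf : ContDiff ℝ ∞ f) (v : E) :
    fderiv ℝ (fun y => fderiv ℝ f y v) = fun x => fderiv ℝ (fderiv ℝ f) x v :=
  funext fun x => (hasFDerivAt_fderiv_apply hf x v).fderiv

theorem norm_sub_le_of_segment {f : E → V} (hf : ContDiff ℝ ∞ f) {x y : E} {C : ℝ}
    (hC : ∀ z ∈ segment ℝ x y, ‖fderiv ℝ f z‖ ≤ C) : ‖f y - f x‖ ≤ C * ‖y - x‖ :=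
  (convex_segment x y).norm_image_sub_le_of_norm_fderiv_le
    (fun z _ => hf.differentiable (by simp) z) hC (left_mem_segment ℝ x y)
    (right_mem_segment ℝ x y)

theorem norm_taylor_le_of_segment {f : E → V} (hf : ContDiff ℝ ∞ f) {x y : E} {C : ℝ}
    (hC0 : 0 ≤ C) (hC : ∀ z ∈ segment ℝ x y, ‖fderiv ℝ (fderiv ℝ f) z‖ ≤ C) :
    ‖f y - f x - fderiv ℝ f x (y - x)‖ ≤ C * ‖y - x‖ ^ 2 := by
  have h1 : ContDiff ℝ ∞ (fderiv ℝ f) := hf.fderiv_right (by simp)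
  have h2 : ∀ z ∈ segment ℝ x y, ‖fderiv ℝ f z - fderiv ℝ f x‖ ≤ C * ‖y - x‖ := by
    intro z hz
    have hsub : segment ℝ x z ⊆ segment ℝ x y :=
      (convex_segment x y).segment_subset (left_mem_segment ℝ x y) hz
    refine (norm_sub_le_of_segment h1 fun w hw => hC w (hsub hw)).trans ?_
    refine mul_le_mul_of_nonneg_left ?_ hC0
    simpa [dist_eq_norm, norm_sub_rev] using (norm_sub_le_of_mem_segment hz)
  have h3 := (convex_segment x y).norm_image_sub_le_of_norm_fderiv_le'
    (fun z _ => hf.differentiable (by simp) z) h2 (left_mem_segment ℝ x y)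
    (right_mem_segment ℝ x y)
  rw [pow_two, ← mul_assoc]
  exact h3

theorem bracket_rpow_le_of_norm_le {x y : E} {K m : ℝ} (hK : 1 ≤ K) (hm : 0 ≤ m)
    (h : ‖y‖ ≤ (K - 1) + K * ‖x‖) : (1 + ‖y‖) ^ m ≤ K ^ m * (1 + ‖x‖) ^ m := by
  rw [← Real.mul_rpow (by linarith) (by positivity)]
  exact Real.rpow_le_rpow (by positivity) (by linarith) hm

theorem contDiff_translate {f : E → V} (hf : ContDiff ℝ ∞ f) (H : E) :
    ContDiff ℝ ∞ fun Z => f (Z + H) := hf.comp (contDiff_id.add contDiff_const)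

theorem contDiff_taylor_translate {f : E → V} (hf : ContDiff ℝ ∞ f) (H : E) :
    ContDiff ℝ ∞ fun Z => f (Z + H) - f Z - fderiv ℝ f Z H :=
  ((contDiff_translate hf H).sub hf).sub ((hf.fderiv_right (by simp)).clm_apply contDiff_const)

theorem fderiv_taylor_translate {f : E → V} (hf : ContDiff ℝ ∞ f) (H : E) :
    fderiv ℝ (fun Z => f (Z + H) - f Z - fderiv ℝ f Z H)
      = fun Z => fderiv ℝ f (Z + H) - fderiv ℝ f Z - fderiv ℝ (fderiv ℝ f) Z H := by
  funext Z
  have hd := hf.differentiable (by simp)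
  have h1 : HasFDerivAt (fun Z => f (Z + H)) (fderiv ℝ f (Z + H)) Z :=
    (hasFDerivAt_comp_add_right H).2 (hd (Z + H)).hasFDerivAt
  exact ((h1.sub (hd Z).hasFDerivAt).sub (hasFDerivAt_fderiv_apply hf Z H)).fderiv

/-- The first-order Taylor remainder under small translations. -/
theorem uniformSymbol_taylor_translate {m : ℝ} (hm : 0 ≤ m) {f : E → V}
    (h : UniformSymbol (fun (_ : Unit) Z => (1 : ℝ) * (1 + ‖Z‖) ^ m) fun _ => f) :
    UniformSymbol (fun (H : Metric.closedBall (0 : E) 1) Z => ‖(H : E)‖ ^ 2 * (1 + ‖Z‖) ^ m)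
      (fun H Z => f (Z + H) - f Z - fderiv ℝ f Z H) := by
  refine ⟨fun H => contDiff_taylor_translate (h.1 ()) H, fun n => ?_⟩
  -- The derivative of the remainder of f is the remainder of f', with values in `E →L[ℝ] V`. Since
  -- E lies in the lowest universe, this space stays in the universe of V.
  induction n generalizing V with
  | zero =>
    obtain ⟨C, hC, hb⟩ := h.fderiv.fderiv.bound
    refine derivBound_zero_iff.2 ⟨C * 2 ^ m, by positivity, fun H Z => ?_⟩
    have hH : ‖(H : E)‖ ≤ 1 := mem_closedBall_zero_iff.1 H.2
    have key := norm_taylor_le_of_segment (h.1 ()) (x := Z) (y := Z + H)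
      (C := C * (2 ^ m * (1 + ‖Z‖) ^ m)) (by positivity) (fun z hz => by
        refine (hb () z).trans (mul_le_mul_of_nonneg_left ?_ hC)
        rw [one_mul]
        refine bracket_rpow_le_of_norm_le one_le_two hm ?_
        have h1 := norm_sub_le_of_mem_segment hz
        have h2 : ‖z‖ ≤ ‖Z‖ + ‖z - Z‖ := by
          simpa using norm_add_le Z (z - Z)
        rw [add_sub_cancel_left] at h1
        have := norm_nonneg Z
        linarith)
    rw [add_sub_cancel_left] at key
    refine key.trans (le_of_eq ?_)
    ring
  | succ n ih =>
    rw [derivBound_succ_iff]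
    simp only [fderiv_taylor_translate (h.1 ())]
    exact ih h.fderiv

theorem hasFDerivAt_dilate {f : E → V} (hf : ContDiff ℝ ∞ f) (t : ℝ) (Z : E) :
    HasFDerivAt (fun Z => f (t • Z)) (t • fderiv ℝ f (t • Z)) Z := by
  have hd := hf.differentiable (by simp)
  rw [← fderiv_comp_smul hd]
  exact (hd.comp (differentiable_id.const_smul t) Z).hasFDerivAt

theorem contDiff_dilate {f : E → V} (hf : ContDiff ℝ ∞ f) (t : ℝ) :
    ContDiff ℝ ∞ fun Z => f (t • Z) := hf.comp (contDiff_id.const_smul t)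

theorem norm_le_of_mem_segment_smul {s σ : ℝ} (hσ : |σ| ≤ 1) {z Z : E}
    (hz : z ∈ segment ℝ (s • Z) ((s + σ) • Z)) : ‖z‖ ≤ ((2 + |s|) - 1) + (2 + |s|) * ‖Z‖ := by
  have h1 := norm_sub_le_of_mem_segment hz
  have h2 : ‖z‖ ≤ ‖s • Z‖ + ‖z - s • Z‖ := by simpa using norm_add_le (s • Z) (z - s • Z)
  have e : (s + σ) • Z - s • Z = σ • Z := by rw [add_smul, add_sub_cancel_left]
  rw [e, norm_smul, Real.norm_eq_abs] at h1
  rw [norm_smul, Real.norm_eq_abs] at h2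
  have := norm_nonneg Z
  have := abs_nonneg s
  nlinarith [mul_le_mul_of_nonneg_right hσ (norm_nonneg Z)]

/-- Differentiation produces s times the difference for f' plus σ f'((s + σ)Z), and the second term
already carries the factor σ. The extra power of 1 + ‖Z‖ comes from the displacement σZ. -/
theorem uniformSymbol_dilate_sub {m : ℝ} (hm : 0 ≤ m) (s : ℝ) {f : E → V}
    (h : UniformSymbol (fun (_ : Unit) Z => (1 : ℝ) * (1 + ‖Z‖) ^ m) fun _ => f) :
    UniformSymbol (fun (σ : Set.Icc (-1 : ℝ) 1) Z => |(σ : ℝ)| * (1 + ‖Z‖) ^ (m + 1))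
      (fun σ Z => f ((s + σ) • Z) - f (s • Z)) := by
  refine ⟨fun σ => (contDiff_dilate (h.1 ()) _).sub (contDiff_dilate (h.1 ()) _), fun n => ?_⟩
  induction n generalizing V with
  | zero =>
    obtain ⟨C, hC, hb⟩ := h.fderiv.bound
    refine derivBound_zero_iff.2 ⟨C * (2 + |s|) ^ m, by positivity, fun σ Z => ?_⟩
    have hσ : |(σ : ℝ)| ≤ 1 := abs_le.2 σ.2
    have key := norm_sub_le_of_segment (h.1 ()) (x := s • Z) (y := (s + σ) • Z)
      (C := C * ((2 + |s|) ^ m * (1 + ‖Z‖) ^ m)) (fun z hz => by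
        refine (hb () z).trans (mul_le_mul_of_nonneg_left ?_ hC)
        rw [one_mul]
        exact bracket_rpow_le_of_norm_le (by linarith [abs_nonneg s]) hm
          (norm_le_of_mem_segment_smul hσ hz))
    rw [add_smul, add_sub_cancel_left, norm_smul, Real.norm_eq_abs, ← add_smul] at key
    refine key.trans ?_
    rw [← bracket_mul, Real.rpow_one]
    calc _ = C * (2 + |s|) ^ m * (|(σ : ℝ)| * ((1 + ‖Z‖) ^ m * ‖Z‖)) := by ring
      _ ≤ _ := by gcongr; linarith
  | succ n ih =>
    rw [derivBound_succ_iff]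
    have hF := h.fderiv
    have e : (fun (σ : Set.Icc (-1 : ℝ) 1) => fderiv ℝ fun Z => f ((s + σ) • Z) - f (s • Z))
        = fun (σ : Set.Icc (-1 : ℝ) 1) Z => (s • ContinuousLinearMap.id ℝ (E →L[ℝ] V))
            (fderiv ℝ f ((s + σ) • Z) - fderiv ℝ f (s • Z))
          + ((σ : ℝ) • ContinuousLinearMap.id ℝ (E →L[ℝ] V)) (fderiv ℝ f ((s + σ) • Z)) := by
      funext σ Z
      rw [((hasFDerivAt_dilate (h.1 ()) (s + σ) Z).fun_sub
        (hasFDerivAt_dilate (h.1 ()) s Z)).fderiv]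
      simp only [smul_apply, ContinuousLinearMap.id_apply, add_smul, smul_sub]
      abel
    rw [e]
    have hs1 : ∀ σ : Set.Icc (-1 : ℝ) 1, ContDiff ℝ ∞ fun Z => fderiv ℝ f ((s + σ) • Z) :=
      fun σ => contDiff_dilate (hF.1 ()) _
    have hs2 : ContDiff ℝ ∞ fun Z => fderiv ℝ f (s • Z) := contDiff_dilate (hF.1 ()) _
    have hσs : ∀ σ : Set.Icc (-1 : ℝ) 1, |s + σ| ≤ |s| + 1 := fun σ =>
      (abs_add_le _ _).trans (add_le_add_right (abs_le.2 σ.2) _)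
    have d1 := (ih hF).clm_comp (c := fun _ : Set.Icc (-1 : ℝ) 1 => |s|) (fun σ => (hs1 σ).sub hs2)
      (fun _ => s • ContinuousLinearMap.id ℝ (E →L[ℝ] V)) (fun _ => norm_smul_id_le s)
    have d2 := (((hF.reindex fun _ : Set.Icc (-1 : ℝ) 1 => ()).comp_smul (fun σ => s + σ)
      hσs).2 n).clm_comp (c := fun σ : Set.Icc (-1 : ℝ) 1 => |(σ : ℝ)|) hs1
      (fun σ => (σ : ℝ) • ContinuousLinearMap.id ℝ (E →L[ℝ] V)) (fun σ => norm_smul_id_le _)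
    refine DerivBound.add (fun σ => ((s • ContinuousLinearMap.id ℝ (E →L[ℝ] V)).contDiff.comp
      ((hs1 σ).sub hs2))) (fun σ => (((σ : ℝ) • ContinuousLinearMap.id ℝ (E →L[ℝ] V)).contDiff.comp
      (hs1 σ))) (d1.mono |s| (abs_nonneg s) fun σ Z => ?_)
      (d2.mono ((1 + |s|) ^ m) (by positivity) fun σ Z => ?_)
    · simp
    · have h1 : (1 + ‖(s + (σ : ℝ)) • Z‖) ^ m ≤ (1 + |s|) ^ m * (1 + ‖Z‖) ^ m := by
        refine bracket_rpow_le_of_norm_le (by linarith [abs_nonneg s]) hm ?_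
        rw [norm_smul, Real.norm_eq_abs]
        have := mul_le_mul_of_nonneg_right (hσs σ) (norm_nonneg Z)
        linarith [abs_nonneg s]
      have h2 := bracket_le Z (r := m) (s := m + 1) (by linarith)
      calc |(σ : ℝ)| * (1 * (1 + ‖(s + (σ : ℝ)) • Z‖) ^ m)
          ≤ |(σ : ℝ)| * ((1 + |s|) ^ m * (1 + ‖Z‖) ^ (m + 1)) := by
            rw [one_mul]
            gcongr
            exact h1.trans (by gcongr)
        _ = _ := by ring

/-- The first-order Taylor remainder under dilations. -/
theorem uniformSymbol_taylor_dilate {m : ℝ} (hm : 0 ≤ m) (s : ℝ) {f : E → V}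
    (h : UniformSymbol (fun (_ : Unit) Z => (1 : ℝ) * (1 + ‖Z‖) ^ m) fun _ => f) :
    UniformSymbol (fun (σ : Set.Icc (-1 : ℝ) 1) Z => (σ : ℝ) ^ 2 * (1 + ‖Z‖) ^ (m + 2))
      (fun σ Z => f ((s + σ) • Z) - f (s • Z) - (σ : ℝ) • fderiv ℝ f (s • Z) Z) := by
  have hsm : ∀ {W : Type u} [NormedAddCommGroup W] [NormedSpace ℝ W] {g : E → W},
      ContDiff ℝ ∞ g → ∀ σ : ℝ, ContDiff ℝ ∞
        fun Z => g ((s + σ) • Z) - g (s • Z) - σ • fderiv ℝ g (s • Z) Z := fun hg σ =>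
    ((contDiff_dilate hg _).sub (contDiff_dilate hg _)).sub
      (((contDiff_dilate (hg.fderiv_right (by simp)) s).clm_apply contDiff_id).const_smul σ)
  refine ⟨fun σ => hsm (h.1 ()) σ, fun n => ?_⟩
  induction n generalizing V with
  | zero =>
    obtain ⟨C, hC, hb⟩ := h.fderiv.fderiv.bound
    refine derivBound_zero_iff.2 ⟨C * (2 + |s|) ^ m, by positivity, fun σ Z => ?_⟩
    have hσ : |(σ : ℝ)| ≤ 1 := abs_le.2 σ.2
    have key := norm_taylor_le_of_segment (h.1 ()) (x := s • Z) (y := (s + σ) • Z)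
      (C := C * ((2 + |s|) ^ m * (1 + ‖Z‖) ^ m)) (by positivity) (fun z hz => by
        refine (hb () z).trans (mul_le_mul_of_nonneg_left ?_ hC)
        rw [one_mul]
        exact bracket_rpow_le_of_norm_le (by linarith [abs_nonneg s]) hm
          (norm_le_of_mem_segment_smul hσ hz))
    have e : (s + σ) • Z - s • Z = (σ : ℝ) • Z := by rw [add_smul, add_sub_cancel_left]
    rw [e, map_smul, norm_smul, mul_pow, Real.norm_eq_abs, sq_abs] at key
    refine key.trans ?_
    have h2 : ‖Z‖ ^ 2 ≤ (1 + ‖Z‖) ^ (2 : ℝ) := by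
      norm_cast
      exact pow_le_pow_left₀ (norm_nonneg _) (by linarith) 2
    rw [← bracket_mul]
    calc _ = C * (2 + |s|) ^ m * ((σ : ℝ) ^ 2 * ((1 + ‖Z‖) ^ m * ‖Z‖ ^ 2)) := by ring
      _ ≤ _ := by gcongr
  | succ n ih =>
    rw [derivBound_succ_iff]
    have hF := h.fderiv
    -- By symmetry of the second derivative, the derivative of the remainder of f is s times the
    -- remainder of f' plus σ times the increment of f'; the latter is covered by
    -- `uniformSymbol_dilate_sub`.
    have e : (fun (σ : Set.Icc (-1 : ℝ) 1) =>
          fderiv ℝ fun Z => f ((s + σ) • Z) - f (s • Z) - (σ : ℝ) • fderiv ℝ f (s • Z) Z)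
        = fun (σ : Set.Icc (-1 : ℝ) 1) Z => (s • ContinuousLinearMap.id ℝ (E →L[ℝ] V))
            (fderiv ℝ f ((s + σ) • Z) - fderiv ℝ f (s • Z)
              - (σ : ℝ) • fderiv ℝ (fderiv ℝ f) (s • Z) Z)
          + ((σ : ℝ) • ContinuousLinearMap.id ℝ (E →L[ℝ] V))
            (fderiv ℝ f ((s + σ) • Z) - fderiv ℝ f (s • Z)) := by
      funext σ Z
      have h3 : HasFDerivAt (fun Z => fderiv ℝ f (s • Z) Z)
          (s • fderiv ℝ (fderiv ℝ f) (s • Z) Z + fderiv ℝ f (s • Z)) Z := by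
        refine ((hasFDerivAt_dilate (hF.1 ()) s Z).clm_apply (hasFDerivAt_id Z)).congr_fderiv ?_
        ext w
        simp [fderiv_fderiv_symm (h.1 ()) (s • Z) w Z, add_comm]
      have h4 : HasFDerivAt
          (fun Z => f ((s + σ) • Z) - f (s • Z) - (σ : ℝ) • fderiv ℝ f (s • Z) Z) _ Z :=
        ((hasFDerivAt_dilate (h.1 ()) (s + σ) Z).sub
        (hasFDerivAt_dilate (h.1 ()) s Z)).sub (h3.const_smul (σ : ℝ))
      rw [h4.fderiv]
      simp only [smul_apply, ContinuousLinearMap.id_apply, add_smul, smul_sub, smul_add,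
        smul_comm s (σ : ℝ)]
      abel
    rw [e]
    have hq := uniformSymbol_dilate_sub hm s hF
    have d1 := (ih hF).clm_comp (c := fun _ : Set.Icc (-1 : ℝ) 1 => |s|) (fun σ => hsm (hF.1 ()) σ)
      (fun _ => s • ContinuousLinearMap.id ℝ (E →L[ℝ] V)) (fun _ => norm_smul_id_le s)
    have d2 := (hq.2 n).clm_comp (c := fun σ : Set.Icc (-1 : ℝ) 1 => |(σ : ℝ)|) hq.1
      (fun σ => (σ : ℝ) • ContinuousLinearMap.id ℝ (E →L[ℝ] V)) (fun σ => norm_smul_id_le _)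
    refine DerivBound.add (fun σ => ((s • ContinuousLinearMap.id ℝ (E →L[ℝ] V)).contDiff.comp
      (hsm (hF.1 ()) σ))) (fun σ => (((σ : ℝ) • ContinuousLinearMap.id ℝ (E →L[ℝ] V)).contDiff.comp
      (hq.1 σ))) (d1.mono |s| (abs_nonneg s) fun σ Z => le_rfl)
      (d2.mono 1 zero_le_one fun σ Z => ?_)
    rw [one_mul, ← mul_assoc, ← pow_two, sq_abs]
    exact mul_le_mul_of_nonneg_left (bracket_le Z (by linarith)) (sq_nonneg _)

end Taylor

/-! ### Expansion of scaled oscillatory integrals -/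

section Smear

universe u

variable {ι : Type*} {V : Type u} [NormedAddCommGroup V] [NormedSpace ℝ V] [NormedSpace ℂ V]
  [IsScalarTower ℝ ℂ V]

theorem Tempered.exists_nonneg {b : DPhase → V} (hb : Tempered b) : ∃ m : ℝ, 0 ≤ m ∧
    UniformSymbol (fun (_ : Unit) Z => (1 : ℝ) * (1 + ‖Z‖) ^ m) fun _ => b := by
  obtain ⟨m, h⟩ := hb
  exact ⟨max m 0, le_max_right _ _, h.bracket_mono (fun _ => zero_le_one) (le_max_left _ _)⟩

theorem Tempered.comp_affine {b : DPhase → V} (hb : Tempered b) (t : ℝ) (Y : DPhase) :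
    Tempered (fun Z => b (Y + t • Z)) := by
  obtain ⟨m, hm, h⟩ := hb.exists_nonneg
  have h1 := h.comp_affine (fun _ => t • ContinuousLinearMap.id ℝ DPhase) (fun _ => Y)
    (K := |t|) (fun _ => norm_smul_id_le t)
  refine ⟨m, h1.mono ((1 + ‖Y‖ + |t|) ^ m) (by positivity) fun _ Z => ?_⟩
  simp only [one_mul, smul_apply, ContinuousLinearMap.id_apply]
  refine bracket_rpow_le_of_norm_le (by linarith [norm_nonneg Y, abs_nonneg t]) hm ?_
  have h2 := norm_add_le Y (t • Z)
  rw [norm_smul, Real.norm_eq_abs] at h2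
  have := mul_nonneg (norm_nonneg Y) (norm_nonneg Z)
  have := norm_nonneg Z
  have := abs_nonneg t
  linarith

theorem Tempered.dilate {b : DPhase → V} (hb : Tempered b) (t : ℝ) :
    Tempered (fun Z => b (t • Z)) := by simpa using hb.comp_affine t 0

theorem Tempered.fderiv {b : DPhase → V} (hb : Tempered b) : Tempered (fderiv ℝ b) := by
  obtain ⟨m, h⟩ := hb
  exact ⟨m, h.fderiv⟩

theorem fderiv_smul_self_eq {f : DPhase → V} (s : ℝ) (Z : DPhase) :
    fderiv ℝ f (s • Z) Z = ∑ α, coord α Z • fderiv ℝ f (s • Z) (codir α) := by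
  conv_lhs => rw [← sum_coord_smul_codir Z]
  rw [map_sum]
  simp only [map_smul]
  refine Finset.sum_congr rfl fun α _ => ?_
  rw [sum_coord_smul_codir]

theorem Tempered.fderiv_dilate_self {f : DPhase → V} (hf : Tempered f) (s : ℝ) :
    Tempered (fun Z => _root_.fderiv ℝ f (s • Z) Z) := by
  simp only [fderiv_smul_self_eq]
  exact Tempered.sum _ fun α _ => ((hf.fderiv_apply (codir α)).dilate s).coord_smul α

/-- The constant coefficient second-order operator generating the Weyl product. -/
def mixedLaplace (a : DPhase → V) (Z : DPhase) : V :=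
  ∑ α, fderiv ℝ (fun W => fderiv ℝ a W (codir α)) Z (dir α)

theorem UniformSymbol.mixedLaplace {w : ι → DPhase → ℝ} {a : ι → DPhase → V}
    (h : UniformSymbol w a) : UniformSymbol w (fun i => mixedLaplace (a i)) :=
  UniformSymbol.sum Finset.univ fun α _ => (h.fderiv_apply (codir α)).fderiv_apply (dir α)

theorem fderiv_mixedLaplace {a : DPhase → V} (ha : ContDiff ℝ ∞ a) :
    fderiv ℝ (mixedLaplace a) = mixedLaplace (fderiv ℝ a) := by
  have h1 : ∀ v, ContDiff ℝ ∞ (fun W => fderiv ℝ a W v) := fun v =>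
    (ha.fderiv_right (by simp)).clm_apply contDiff_const
  funext Z
  have h2 : HasFDerivAt (mixedLaplace a) (∑ α, fderiv ℝ (fderiv ℝ fun W => fderiv ℝ a W (codir α)) Z
      (dir α)) Z := HasFDerivAt.fun_sum fun α _ => hasFDerivAt_fderiv_apply (h1 (codir α)) Z (dir α)
  rw [h2.fderiv, mixedLaplace]
  refine Finset.sum_congr rfl fun α _ => ?_
  rw [fderiv_fderiv_apply ha]

variable [CompleteSpace V]

/-- The Taylor remainder in σ is a symbol family of size σ², so its oscillatory integral is O(σ²).
This replaces differentiation under an absolutely convergent integral. -/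
theorem hasDerivAt_oscInt_dilate {f : DPhase → V} (hf : Tempered f) (s : ℝ) :
    HasDerivAt (fun s : ℝ => oscInt fun Z => f (s • Z))
      (oscInt fun Z => fderiv ℝ f (s • Z) Z) s := by
  obtain ⟨m, hm, h⟩ := hf.exists_nonneg
  obtain ⟨C, hC, hb⟩ := (uniformSymbol_taylor_dilate hm s h).norm_oscInt_le (fun _ => sq_nonneg _)
  rw [hasDerivAt_iff_isLittleO_nhds_zero]
  have hO : (fun σ : ℝ => (oscInt fun Z => f ((s + σ) • Z)) - (oscInt fun Z => f (s • Z))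
      - σ • oscInt fun Z => fderiv ℝ f (s • Z) Z) =O[𝓝 0] fun σ : ℝ => σ ^ 2 := by
    refine Asymptotics.IsBigO.of_bound C ?_
    filter_upwards [Icc_mem_nhds (show (-1 : ℝ) < 0 by norm_num) zero_lt_one] with σ hσ
    have e : (oscInt fun Z => f ((s + σ) • Z)) - (oscInt fun Z => f (s • Z))
        - σ • oscInt (fun Z => fderiv ℝ f (s • Z) Z)
        = oscInt fun Z => f ((s + σ) • Z) - f (s • Z) - σ • fderiv ℝ f (s • Z) Z := by
      simp only [real_smul_eq_coe_smul σ]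
      rw [oscInt_sub ((hf.dilate _).sub (hf.dilate _)) ((hf.fderiv_dilate_self s).const_smul _),
        oscInt_sub (hf.dilate _) (hf.dilate _), oscInt_const_smul (hf.fderiv_dilate_self s)]
    rw [e, Real.norm_of_nonneg (sq_nonneg σ)]
    exact hb ⟨σ, hσ⟩
  exact hO.trans_isLittleO (Asymptotics.isLittleO_pow_id one_lt_two)

theorem hasFDerivAt_oscInt_translate {a : DPhase → V} (ha : Tempered a) (s : ℝ) (Y : DPhase) :
    HasFDerivAt (fun Y => oscInt fun Z => a (Y + s • Z))
      (oscInt fun Z => fderiv ℝ a (Y + s • Z)) Y := by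
  have hf : Tempered fun W => a (Y + W) := by simpa using ha.comp_affine 1 Y
  obtain ⟨m, hm, h⟩ := hf.exists_nonneg
  have h1 := (uniformSymbol_taylor_translate hm h).comp_smul (fun _ => s) (fun _ => le_rfl)
  have h2 : UniformSymbol (fun (H : Metric.closedBall (0 : DPhase) 1) Z =>
      ‖(H : DPhase)‖ ^ 2 * (1 + ‖Z‖) ^ m) _ :=
    h1.mono ((1 + |s|) ^ m) (by positivity) fun H Z => by
      rw [mul_left_comm]
      refine mul_le_mul_of_nonneg_left ?_ (sq_nonneg _)
      refine bracket_rpow_le_of_norm_le (by linarith [abs_nonneg s]) hm ?_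
      rw [norm_smul, Real.norm_eq_abs]
      linarith [abs_nonneg s, norm_nonneg Z]
  obtain ⟨C, hC, hb⟩ := h2.norm_oscInt_le (fun _ => sq_nonneg _)
  rw [hasFDerivAt_iff_isLittleO_nhds_zero]
  have hO : (fun H : DPhase => (oscInt fun Z => a (Y + H + s • Z)) - (oscInt fun Z => a (Y + s • Z))
      - (oscInt fun Z => fderiv ℝ a (Y + s • Z)) H) =O[𝓝 0] fun H : DPhase => ‖H‖ ^ 2 := by
    refine Asymptotics.IsBigO.of_bound C ?_
    filter_upwards [Metric.closedBall_mem_nhds (0 : DPhase) zero_lt_one] with H hH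
    have t1 := ha.fderiv.comp_affine s Y
    have e0 : (oscInt fun Z => fderiv ℝ a (Y + s • Z)) H
        = oscInt fun Z => fderiv ℝ a (Y + s • Z) H :=
      (oscInt_clm_comp t1 (ContinuousLinearMap.apply ℝ V H) fun c v => by simp).symm
    have e : (oscInt fun Z => a (Y + H + s • Z)) - (oscInt fun Z => a (Y + s • Z))
        - (oscInt fun Z => fderiv ℝ a (Y + s • Z)) H
        = oscInt fun Z => a (Y + (s • Z + H)) - a (Y + s • Z)
          - fderiv ℝ (fun W => a (Y + W)) (s • Z) H := by
      rw [e0, ← oscInt_sub (ha.comp_affine _ _) (ha.comp_affine _ _),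
        ← oscInt_sub ((ha.comp_affine _ _).sub (ha.comp_affine _ _))
          ((ha.fderiv_apply H).comp_affine s Y)]
      congr 1
      funext Z
      rw [fderiv_comp_add_left, add_assoc Y H, add_comm H]
    rw [e, Real.norm_of_nonneg (sq_nonneg ‖H‖)]
    exact hb ⟨H, hH⟩
  exact hO.trans_isLittleO (Asymptotics.isLittleO_norm_pow_id one_lt_two)

/-- The radial derivative is the sum of `coord α` times the derivative along `codir α`. Under the
integral each coordinate becomes i times a derivative along `dir α`, which produces the factor s
when it meets sZ. -/
theorem oscInt_fderiv_dilate_self {f : DPhase → V} (hf : Tempered f) (s : ℝ) :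
    (oscInt fun Z => fderiv ℝ f (s • Z) Z)
      = (Complex.I * s) • oscInt fun Z => mixedLaplace f (s • Z) := by
  have hs := hf.contDiff
  have t1 : ∀ α, Tempered fun Z => fderiv ℝ f (s • Z) (codir α) := fun α =>
    (hf.fderiv_apply (codir α)).dilate s
  have t2 : ∀ α, Tempered fun Z => fderiv ℝ (fun W => fderiv ℝ f W (codir α)) (s • Z) (dir α) :=
    fun α => ((hf.fderiv_apply (codir α)).fderiv_apply (dir α)).dilate s
  simp only [fderiv_smul_self_eq, mixedLaplace]
  rw [oscInt_sum _ fun α _ => (t1 α).coord_smul α, oscInt_sum _ fun α _ => t2 α, Finset.smul_sum]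
  refine Finset.sum_congr rfl fun α _ => ?_
  have hd : Differentiable ℝ fun W => fderiv ℝ f W (codir α) :=
    (hf.fderiv_apply (codir α)).contDiff.differentiable (by simp)
  rw [oscInt_coord_smul (t1 α), mul_smul, ← oscInt_const_smul (t2 α)]
  simp only [fderiv_comp_smul hd, smul_apply, real_smul_eq_coe_smul s]

theorem norm_sub_le_sq_of_hasDerivAt {h h' : ℝ → V} {K : ℝ} {p : ℕ} {s₀ : ℝ} (hK : 0 ≤ K)
    (hd : ∀ s, HasDerivAt h (h' s) s) (hb : ∀ s ∈ Set.Icc 0 s₀, ‖h' s‖ ≤ K * s ^ p)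
    {s : ℝ} (hs : s ∈ Set.Icc 0 s₀) : ‖h s - h 0‖ ≤ K * s ^ (p + 1) := by
  have := norm_image_sub_le_of_norm_deriv_le_segment' (f := h) (f' := h') (a := 0) (b := s)
    (C := K * s ^ p) (fun x _ => (hd x).hasDerivWithinAt) (fun x hx => by
      refine (hb x ⟨hx.1, hx.2.le.trans hs.2⟩).trans (mul_le_mul_of_nonneg_left ?_ hK)
      exact pow_le_pow_left₀ hx.1 hx.2.le p) s ⟨hs.1, le_rfl⟩
  rw [sub_zero] at this
  rw [pow_succ, ← mul_assoc]
  exact this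

/-- Weights that vary at most polynomially. -/
structure TemperateWeight (m : ℝ) (ρ : ι → DPhase → ℝ) : Prop where
  nonneg_exp : 0 ≤ m
  nonneg : ∀ i Y, 0 ≤ ρ i Y
  add_le : ∀ i Y Z, ρ i (Y + Z) ≤ ρ i Y * (1 + ‖Z‖) ^ m

/-- The family of all translates and bounded dilates. -/
theorem UniformSymbol.translate_dilate {m : ℝ} {ρ : ι → DPhase → ℝ} (hρ : TemperateWeight m ρ)
    {a : ι → DPhase → V} (h : UniformSymbol ρ a) (s₀ : ℝ) :
    UniformSymbol (fun (p : ι × DPhase × Set.Icc 0 s₀) Z => ρ p.1 p.2.1 * (1 + ‖Z‖) ^ m)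
      (fun p Z => a p.1 (p.2.1 + (p.2.2 : ℝ) • Z)) := by
  have h1 := (h.reindex (Prod.fst : ι × DPhase × Set.Icc 0 s₀ → ι)).comp_affine
    (fun p => (p.2.2 : ℝ) • ContinuousLinearMap.id ℝ DPhase) (fun p => p.2.1)
    (K := s₀) (fun p => (norm_smul_id_le _).trans (by
      rw [abs_of_nonneg p.2.2.2.1]; exact p.2.2.2.2))
  refine h1.mono ((1 + |s₀|) ^ m) (by positivity) fun p Z => ?_
  simp only [smul_apply, ContinuousLinearMap.id_apply]
  refine (hρ.add_le _ _ _).trans ?_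
  rw [mul_left_comm]
  refine mul_le_mul_of_nonneg_left ?_ (hρ.nonneg _ _)
  refine bracket_rpow_le_of_norm_le (by linarith [abs_nonneg s₀]) hρ.nonneg_exp ?_
  rw [norm_smul, Real.norm_of_nonneg p.2.2.2.1]
  have := mul_le_mul_of_nonneg_right (p.2.2.2.2.trans (le_abs_self s₀)) (norm_nonneg Z)
  linarith [abs_nonneg s₀, norm_nonneg Z]

theorem UniformSymbol.tempered_of_temperateWeight {m : ℝ} {ρ : ι → DPhase → ℝ}
    (hρ : TemperateWeight m ρ) {a : ι → DPhase → V} (h : UniformSymbol ρ a) (i : ι) :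
    Tempered (a i) := by
  simpa using (h.translate_dilate hρ 1).tempered (i, 0, ⟨1, zero_le_one, le_rfl⟩)

/-- `oscInt` of the translated and dilated amplitude. -/
def oscScaled (s : ℝ) (a : DPhase → V) (Y : DPhase) : V := oscInt fun Z => a (Y + s • Z)

theorem UniformSymbol.norm_oscScaled_le {m : ℝ} {ρ : ι → DPhase → ℝ} (hρ : TemperateWeight m ρ)
    {a : ι → DPhase → V} (h : UniformSymbol ρ a) (s₀ : ℝ) :
    ∃ C : ℝ, 0 ≤ C ∧ ∀ i Y, ∀ s ∈ Set.Icc 0 s₀, ‖oscScaled s (a i) Y‖ ≤ C * ρ i Y := by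
  obtain ⟨C, hC, hb⟩ := (h.translate_dilate hρ s₀).norm_oscInt_le (fun p => hρ.nonneg _ _)
  exact ⟨C, hC, fun i Y s hs => hb (i, Y, ⟨s, hs⟩)⟩

theorem oscScaled_zero (a : DPhase → V) (Y : DPhase) : oscScaled 0 a Y = a Y := by
  simp [oscScaled, oscInt_const]

/-- The evolution equation behind the Weyl expansion: in the time variable s²/2 it is a
Schrödinger-type equation with generator `mixedLaplace` and initial value a. -/
theorem hasDerivAt_oscScaled {a : DPhase → V} (ha : Tempered a) (Y : DPhase) (s : ℝ) :
    HasDerivAt (fun s => oscScaled s a Y) ((Complex.I * s) • oscScaled s (mixedLaplace a) Y) s := by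
  have hf : Tempered fun W => a (Y + W) := by simpa using ha.comp_affine 1 Y
  have h := hasDerivAt_oscInt_dilate hf s
  rw [oscInt_fderiv_dilate_self hf] at h
  have e : mixedLaplace (fun W => a (Y + W)) = fun Z => mixedLaplace a (Y + Z) := by
    funext Z
    refine Finset.sum_congr rfl fun α _ => ?_
    simp only [fderiv_comp_add_left]
    rw [fderiv_comp_add_left (f := fun W => fderiv ℝ a W (codir α))]
  rw [e] at h
  exact h

theorem UniformSymbol.norm_oscScaled_sub_le {m : ℝ} {ρ : ι → DPhase → ℝ}
    (hρ : TemperateWeight m ρ) {a : ι → DPhase → V} (h : UniformSymbol ρ a) (s₀ : ℝ) :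
    ∃ C : ℝ, 0 ≤ C ∧ ∀ i Y, ∀ s ∈ Set.Icc 0 s₀,
      ‖oscScaled s (a i) Y - a i Y‖ ≤ C * ρ i Y * s ^ 2 := by
  obtain ⟨C, hC, hb⟩ := h.mixedLaplace.norm_oscScaled_le hρ s₀
  refine ⟨C, hC, fun i Y s hs => ?_⟩
  have key := norm_sub_le_sq_of_hasDerivAt (p := 1) (K := C * ρ i Y) (s₀ := s₀)
    (mul_nonneg hC (hρ.nonneg i Y))
    (hasDerivAt_oscScaled (h.tempered_of_temperateWeight hρ i) Y) (fun t ht => by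
      rw [norm_smul, norm_mul, Complex.norm_I, one_mul, Complex.norm_real,
        Real.norm_of_nonneg ht.1, pow_one, mul_comm]
      exact mul_le_mul_of_nonneg_right (hb i Y t ht) ht.1) hs
  rwa [oscScaled_zero] at key

/-- The s-derivative of the remainder is i s times the first-order remainder for `mixedLaplace`,
hence O(s³). -/
theorem UniformSymbol.norm_oscScaled_sub_sub_le {m : ℝ} {ρ : ι → DPhase → ℝ}
    (hρ : TemperateWeight m ρ) {a : ι → DPhase → V} (h : UniformSymbol ρ a) (s₀ : ℝ) :
    ∃ C : ℝ, 0 ≤ C ∧ ∀ i Y, ∀ s ∈ Set.Icc 0 s₀,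
      ‖oscScaled s (a i) Y - a i Y - (Complex.I * (s ^ 2 / 2 : ℝ)) • RayOptics.mixedLaplace (a i) Y‖
        ≤ C * ρ i Y * s ^ 4 := by
  obtain ⟨C, hC, hb⟩ := h.mixedLaplace.norm_oscScaled_sub_le hρ s₀
  refine ⟨C, hC, fun i Y s hs => ?_⟩
  have hder : ∀ t : ℝ, HasDerivAt
      (fun t : ℝ => oscScaled t (a i) Y - (Complex.I * (t ^ 2 / 2 : ℝ)) • RayOptics.mixedLaplace (a i) Y)
      ((Complex.I * t) • (oscScaled t (RayOptics.mixedLaplace (a i)) Y - RayOptics.mixedLaplace (a i) Y)) t := fun t => by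
    have h1 : HasDerivAt (fun t : ℝ => Complex.I * ((t ^ 2 / 2 : ℝ) : ℂ)) (Complex.I * t) t := by
      have h2 : HasDerivAt (fun t : ℝ => t ^ 2 / 2) t t := by
        simpa using ((hasDerivAt_pow 2 t).div_const 2)
      exact h2.ofReal_comp.const_mul Complex.I
    have h3 : HasDerivAt (fun t : ℝ => (Complex.I * ((t ^ 2 / 2 : ℝ) : ℂ)) • RayOptics.mixedLaplace (a i) Y)
        ((Complex.I * t) • RayOptics.mixedLaplace (a i) Y) t :=
      ((smulC V).flip (RayOptics.mixedLaplace (a i) Y)).hasFDerivAt.comp_hasDerivAt t h1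
    have := (hasDerivAt_oscScaled (h.tempered_of_temperateWeight hρ i) Y t).sub h3
    rwa [← smul_sub] at this
  have key := norm_sub_le_sq_of_hasDerivAt (p := 3) (K := C * ρ i Y) (s₀ := s₀)
    (mul_nonneg hC (hρ.nonneg i Y)) hder (fun t ht => by
      rw [norm_smul, norm_mul, Complex.norm_I, one_mul, Complex.norm_real,
        Real.norm_of_nonneg ht.1, pow_succ', mul_left_comm]
      exact mul_le_mul_of_nonneg_left (hb i Y t ht) ht.1) hs
  simp only [oscScaled_zero] at key
  refine le_trans (le_of_eq ?_) key
  congr 1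
  simp
  abel

theorem hasFDerivAt_oscScaled {a : DPhase → V} (ha : Tempered a) (s : ℝ) (Y : DPhase) :
    HasFDerivAt (oscScaled s a) (oscScaled s (fderiv ℝ a) Y) Y :=
  hasFDerivAt_oscInt_translate ha s Y

theorem fderiv_oscScaled {a : DPhase → V} (ha : Tempered a) (s : ℝ) :
    fderiv ℝ (oscScaled s a) = oscScaled s (fderiv ℝ a) :=
  funext fun Y => (hasFDerivAt_oscScaled ha s Y).fderiv

theorem contDiff_oscScaled {a : DPhase → V} (ha : Tempered a) (s : ℝ) :
    ContDiff ℝ ∞ (oscScaled s a) := by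
  rw [contDiff_infty]
  intro n
  induction n generalizing V with
  | zero =>
    have : Differentiable ℝ (oscScaled s a) := fun Y =>
      (hasFDerivAt_oscScaled ha s Y).differentiableAt
    exact contDiff_zero.2 this.continuous
  | succ n ih =>
    push_cast
    rw [contDiff_succ_iff_fderiv, fderiv_oscScaled ha]
    exact ⟨fun Y => (hasFDerivAt_oscScaled ha s Y).differentiableAt, by simp, ih ha.fderiv⟩

/-- Differentiation commutes with `oscScaled`, so the sup bound applied to the derivatives of the
amplitude bounds every derivative of the result. -/
theorem UniformSymbol.oscScaled {m : ℝ} {ρ : ι → DPhase → ℝ} (hρ : TemperateWeight m ρ)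
    {a : ι → DPhase → V} (h : UniformSymbol ρ a) {s₀ : ℝ} (s : ι → ℝ)
    (hs : ∀ i, s i ∈ Set.Icc 0 s₀) : UniformSymbol ρ (fun i => oscScaled (s i) (a i)) := by
  refine ⟨fun i => contDiff_oscScaled (h.tempered_of_temperateWeight hρ i) _, fun n => ?_⟩
  induction n generalizing V with
  | zero =>
    obtain ⟨C, hC, hb⟩ := h.norm_oscScaled_le hρ s₀
    exact derivBound_zero_iff.2 ⟨C, hC, fun i Y => hb i Y _ (hs i)⟩
  | succ n ih =>
    rw [derivBound_succ_iff]
    simp only [fderiv_oscScaled (h.tempered_of_temperateWeight hρ _)]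
    exact ih h.fderiv

theorem UniformSymbol.oscScaled_sub {m : ℝ} {ρ : ι → DPhase → ℝ} (hρ : TemperateWeight m ρ)
    {a : ι → DPhase → V} (h : UniformSymbol ρ a) {s₀ : ℝ} (s : ι → ℝ)
    (hs : ∀ i, s i ∈ Set.Icc 0 s₀) :
    UniformSymbol (fun i Y => s i ^ 2 * ρ i Y) (fun i Y => RayOptics.oscScaled (s i) (a i) Y - a i Y) := by
  refine ⟨((h.oscScaled hρ s hs).sub h).1, fun n => ?_⟩
  induction n generalizing V with
  | zero =>
    obtain ⟨C, hC, hb⟩ := h.norm_oscScaled_sub_le hρ s₀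
    exact derivBound_zero_iff.2 ⟨C, hC, fun i Y => (hb i Y _ (hs i)).trans (le_of_eq (by ring))⟩
  | succ n ih =>
    rw [derivBound_succ_iff]
    have e : (fun i => _root_.fderiv ℝ fun Y => RayOptics.oscScaled (s i) (a i) Y - a i Y)
        = fun i Y => RayOptics.oscScaled (s i) (_root_.fderiv ℝ (a i)) Y - _root_.fderiv ℝ (a i) Y := by
      funext i Y
      exact ((hasFDerivAt_oscScaled (h.tempered_of_temperateWeight hρ i) _ Y).sub
        (h.differentiable i Y).hasFDerivAt).fderiv
    rw [e]
    exact ih h.fderiv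

theorem UniformSymbol.oscScaled_sub_sub {m : ℝ} {ρ : ι → DPhase → ℝ} (hρ : TemperateWeight m ρ)
    {a : ι → DPhase → V} (h : UniformSymbol ρ a) {s₀ : ℝ} (s : ι → ℝ)
    (hs : ∀ i, s i ∈ Set.Icc 0 s₀) :
    UniformSymbol (fun i Y => s i ^ 4 * ρ i Y) (fun i Y => RayOptics.oscScaled (s i) (a i) Y - a i Y
      - (Complex.I * (s i ^ 2 / 2 : ℝ)) • RayOptics.mixedLaplace (a i) Y) := by
  refine ⟨fun i => (((h.oscScaled hρ s hs).sub h).1 i).sub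
    ((h.mixedLaplace.const_smul _).1 i), fun n => ?_⟩
  induction n generalizing V with
  | zero =>
    obtain ⟨C, hC, hb⟩ := h.norm_oscScaled_sub_sub_le hρ s₀
    exact derivBound_zero_iff.2 ⟨C, hC, fun i Y => (hb i Y _ (hs i)).trans (le_of_eq (by ring))⟩
  | succ n ih =>
    rw [derivBound_succ_iff]
    have e : (fun i => _root_.fderiv ℝ fun Y => RayOptics.oscScaled (s i) (a i) Y - a i Y
          - (Complex.I * (s i ^ 2 / 2 : ℝ)) • RayOptics.mixedLaplace (a i) Y)
        = fun i Y => RayOptics.oscScaled (s i) (_root_.fderiv ℝ (a i)) Y - _root_.fderiv ℝ (a i) Y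
          - (Complex.I * (s i ^ 2 / 2 : ℝ)) • RayOptics.mixedLaplace (_root_.fderiv ℝ (a i)) Y := by
      funext i Y
      have h3 := ((smulC V (Complex.I * (s i ^ 2 / 2 : ℝ))).hasFDerivAt.comp Y
        (h.mixedLaplace.differentiable i Y).hasFDerivAt)
      have h4 := (((hasFDerivAt_oscScaled (h.tempered_of_temperateWeight hρ i) (s i) Y).sub
        (h.differentiable i Y).hasFDerivAt).sub h3).fderiv
      rw [fderiv_mixedLaplace (h.1 i)] at h4
      exact h4
    rw [e]
    exact ih h.fderiv

end Smear

/-! ### The Weyl product of symbols -/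

/-- `IsWeylProduct` uses the real structure underlying the complex one, the calculus above any
compatible one; the two coincide. -/
theorem normedSpace_real_eq {F : Type*} [NormedAddCommGroup F] [NormedSpace ℂ F]
    [i : NormedSpace ℝ F] [IsScalarTower ℝ ℂ F] : i = NormedSpace.complexToReal := by
  have h : ∀ (r : ℝ) (v : F), i.toSMul.smul r v = (NormedSpace.complexToReal (E := F)).toSMul.smul r v :=
    fun r v => real_smul_eq_coe_smul r v
  have h1 : i.toModule = (NormedSpace.complexToReal (E := F)).toModule := by
    ext r v
    exact h r v
  cases i
  congr

theorem rapidDecay_schwartz (χ : 𝓢(DPhase, ℂ)) : RapidDecay χ := by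
  intro r
  refine ⟨fun _ => χ.smooth ⊤, fun n => ?_⟩
  obtain ⟨k, hk⟩ := exists_nat_ge (-r)
  refine ⟨2 ^ k * ((Finset.Iic (k, n)).sup fun m => SchwartzMap.seminorm ℝ m.1 m.2) χ,
    by positivity, fun _ Z => ?_⟩
  have h := SchwartzMap.one_add_le_sup_seminorm_apply (𝕜 := ℝ) (m := (k, n)) (k := k) (n := n)
    le_rfl le_rfl χ Z
  have hp : (0 : ℝ) < (1 + ‖Z‖) ^ k := by positivity
  have h2 : ((1 + ‖Z‖) ^ k)⁻¹ ≤ (1 + ‖Z‖) ^ r := by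
    rw [← Real.rpow_natCast, ← Real.rpow_neg (by positivity)]
    exact bracket_le Z (by linarith)
  calc ‖iteratedFDeriv ℝ n χ Z‖ = ((1 + ‖Z‖) ^ k * ‖iteratedFDeriv ℝ n χ Z‖) * ((1 + ‖Z‖) ^ k)⁻¹ := by
        field_simp
    _ ≤ _ := mul_le_mul h h2 (by positivity) (by positivity)

section Weyl

variable {ι : Type*} {F₁ F₂ F₃ : Type*}
  [NormedAddCommGroup F₁] [NormedSpace ℂ F₁] [NormedSpace ℝ F₁] [IsScalarTower ℝ ℂ F₁]
  [NormedAddCommGroup F₂] [NormedSpace ℂ F₂] [NormedSpace ℝ F₂] [IsScalarTower ℝ ℂ F₂]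
  [NormedAddCommGroup F₃] [NormedSpace ℂ F₃] [NormedSpace ℝ F₃] [IsScalarTower ℝ ℂ F₃]

/-- Composition of operators as a real bilinear map. -/
def compR (F₁ F₂ F₃ : Type*)
    [NormedAddCommGroup F₁] [NormedSpace ℂ F₁]
    [NormedAddCommGroup F₂] [NormedSpace ℂ F₂] [NormedSpace ℝ F₂] [IsScalarTower ℝ ℂ F₂]
    [NormedAddCommGroup F₃] [NormedSpace ℂ F₃] [NormedSpace ℝ F₃] [IsScalarTower ℝ ℂ F₃] :
    (F₂ →L[ℂ] F₃) →L[ℝ] (F₁ →L[ℂ] F₂) →L[ℝ] (F₁ →L[ℂ] F₃) :=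
  (ContinuousLinearMap.compL ℂ F₁ F₂ F₃).bilinearRestrictScalars ℝ

/-- The amplitude `(X', X'') ↦ f(X') g(X'')`. -/
def weylAmplitude (f : Phase → F₂ →L[ℂ] F₃) (g : Phase → F₁ →L[ℂ] F₂) (Z : DPhase) :
    F₁ →L[ℂ] F₃ := (f Z.1).comp (g Z.2)

/-- The Weyl product of two operator-valued symbols. -/
def weyl (lam : ℝ) (f : Phase → F₂ →L[ℂ] F₃) (g : Phase → F₁ →L[ℂ] F₂) (X : Phase) :
    F₁ →L[ℂ] F₃ := oscScaled (Real.sqrt (lam / 2)) (weylAmplitude f g) (X, X)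

theorem exp_phase_dilate {lam : ℝ} (hlam : 0 < lam) (Z : DPhase) :
    Complex.exp (Complex.I * ((2 / lam * (inner ℝ (Real.sqrt (lam / 2) • Z).1.1
        (Real.sqrt (lam / 2) • Z).2.2 - inner ℝ (Real.sqrt (lam / 2) • Z).2.1
        (Real.sqrt (lam / 2) • Z).1.2) : ℝ) : ℂ)) = osc Z := by
  rw [osc]
  congr 3
  simp only [Prod.smul_fst, Prod.smul_snd, real_inner_smul_left, real_inner_smul_right, phaseQ]
  have h : Real.sqrt (lam / 2) * Real.sqrt (lam / 2) = lam / 2 := Real.mul_self_sqrt (by positivity)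
  have h2 : 2 / lam * (Real.sqrt (lam / 2) * Real.sqrt (lam / 2)) = 1 := by rw [h]; field_simp
  linear_combination (inner ℝ Z.1.1 Z.2.2 - inner ℝ Z.2.1 Z.1.2) * h2

/-- Under the substitution by s = √(λ/2) the phase becomes `phaseQ`, the Jacobian s¹² = (λ/2)⁶ turns
(πλ)⁻⁶ into (2π)⁻⁶, and the cutoff parameter ε becomes εs, which also tends to 0 from the right. -/
theorem isWeylProduct_weyl {lam : ℝ} (hlam : 0 < lam) {f : Phase → F₂ →L[ℂ] F₃}
    {g : Phase → F₁ →L[ℂ] F₂} (h : Tempered (weylAmplitude f g)) :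
    IsWeylProduct lam f g (weyl lam f g) := by
  rename_i i₁ _ i₂ _ _ _ i₃ _
  obtain rfl := normedSpace_real_eq (F := F₃) (i := i₃)
  intro X χ hχ
  set s : ℝ := Real.sqrt (lam / 2) with hs
  have hs0 : 0 < s := Real.sqrt_pos.2 (by positivity)
  have lim := (h.comp_affine s (X, X)).tendsto_oscReg (rapidDecay_schwartz χ)
  rw [hχ, one_smul] at lim
  have hε : Tendsto (fun ε : ℝ => ε * s) (𝓝[>] 0) (𝓝[>] 0) := by
    refine tendsto_nhdsWithin_iff.2 ⟨?_, ?_⟩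
    · have : Tendsto (fun ε : ℝ => ε * s) (𝓝 0) (𝓝 (0 * s)) :=
        (continuous_id.mul continuous_const).tendsto 0
      rw [zero_mul] at this
      exact this.mono_left nhdsWithin_le_nhds
    · filter_upwards [self_mem_nhdsWithin] with ε hε using mul_pos hε hs0
  refine (lim.comp hε).congr fun ε => ?_
  have key := Measure.integral_comp_smul (volume : Measure DPhase)
    (fun Z : DPhase => (Complex.exp (Complex.I *
            ((2 / lam * (inner ℝ Z.1.1 Z.2.2 - inner ℝ Z.2.1 Z.1.2) : ℝ) : ℂ)) * χ (ε • Z)) •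
          (f (X + Z.1)).comp (g (X + Z.2))) s
  have hdim : Module.finrank ℝ DPhase = 12 := by simp
  rw [hdim] at key
  have hs12 : s ^ 12 = (lam / 2) ^ 6 := by
    rw [show 12 = 2 * 6 by norm_num, pow_mul, hs, Real.sq_sqrt (by positivity)]
  rw [Function.comp_apply, oscReg]
  have e1 : ∀ Z : DPhase, (osc Z * χ ((ε * s) • Z)) • weylAmplitude f g ((X, X) + s • Z)
      = (Complex.exp (Complex.I * ((2 / lam * (inner ℝ (s • Z).1.1 (s • Z).2.2
          - inner ℝ (s • Z).2.1 (s • Z).1.2) : ℝ) : ℂ)) * χ (ε • s • Z)) •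
          (f (X + (s • Z).1)).comp (g (X + (s • Z).2)) := fun Z => by
    rw [exp_phase_dilate hlam, mul_smul ε s Z]
    rfl
  simp only [e1]
  rw [key, ← mul_smul, hs12, abs_of_pos (by positivity)]
  congr 1
  have := Real.pi_pos
  field_simp

theorem weylAmplitude_uniformSymbol {w₁ w₂ : ι → Phase → ℝ} {f : ι → Phase → F₂ →L[ℂ] F₃}
    {g : ι → Phase → F₁ →L[ℂ] F₂} (hf : UniformSymbol w₁ f) (hg : UniformSymbol w₂ g) :
    UniformSymbol (fun i Z => w₁ i Z.1 * w₂ i Z.2) (fun i => weylAmplitude (f i) (g i)) := by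
  have h1 := hf.comp_affine (fun _ => ContinuousLinearMap.fst ℝ Phase Phase) (fun _ => 0) (K := 1)
    (fun _ => ContinuousLinearMap.norm_fst_le ℝ Phase Phase)
  have h2 := hg.comp_affine (fun _ => ContinuousLinearMap.snd ℝ Phase Phase) (fun _ => 0) (K := 1)
    (fun _ => ContinuousLinearMap.norm_snd_le ℝ Phase Phase)
  have h3 := h1.bilinear (compR F₁ F₂ F₃) h2
  simp only [zero_add] at h3
  exact h3

/-- The first-order term of the Weyl product, `∑ⱼ (∂_{rⱼ} f ∂_{kⱼ} g - ∂_{kⱼ} f ∂_{rⱼ} g)`. -/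
def weylBracket (f : Phase → F₂ →L[ℂ] F₃) (g : Phase → F₁ →L[ℂ] F₂) (X : Phase) : F₁ →L[ℂ] F₃ :=
  ∑ j : Fin 3, ((fderiv ℝ f X (EuclideanSpace.single j 1, 0)).comp
      (fderiv ℝ g X (0, EuclideanSpace.single j 1))
    - (fderiv ℝ f X (0, EuclideanSpace.single j 1)).comp
      (fderiv ℝ g X (EuclideanSpace.single j 1, 0)))

/-! ### Mixed second derivatives of product amplitudes -/

section MixedDerivatives

variable {f : Phase → F₂ →L[ℂ] F₃} {g : Phase → F₁ →L[ℂ] F₂}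

theorem hasFDerivAt_weylAmplitude (hf : Differentiable ℝ f) (hg : Differentiable ℝ g) (Z : DPhase) :
    HasFDerivAt (weylAmplitude f g)
      ((compR F₁ F₂ F₃).precompR DPhase (f Z.1)
          ((fderiv ℝ g Z.2).comp (ContinuousLinearMap.snd ℝ Phase Phase))
        + (compR F₁ F₂ F₃).precompL DPhase
          ((fderiv ℝ f Z.1).comp (ContinuousLinearMap.fst ℝ Phase Phase)) (g Z.2)) Z :=
  (compR F₁ F₂ F₃).hasFDerivAt_of_bilinear ((hf Z.1).hasFDerivAt.comp Z hasFDerivAt_fst)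
    ((hg Z.2).hasFDerivAt.comp Z hasFDerivAt_snd)

theorem fderiv_weylAmplitude_apply (hf : Differentiable ℝ f) (hg : Differentiable ℝ g)
    (Z H : DPhase) : fderiv ℝ (weylAmplitude f g) Z H
      = (f Z.1).comp (fderiv ℝ g Z.2 H.2) + (fderiv ℝ f Z.1 H.1).comp (g Z.2) := by
  rw [(hasFDerivAt_weylAmplitude hf hg Z).fderiv]
  rfl

theorem fderiv_fderiv_weylAmplitude_left (hf : ContDiff ℝ ∞ f) (hg : ContDiff ℝ ∞ g) (Z : DPhase)
    (u v : Phase) : fderiv ℝ (fun W => fderiv ℝ (weylAmplitude f g) W (0, u)) Z (v, 0)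
      = (fderiv ℝ f Z.1 v).comp (fderiv ℝ g Z.2 u) := by
  have e : (fun W => fderiv ℝ (weylAmplitude f g) W (0, u))
      = weylAmplitude f (fun X => fderiv ℝ g X u) := by
    funext W
    rw [fderiv_weylAmplitude_apply (hf.differentiable (by simp)) (hg.differentiable (by simp))]
    simp [weylAmplitude]
  have hg' : ContDiff ℝ ∞ fun X => fderiv ℝ g X u :=
    (hg.fderiv_right (by simp)).clm_apply contDiff_const
  rw [e, fderiv_weylAmplitude_apply (hf.differentiable (by simp)) (hg'.differentiable (by simp))]
  simp

theorem fderiv_fderiv_weylAmplitude_right (hf : ContDiff ℝ ∞ f) (hg : ContDiff ℝ ∞ g) (Z : DPhase)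
    (u v : Phase) : fderiv ℝ (fun W => fderiv ℝ (weylAmplitude f g) W (u, 0)) Z (0, v)
      = (fderiv ℝ f Z.1 u).comp (fderiv ℝ g Z.2 v) := by
  have e : (fun W => fderiv ℝ (weylAmplitude f g) W (u, 0))
      = weylAmplitude (fun X => fderiv ℝ f X u) g := by
    funext W
    rw [fderiv_weylAmplitude_apply (hf.differentiable (by simp)) (hg.differentiable (by simp))]
    simp [weylAmplitude]
  have hf' : ContDiff ℝ ∞ fun X => fderiv ℝ f X u :=
    (hf.fderiv_right (by simp)).clm_apply contDiff_const
  rw [e, fderiv_weylAmplitude_apply (hf'.differentiable (by simp)) (hg.differentiable (by simp))]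
  simp

/-- The dual pairs of directions always take one derivative in X' and one in X'', so each falls on
its own factor. Every pair occurs twice, once from either side, whence the factor 2. -/
theorem mixedLaplace_weylAmplitude (hf : ContDiff ℝ ∞ f) (hg : ContDiff ℝ ∞ g) (X : Phase) :
    mixedLaplace (weylAmplitude f g) (X, X) = (2 : ℂ) • weylBracket f g X := by
  have hL := fun u v => fderiv_fderiv_weylAmplitude_left hf hg (X, X) u v
  have hR := fun u v => fderiv_fderiv_weylAmplitude_right hf hg (X, X) u v
  have z : ((0 : E3), (0 : E3)) = (0 : Phase) := rfl
  have n1 : ∀ x : Phase, -((0 : Phase), x) = (0, -x) := fun x => by simp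
  have n2 : ∀ x : Phase, -(x, (0 : Phase)) = (-x, 0) := fun x => by simp
  simp only [mixedLaplace, Fintype.sum_sum_type, dir, codir, z, n1, n2]
  simp only [hL, hR]
  simp only [map_neg, ContinuousLinearMap.neg_comp, ContinuousLinearMap.comp_neg,
    Finset.sum_neg_distrib, weylBracket, Finset.sum_sub_distrib, two_smul]
  abel

end MixedDerivatives

/-- The weights `λ^N (1 + |k|)^M`. -/
def ordWeight (lam : ι → ℝ) (N M : ℕ) (i : ι) (X : Phase) : ℝ := lam i ^ N * (1 + ‖X.2‖) ^ M

theorem ordWeight_mul (lam : ι → ℝ) (N M N' M' : ℕ) (i : ι) (X : Phase) :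
    ordWeight lam N M i X * ordWeight lam N' M' i X = ordWeight lam (N + N') (M + M') i X := by
  simp only [ordWeight, pow_add]
  ring

theorem temperateWeight_ordWeight {lam : ι → ℝ} (hlam : ∀ i, 0 ≤ lam i) (N M N' M' : ℕ) :
    TemperateWeight ((M + M' : ℕ) : ℝ)
      (fun i (Z : DPhase) => ordWeight lam N M i Z.1 * ordWeight lam N' M' i Z.2) where
  nonneg_exp := by positivity
  nonneg i Y := by
    have := hlam i
    simp only [ordWeight]
    positivity
  add_le i Y Z := by
    have hl := hlam i
    have hZ1 : ‖Z.1.2‖ ≤ ‖Z‖ := (norm_snd_le Z.1).trans (norm_fst_le Z)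
    have hZ2 : ‖Z.2.2‖ ≤ ‖Z‖ := (norm_snd_le Z.2).trans (norm_snd_le Z)
    have h1 : 1 + ‖(Y + Z).1.2‖ ≤ (1 + ‖Y.1.2‖) * (1 + ‖Z‖) := by
      have := norm_add_le Y.1.2 Z.1.2
      have h0 := mul_nonneg (norm_nonneg Y.1.2) (norm_nonneg Z)
      simp only [Prod.fst_add, Prod.snd_add]
      linarith
    have h2 : 1 + ‖(Y + Z).2.2‖ ≤ (1 + ‖Y.2.2‖) * (1 + ‖Z‖) := by
      have := norm_add_le Y.2.2 Z.2.2
      have h0 := mul_nonneg (norm_nonneg Y.2.2) (norm_nonneg Z)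
      simp only [Prod.snd_add]
      linarith
    have h1' := pow_le_pow_left₀ (by positivity) h1 M
    have h2' := pow_le_pow_left₀ (by positivity) h2 M'
    rw [mul_pow] at h1' h2'
    rw [Real.rpow_natCast]
    simp only [ordWeight]
    calc _ = (lam i ^ N * lam i ^ N') * ((1 + ‖(Y + Z).1.2‖) ^ M * (1 + ‖(Y + Z).2.2‖) ^ M') := by ring
      _ ≤ (lam i ^ N * lam i ^ N') * (((1 + ‖Y.1.2‖) ^ M * (1 + ‖Z‖) ^ M) *
          ((1 + ‖Y.2.2‖) ^ M' * (1 + ‖Z‖) ^ M')) := by gcongr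
      _ = _ := by rw [pow_add]; ring

/-! ### Weighted expansion and covariance of the Weyl product -/

section Expansion

variable {lam : ι → ℝ} {Λ : ℝ} {N M N' M' : ℕ}
  {f : ι → Phase → F₂ →L[ℂ] F₃} {g : ι → Phase → F₁ →L[ℂ] F₂}

/-- The diagonal embedding. -/
def diag : Phase →L[ℝ] DPhase :=
  (ContinuousLinearMap.id ℝ Phase).prod (ContinuousLinearMap.id ℝ Phase)

theorem UniformSymbol.comp_diag {V : Type*} [NormedAddCommGroup V] [NormedSpace ℝ V]
    {w : ι → DPhase → ℝ} {a : ι → DPhase → V} (h : UniformSymbol w a) :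
    UniformSymbol (fun i X => w i (X, X)) (fun i X => a i (X, X)) := by
  have := h.comp_affine (fun _ => diag) (fun _ => 0) (K := ‖diag‖) (fun _ => le_rfl)
  simpa [diag] using this

theorem sqrt_half_mem {lam Λ : ℝ} (h : lam ∈ Set.Icc 0 Λ) :
    Real.sqrt (lam / 2) ∈ Set.Icc 0 (Real.sqrt (Λ / 2)) :=
  ⟨Real.sqrt_nonneg _, Real.sqrt_le_sqrt (by linarith [h.2])⟩

variable [CompleteSpace F₃]

theorem tempered_weylAmplitude (hlam : ∀ i, lam i ∈ Set.Icc 0 Λ)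
    (hf : UniformSymbol (ordWeight lam N M) f) (hg : UniformSymbol (ordWeight lam N' M') g) (i : ι) :
    Tempered (weylAmplitude (f i) (g i)) :=
  (weylAmplitude_uniformSymbol hf hg).tempered_of_temperateWeight
    (temperateWeight_ordWeight (fun i => (hlam i).1) N M N' M') i

theorem UniformSymbol.weyl (hlam : ∀ i, lam i ∈ Set.Icc 0 Λ)
    (hf : UniformSymbol (ordWeight lam N M) f) (hg : UniformSymbol (ordWeight lam N' M') g) :
    UniformSymbol (ordWeight lam (N + N') (M + M')) (fun i => weyl (lam i) (f i) (g i)) := by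
  have h := ((weylAmplitude_uniformSymbol hf hg).oscScaled
    (temperateWeight_ordWeight (fun i => (hlam i).1) N M N' M') (fun i => Real.sqrt (lam i / 2))
    (fun i => sqrt_half_mem (hlam i))).comp_diag
  exact h.mono 1 zero_le_one fun i X => by rw [ordWeight_mul, one_mul]

theorem UniformSymbol.weyl_sub (hlam : ∀ i, lam i ∈ Set.Icc 0 Λ)
    (hf : UniformSymbol (ordWeight lam N M) f) (hg : UniformSymbol (ordWeight lam N' M') g) :
    UniformSymbol (ordWeight lam (N + N' + 1) (M + M'))
      (fun i X => RayOptics.weyl (lam i) (f i) (g i) X - (f i X).comp (g i X)) := by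
  have h := ((weylAmplitude_uniformSymbol hf hg).oscScaled_sub
    (temperateWeight_ordWeight (fun i => (hlam i).1) N M N' M') (fun i => Real.sqrt (lam i / 2))
    (fun i => sqrt_half_mem (hlam i))).comp_diag
  refine h.mono (1 / 2) (by norm_num) fun i X => le_of_eq ?_
  have := (hlam i).1
  rw [ordWeight_mul, Real.sq_sqrt (by positivity)]
  simp only [ordWeight, pow_succ]
  ring

/-- With s² = λ/2 the coefficient i s²/2 is iλ/4; the 2 from `mixedLaplace_weylAmplitude` makes it
iλ/2. The remainder s⁴ is λ²/4. -/
theorem UniformSymbol.weyl_sub_sub (hlam : ∀ i, lam i ∈ Set.Icc 0 Λ)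
    (hf : UniformSymbol (ordWeight lam N M) f) (hg : UniformSymbol (ordWeight lam N' M') g) :
    UniformSymbol (ordWeight lam (N + N' + 2) (M + M'))
      (fun i X => RayOptics.weyl (lam i) (f i) (g i) X - (f i X).comp (g i X)
        - (Complex.I / 2 * lam i) • weylBracket (f i) (g i) X) := by
  have h := ((weylAmplitude_uniformSymbol hf hg).oscScaled_sub_sub
    (temperateWeight_ordWeight (fun i => (hlam i).1) N M N' M') (fun i => Real.sqrt (lam i / 2))
    (fun i => sqrt_half_mem (hlam i))).comp_diag
  refine (h.mono (1 / 4) (by norm_num) fun i X => le_of_eq ?_).congr fun i X => ?_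
  · have := (hlam i).1
    rw [ordWeight_mul, show 4 = 2 * 2 by norm_num, pow_mul, Real.sq_sqrt (by positivity)]
    simp only [ordWeight, pow_succ]
    ring
  · have := (hlam i).1
    rw [Real.sq_sqrt (by positivity), mixedLaplace_weylAmplitude (hf.1 i) (hg.1 i), ← mul_smul]
    simp only [RayOptics.weyl, weylAmplitude]
    congr 2
    push_cast
    ring

/-- Covariance of the Weyl product under simultaneous translation of both factors. -/
theorem weyl_translate {lam : ℝ} {f : Phase → F₂ →L[ℂ] F₃} {g : Phase → F₁ →L[ℂ] F₂}
    (h : Tempered (weylAmplitude f g)) (Y : Phase) (T : (F₁ →L[ℂ] F₃) →L[ℝ] (F₁ →L[ℂ] F₃))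
    (hT : ∀ (c : ℂ) v, T (c • v) = c • T v)
    (hfg : ∀ X X', (f (X + Y)).comp (g (X' + Y)) = T ((f X).comp (g X'))) (X : Phase) :
    RayOptics.weyl lam f g (X + Y) = T (RayOptics.weyl lam f g X) := by
  simp only [RayOptics.weyl, oscScaled]
  rw [← oscInt_clm_comp (h.comp_affine _ _) T hT]
  congr 1
  funext Z
  simp only [weylAmplitude, Prod.fst_add, Prod.snd_add]
  rw [← hfg, add_right_comm X Y, add_right_comm X Y]

end Expansion

end Weyl

/-! ### Periodic functions and the unit cell -/

section Cell

variable (b : Module.Basis (Fin 3) ℝ E3)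

/-- Invariance under lattice translations. -/
def LatticePeriodic {W : Type*} (F : E3 → W) : Prop := ∀ γ ∈ lattice b, ∀ y, F (y + γ) = F y

instance : IsFiniteMeasure (cellMeasure b) :=
  ⟨by rw [Measure.restrict_apply_univ]; exact (ZSpan.fundamentalDomain_isBounded b).measure_lt_top⟩

theorem LatticePeriodic.exists_bound {W : Type*} [NormedAddCommGroup W] {F : E3 → W}
    (hF : LatticePeriodic b F) (hc : Continuous F) : ∃ C : ℝ, ∀ y, ‖F y‖ ≤ C := by
  have hcomp : IsCompact (closure (ZSpan.fundamentalDomain b)) :=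
    (ZSpan.fundamentalDomain_isBounded b).isCompact_closure
  obtain ⟨C, hC⟩ := hcomp.exists_bound_of_continuousOn hc.continuousOn
  refine ⟨C, fun y => ?_⟩
  have h1 : F (ZSpan.fract b y) = F y := by
    have h2 : ZSpan.fract b y + (ZSpan.floor b y : E3) = y := by simp [ZSpan.fract_apply]
    rw [← hF (ZSpan.floor b y) (ZSpan.floor b y).2, h2]
  rw [← h1]
  exact hC _ (subset_closure (ZSpan.fract_mem_fundamentalDomain b y))

theorem LatticePeriodic.fderiv {W : Type*} [NormedAddCommGroup W] [NormedSpace ℝ W] {F : E3 → W}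
    (hF : LatticePeriodic b F) : LatticePeriodic b (_root_.fderiv ℝ F) := fun γ hγ y => by
  rw [← fderiv_comp_add_right]
  congr 1
  funext z
  exact hF γ hγ z

instance : VAddInvariantMeasure (Submodule.span ℤ (Set.range b)) E3 volume :=
  ⟨fun γ _ _ => measure_preimage_add volume (γ : E3) _⟩

-- A translate of the unit cell is again a fundamental domain, and a periodic function has the same
-- integral over both.
open scoped Pointwise in
theorem LatticePeriodic.integral_comp_add {F : E3 → ℂ} (hF : LatticePeriodic b F) (v : E3) :
    ∫ y, F (y + v) ∂(cellMeasure b) = ∫ y, F y ∂(cellMeasure b) := by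
  have h1 := ZSpan.isAddFundamentalDomain b (volume : Measure E3)
  have h2 := h1.vadd_of_comm v
  have e1 : ∫ y, F (y + v) ∂(cellMeasure b) = ∫ y in v +ᵥ ZSpan.fundamentalDomain b, F y := by
    have := (measurePreserving_vadd v (volume : Measure E3)).setIntegral_image_emb
      (MeasurableEquiv.vadd v).measurableEmbedding F (ZSpan.fundamentalDomain b)
    rw [Set.image_vadd] at this
    rw [this]
    simp only [vadd_eq_add, add_comm v]
  rw [e1]
  refine h2.setIntegral_eq h1 fun γ y => ?_
  have := hF γ γ.2 y
  rw [add_comm] at this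
  exact this

/-- The cell integral of F(· + tv) does not depend on t; it is differentiated at t = 0 under the
integral. -/
theorem LatticePeriodic.integral_fderiv {F : E3 → ℂ} (hF : LatticePeriodic b F)
    (hs : ContDiff ℝ ∞ F) (v : E3) : ∫ y, _root_.fderiv ℝ F y v ∂(cellMeasure b) = 0 := by
  have hs' : Continuous (_root_.fderiv ℝ F) := hs.continuous_fderiv (by simp)
  obtain ⟨C, hC⟩ := hF.fderiv.exists_bound b hs'
  obtain ⟨C', hC'⟩ := hF.exists_bound b hs.continuous
  have hline : ∀ y t, HasDerivAt (fun t : ℝ => F (y + t • v)) (_root_.fderiv ℝ F (y + t • v) v) t :=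
    fun y t => by
      have h1 : HasDerivAt (fun t : ℝ => y + t • v) v t := by
        simpa using ((hasDerivAt_id t).smul_const v).const_add y
      exact ((hs.differentiable (by simp) _).hasFDerivAt).comp_hasDerivAt t h1
  have hF0 : ∀ t : ℝ, Continuous fun y => F (y + t • v) := fun t =>
    hs.continuous.comp (by fun_prop)
  have key := hasDerivAt_integral_of_dominated_loc_of_deriv_le (μ := cellMeasure b)
    (F := fun t y => F (y + t • v)) (F' := fun t y => _root_.fderiv ℝ F (y + t • v) v)
    (x₀ := (0 : ℝ)) (s := Set.univ) (bound := fun _ => C * ‖v‖) Filter.univ_mem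
    (Eventually.of_forall fun t => (hF0 t).aestronglyMeasurable)
    (Integrable.of_bound (hF0 0).aestronglyMeasurable C' (ae_of_all _ fun y => hC' _))
    ((by fun_prop : Continuous fun y => _root_.fderiv ℝ F (y + (0 : ℝ) • v) v).aestronglyMeasurable)
    (ae_of_all _ fun y t _ => (ContinuousLinearMap.le_opNorm _ _).trans
      (mul_le_mul_of_nonneg_right (hC _) (norm_nonneg _)))
    (integrable_const _)
    (ae_of_all _ fun y t _ => hline y t)
  have h2 := key.2
  simp only [hF.integral_comp_add b] at h2
  have h3 := h2.unique (hasDerivAt_const (0 : ℝ) _)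
  simpa using h3

theorem memLp_of_latticePeriodic {θ : E3 → C6} (hθ : LatticePeriodic b θ) (hc : Continuous θ)
    (p : ℝ≥0∞) : MemLp θ p (cellMeasure b) := by
  obtain ⟨C, hC⟩ := hθ.exists_bound b hc
  exact MemLp.of_bound hc.aestronglyMeasurable C (ae_of_all _ hC)

/-! ### Multiplication operators -/

theorem mulOp_coeFn {A : E3 → Mat6} (h : MemLp (fun y => matCLM (A y)) ∞ (cellMeasure b))
    (u : Hcell b) : mulOp b A u =ᵐ[cellMeasure b] fun y => matCLM (A y) (u y) := by
  rw [mulOp, dif_pos h]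
  have h1 := (ContinuousLinearMap.id ℂ (C6 →L[ℂ] C6)).coeFn_holder (r := 2) h.toLp u
  filter_upwards [h1, h.coeFn_toLp] with y hy hy'
  rw [← hy']
  exact hy

theorem constOp_coeFn (A : Mat6) (u : Hcell b) :
    constOp b A u =ᵐ[cellMeasure b] fun y => matCLM A (u y) :=
  ContinuousLinearMap.coeFn_compLpL _ _

theorem matCLM_mul (A B : Mat6) (v : C6) : matCLM (A * B) v = matCLM A (matCLM B v) := by
  simp [matCLM]

theorem matCLM_one (v : C6) : matCLM 1 v = v := by simp [matCLM]

theorem matCLM_smul (c : ℂ) (A : Mat6) (v : C6) : matCLM (c • A) v = c • matCLM A v := by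
  simp [matCLM]

theorem matCLM_add (A B : Mat6) (v : C6) : matCLM (A + B) v = matCLM A v + matCLM B v := by
  simp [matCLM]

theorem inner_matCLM (A : Mat6) (u v : C6) :
    inner ℂ (matCLM A u) v = inner ℂ u (matCLM A.conjTranspose v) := by
  have h : matCLM A.conjTranspose = ContinuousLinearMap.adjoint (matCLM A) := by
    rw [← ContinuousLinearMap.star_eq_adjoint, matCLM, matCLM, ← map_star]
    rfl
  rw [h, ContinuousLinearMap.adjoint_inner_right]

theorem inner_mulOp {A : E3 → Mat6} (h : MemLp (fun y => matCLM (A y)) ∞ (cellMeasure b))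
    (hA : ∀ᵐ y ∂(cellMeasure b), (A y).conjTranspose = A y) (u v : Hcell b) :
    inner ℂ (mulOp b A u) v = inner ℂ u (mulOp b A v) := by
  rw [L2.inner_def, L2.inner_def]
  refine integral_congr_ae ?_
  filter_upwards [mulOp_coeFn b h u, mulOp_coeFn b h v, hA] with y h1 h2 h3
  rw [h1, h2, inner_matCLM, h3]

theorem inner_constOp {A : Mat6} (hA : A.conjTranspose = A) (u v : Hcell b) :
    inner ℂ (constOp b A u) v = inner ℂ u (constOp b A v) := by
  rw [L2.inner_def, L2.inner_def]
  refine integral_congr_ae ?_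
  filter_upwards [constOp_coeFn b A u, constOp_coeFn b A v] with y h1 h2
  rw [h1, h2, inner_matCLM, hA]

/-- The phase factor `e^{i g · y}`. -/
def phaseFun (g y : E3) : ℂ := Complex.exp (Complex.I * (inner ℝ g y : ℝ))

theorem norm_phaseFun (g y : E3) : ‖phaseFun g y‖ = 1 := by
  rw [phaseFun, mul_comm, Complex.norm_exp_ofReal_mul_I]

theorem phaseFun_mul_neg (g y : E3) : phaseFun g y * phaseFun (-g) y = 1 := by
  rw [phaseFun, phaseFun, ← Complex.exp_add]
  simp

theorem conj_phaseFun (g y : E3) : (starRingEnd ℂ) (phaseFun g y) = phaseFun (-g) y := by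
  rw [phaseFun, phaseFun, ← Complex.exp_conj]
  simp

theorem contDiff_phaseFun (g : E3) : ContDiff ℝ ∞ (phaseFun g) :=
  (contDiff_const.mul (Complex.ofRealCLM.contDiff.comp (contDiff_const.inner ℝ contDiff_id))).cexp

theorem phaseFun_periodic {g : E3} (hg : g ∈ dualLattice b) : LatticePeriodic b (phaseFun g) := by
  intro γ hγ y
  obtain ⟨n, hn⟩ := hg γ hγ
  rw [phaseFun, inner_add_right, hn]
  push_cast
  rw [mul_add, Complex.exp_add]
  have : Complex.exp (Complex.I * (2 * Real.pi * n)) = 1 := by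
    rw [Complex.exp_eq_one_iff]
    exact ⟨n, by ring⟩
  rw [this, mul_one]
  rfl

theorem memLp_phase (g : E3) :
    MemLp (fun y => matCLM (Complex.exp (Complex.I * (inner ℝ g y : ℝ)) • (1 : Mat6))) ∞
      (cellMeasure b) := by
  have e : (fun y => matCLM (Complex.exp (Complex.I * (inner ℝ g y : ℝ)) • (1 : Mat6)))
      = fun y => phaseFun g y • ContinuousLinearMap.id ℂ C6 := by
    funext y
    ext1 v
    rw [matCLM_smul, matCLM_one]
    rfl
  rw [e]
  refine MemLp.of_bound ((contDiff_phaseFun g).continuous.smul continuous_const).aestronglyMeasurable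
    1 (ae_of_all _ fun y => ?_)
  rw [norm_smul, norm_phaseFun, one_mul]
  exact ContinuousLinearMap.norm_id_le

theorem phaseOp_coeFn (g : E3) (u : Hcell b) :
    phaseOp b g u =ᵐ[cellMeasure b] fun y => phaseFun g y • u y := by
  filter_upwards [mulOp_coeFn b (memLp_phase b g) u] with y hy
  rw [phaseOp, hy, matCLM_smul, matCLM_one]
  rfl

theorem phaseOp_phaseOp_neg (g : E3) (u : Hcell b) : phaseOp b g (phaseOp b (-g) u) = u := by
  refine Lp.ext ?_
  filter_upwards [phaseOp_coeFn b g (phaseOp b (-g) u), phaseOp_coeFn b (-g) u] with y h1 h2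
  rw [h1, h2, smul_smul, phaseFun_mul_neg, one_smul]

theorem phaseOp_neg_phaseOp (g : E3) (u : Hcell b) : phaseOp b (-g) (phaseOp b g u) = u := by
  simpa using phaseOp_phaseOp_neg b (-g) u

theorem inner_phaseOp (g : E3) (u v : Hcell b) :
    inner ℂ u (phaseOp b g v) = inner ℂ (phaseOp b (-g) u) v := by
  rw [L2.inner_def, L2.inner_def]
  refine integral_congr_ae ?_
  filter_upwards [phaseOp_coeFn b g v, phaseOp_coeFn b (-g) u] with y h1 h2
  rw [h1, h2, inner_smul_left, inner_smul_right, conj_phaseFun, neg_neg]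

theorem norm_phaseOp_apply (g : E3) (u : Hcell b) : ‖phaseOp b g u‖ = ‖u‖ := by
  have h : inner ℂ (phaseOp b g u) (phaseOp b g u) = inner ℂ u u := by
    rw [inner_phaseOp, phaseOp_neg_phaseOp]
  rw [inner_self_eq_norm_sq_to_K, inner_self_eq_norm_sq_to_K] at h
  have h2 : ‖phaseOp b g u‖ ^ 2 = ‖u‖ ^ 2 := by exact_mod_cast h
  exact (sq_eq_sq₀ (norm_nonneg _) (norm_nonneg _)).1 h2

theorem norm_phaseOp_le (g : E3) : ‖phaseOp b g‖ ≤ 1 :=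
  ContinuousLinearMap.opNorm_le_bound _ zero_le_one fun u => by
    rw [norm_phaseOp_apply, one_mul]

theorem mulOp_phaseOp {A : E3 → Mat6} (h : MemLp (fun y => matCLM (A y)) ∞ (cellMeasure b))
    (g : E3) (u : Hcell b) : mulOp b A (phaseOp b g u) = phaseOp b g (mulOp b A u) := by
  refine Lp.ext ?_
  filter_upwards [mulOp_coeFn b h (phaseOp b g u), mulOp_coeFn b h u, phaseOp_coeFn b g u,
    phaseOp_coeFn b g (mulOp b A u)] with y h1 h2 h3 h4
  rw [h1, h3, h4, h2, map_smul]

theorem constOp_phaseOp (A : Mat6) (g : E3) (u : Hcell b) :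
    constOp b A (phaseOp b g u) = phaseOp b g (constOp b A u) := by
  refine Lp.ext ?_
  filter_upwards [constOp_coeFn b A (phaseOp b g u), constOp_coeFn b A u, phaseOp_coeFn b g u,
    phaseOp_coeFn b g (constOp b A u)] with y h1 h2 h3 h4
  rw [h1, h3, h4, h2, map_smul]

theorem constOp_add (A B : Mat6) : constOp b (A + B) = constOp b A + constOp b B := by
  ext1 u
  refine Lp.ext ?_
  filter_upwards [constOp_coeFn b (A + B) u, constOp_coeFn b A u, constOp_coeFn b B u,
    Lp.coeFn_add (constOp b A u) (constOp b B u)] with y h1 h2 h3 h4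
  rw [add_apply, h1, h4, Pi.add_apply, h2, h3, matCLM_add]

theorem constOp_smul (c : ℂ) (A : Mat6) : constOp b (c • A) = c • constOp b A := by
  ext1 u
  refine Lp.ext ?_
  filter_upwards [constOp_coeFn b (c • A) u, constOp_coeFn b A u,
    Lp.coeFn_smul c (constOp b A u)] with y h1 h2 h4
  rw [smul_apply, h1, h4, Pi.smul_apply, h2, matCLM_smul]

/-! ### The matrices entering Rot: hermiticity and linearity -/

theorem rotMat_conjTranspose (k : E3) :
    (rotMat fun j => (k j : ℂ)).conjTranspose = rotMat fun j => (k j : ℂ) := by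
  have h : (crossMat fun j => (k j : ℂ)).conjTranspose = -crossMat fun j => (k j : ℂ) := by
    ext i j
    fin_cases i <;> fin_cases j <;> simp [crossMat]
  rw [rotMat, Matrix.fromBlocks_conjTranspose, Matrix.conjTranspose_neg, h]
  simp

theorem rotMat_add (v w : Fin 3 → ℂ) : rotMat (v + w) = rotMat v + rotMat w := by
  have h : crossMat (v + w) = crossMat v + crossMat w := by
    ext i j
    fin_cases i <;> fin_cases j <;> simp [crossMat] <;> ring
  rw [rotMat, rotMat, rotMat, h, Matrix.fromBlocks_add]
  simp [add_comm]

theorem rotMat_smul (c : ℂ) (v : Fin 3 → ℂ) : rotMat (c • v) = c • rotMat v := by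
  have h : crossMat (c • v) = c • crossMat v := by
    ext i j
    fin_cases i <;> fin_cases j <;> simp [crossMat]
  rw [rotMat, rotMat, h, Matrix.fromBlocks_smul]
  simp

/-- `rotMat` as a linear map. -/
def rotLin : (Fin 3 → ℂ) →ₗ[ℂ] Mat6 where
  toFun := rotMat
  map_add' := rotMat_add
  map_smul' := rotMat_smul

theorem rotMat_eq_sum (v : Fin 3 → ℂ) : rotMat v = ∑ j, v j • rotMat (Pi.single j 1) := by
  have h : v = ∑ j, v j • (Pi.single j (1 : ℂ) : Fin 3 → ℂ) := by
    ext i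
    simp [Finset.sum_apply, Pi.single_apply]
  have h2 : rotLin v = ∑ j, v j • rotLin (Pi.single j 1) := by
    conv_lhs => rw [h]
    simp only [map_sum, map_smul]
  exact h2

theorem rotMat_single_conjTranspose (j : Fin 3) :
    (rotMat (Pi.single j 1)).conjTranspose = rotMat (Pi.single j 1) := by
  have h := rotMat_conjTranspose (EuclideanSpace.single j 1)
  have e : (fun i => ((EuclideanSpace.single j (1 : ℝ) : E3) i : ℂ)) = Pi.single j 1 := by
    ext i
    by_cases hij : i = j <;> simp [hij]
  rwa [e] at h

end Cell

/-! ### Test fields and the Maxwell domain -/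

section TestFields

variable (b : Module.Basis (Fin 3) ℝ E3)

theorem convex_fundamentalDomain : Convex ℝ (ZSpan.fundamentalDomain b) := by
  intro x hx y hy s t hs ht hst
  rw [ZSpan.mem_fundamentalDomain] at *
  intro i
  rw [map_add, map_smul, map_smul]
  exact (convex_Ico (𝕜 := ℝ) (0 : ℝ) 1) (hx i) (hy i) hs ht hst

/-- The cell is convex, so its boundary is a null set. Bump functions supported in the interior
therefore suffice as tests. -/
theorem ae_mem_interior_cell :
    ∀ᵐ y ∂(cellMeasure b), y ∈ interior (ZSpan.fundamentalDomain b) := by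
  have h : volume (frontier (ZSpan.fundamentalDomain b)) = 0 :=
    (convex_fundamentalDomain b).addHaar_frontier _
  have h2 : ∀ᵐ y ∂(cellMeasure b), y ∉ frontier (ZSpan.fundamentalDomain b) :=
    ae_restrict_of_ae (measure_eq_zero_iff_ae_notMem.1 h)
  filter_upwards [h2, ae_restrict_mem (ZSpan.fundamentalDomain_measurableSet b)] with y h3 h4
  by_contra h5
  exact h3 ⟨subset_closure h4, h5⟩

theorem IsTestField.latticePeriodic {b : Module.Basis (Fin 3) ℝ E3} {θ : E3 → C6}
    (hθ : IsTestField b θ) : LatticePeriodic b θ := hθ.2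

theorem IsTestField.continuous_rotFun {b : Module.Basis (Fin 3) ℝ E3} {θ : E3 → C6}
    (hθ : IsTestField b θ) : Continuous (rotFun θ) := by
  have h : Continuous (fderiv ℝ θ) := hθ.1.continuous_fderiv (by simp)
  unfold rotFun
  fun_prop

theorem IsTestField.memLp {b : Module.Basis (Fin 3) ℝ E3} {θ : E3 → C6} (hθ : IsTestField b θ) :
    MemLp θ 2 (cellMeasure b) :=
  memLp_of_latticePeriodic b hθ.latticePeriodic hθ.1.continuous 2

theorem IsTestField.memLp_rotFun {b : Module.Basis (Fin 3) ℝ E3} {θ : E3 → C6}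
    (hθ : IsTestField b θ) : MemLp (rotFun θ) 2 (cellMeasure b) := by
  refine memLp_of_latticePeriodic b (fun γ hγ y => ?_) hθ.continuous_rotFun 2
  simp only [rotFun]
  rw [hθ.latticePeriodic.fderiv b γ hγ y]

open scoped Pointwise in
/-- The periodic extension of a function supported inside the unit cell is smooth. -/
theorem contDiff_comp_fract {g : E3 → ℝ} (hg : ContDiff ℝ ∞ g) (hc : HasCompactSupport g)
    (hs : tsupport g ⊆ interior (ZSpan.fundamentalDomain b)) :
    ContDiff ℝ ∞ fun y => g (ZSpan.fract b y) := by
  rw [contDiff_iff_contDiffAt]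
  intro y
  have hfloor : ∀ y, y - (ZSpan.floor b y : E3) = ZSpan.fract b y := fun y => by
    rw [ZSpan.fract_apply]
  -- Either the point lies in a lattice translate of the open cell, where the extension is locally a
  -- translate of g, or it avoids the closed set Γ + supp g, off which the extension vanishes.
  by_cases h : ∃ γ ∈ lattice b, y - γ ∈ interior (ZSpan.fundamentalDomain b)
  · obtain ⟨γ, hγ, hy⟩ := h
    have hnhds : ∀ᶠ z in 𝓝 y, z - γ ∈ interior (ZSpan.fundamentalDomain b) :=
      (continuous_id.sub continuous_const).continuousAt.preimage_mem_nhds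
        (isOpen_interior.mem_nhds hy)
    have h2 : ContDiffAt ℝ ∞ (fun z => g (z - γ)) y :=
      (hg.comp (contDiff_id.sub contDiff_const)).contDiffAt
    refine h2.congr_of_eventuallyEq ?_
    filter_upwards [hnhds] with z hz
    congr 1
    have h3 : ZSpan.fract b z = ZSpan.fract b (z - γ) := by
      rw [sub_eq_add_neg, ZSpan.fract_add_ZSpan b z (neg_mem hγ)]
    rw [h3]
    exact ZSpan.fract_eq_self.2 (interior_subset hz)
  · have hcl : IsClosed ((lattice b : Set E3) + tsupport g) := by
      have h1 : IsClosed (lattice b : Set E3) :=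
        haveI : DiscreteTopology (lattice b).toAddSubgroup :=
          inferInstanceAs (DiscreteTopology (Submodule.span ℤ (Set.range b)))
        AddSubgroup.isClosed_of_discrete (H := (lattice b).toAddSubgroup)
      exact h1.add_right_of_isCompact hc
    have hy : y ∉ ((lattice b : Set E3) + tsupport g) := by
      rintro ⟨γ, hγ, s, hs', rfl⟩
      exact h ⟨γ, hγ, by simpa using hs hs'⟩
    have h2 : ContDiffAt ℝ ∞ (fun _ : E3 => (0 : ℝ)) y := contDiffAt_const
    refine h2.congr_of_eventuallyEq ?_
    filter_upwards [hcl.isOpen_compl.mem_nhds hy] with z hz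
    by_contra h3
    refine hz ⟨ZSpan.floor b z, (ZSpan.floor b z).2, ZSpan.fract b z,
      subset_tsupport _ h3, ?_⟩
    rw [← hfloor]
    exact add_sub_cancel _ _

theorem isTestField_comp_fract {g : E3 → ℝ} (hg : ContDiff ℝ ∞ g) (hc : HasCompactSupport g)
    (hs : tsupport g ⊆ interior (ZSpan.fundamentalDomain b)) (v : C6) :
    IsTestField b fun y => g (ZSpan.fract b y) • v :=
  ⟨(contDiff_comp_fract b hg hc hs).smul contDiff_const, fun γ hγ y => by
    dsimp only
    rw [ZSpan.fract_add_ZSpan b y hγ]⟩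

/-- Periodic extensions of bump functions on the open cell, times constant vectors, are test fields;
this reduces the claim to the fundamental lemma of the calculus of variations. -/
theorem eq_zero_of_inner_testField {w : Hcell b}
    (h : ∀ θ, IsTestField b θ → ∀ u : Hcell b, u =ᵐ[cellMeasure b] θ → inner ℂ u w = 0) :
    w = 0 := by
  have hInt : Integrable w (cellMeasure b) := (Lp.memLp w).integrable one_le_two
  have key : ∀ᵐ y ∂(cellMeasure b), y ∈ interior (ZSpan.fundamentalDomain b) → w y = 0 := by
    refine isOpen_interior.ae_eq_zero_of_integral_contDiff_smul_eq_zero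
      (hInt.locallyIntegrable.locallyIntegrableOn _) fun g hg hc hs => ?_
    refine ext_inner_left ℂ fun v => ?_
    have hθ := isTestField_comp_fract b hg hc hs v
    have hL := hθ.memLp
    have h0 := h _ hθ hL.toLp hL.coeFn_toLp
    obtain ⟨C, hC⟩ := hc.exists_bound_of_continuous hg.continuous
    have hint2 : Integrable (fun y => g y • w y) (cellMeasure b) :=
      hInt.bdd_smul C hg.continuous.aestronglyMeasurable (ae_of_all _ hC)
    rw [inner_zero_right, ← h0, L2.inner_def, ← integral_inner hint2]
    refine integral_congr_ae ?_
    filter_upwards [hL.coeFn_toLp, ae_restrict_mem (ZSpan.fundamentalDomain_measurableSet b)]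
      with y h1 h2
    rw [h1, ZSpan.fract_eq_self.2 h2, real_smul_eq_coe_smul, real_smul_eq_coe_smul,
      inner_smul_left, inner_smul_right]
    simp
  refine Lp.ext ?_
  filter_upwards [key, ae_mem_interior_cell b, Lp.coeFn_zero C6 2 (cellMeasure b)] with y h1 h2 h3
  rw [h1 h2, h3]
  rfl

/-- The weak Rot is single valued: for ψ = 0 its value η is orthogonal to all test fields. -/
theorem incl_injective : Function.Injective (incl b) := by
  rw [injective_iff_map_eq_zero]
  rintro ⟨⟨p, q⟩, hp⟩ h
  have hp0 : p = 0 := h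
  subst hp0
  have hq : q = 0 := eq_zero_of_inner_testField b fun θ hθ u hu => by
    have hr := hθ.memLp_rotFun
    have := hp θ hθ u hr.toLp hu hr.coeFn_toLp
    simpa using this.symm
  subst hq
  rfl

/-- The matrices `rotMat` of the unit vectors are hermitian, so the integrands differ by i times the
divergence of a periodic field, whose cell integral is zero. -/
theorem integral_inner_rotFun {η θ : E3 → C6} (hη : IsTestField b η) (hθ : IsTestField b θ) :
    ∫ y, inner ℂ (rotFun η y) (θ y) ∂(cellMeasure b)
      = ∫ y, inner ℂ (η y) (rotFun θ y) ∂(cellMeasure b) := by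
  have hη' : Continuous (fderiv ℝ η) := hη.1.continuous_fderiv (by simp)
  have hθ' : Continuous (fderiv ℝ θ) := hθ.1.continuous_fderiv (by simp)
  have hηc := hη.1.continuous
  have hθc := hθ.1.continuous
  set F : Fin 3 → E3 → ℂ := fun j y => inner ℂ (η y) (matCLM (rotMat (Pi.single j 1)) (θ y)) with hF
  have hFs : ∀ j, ContDiff ℝ ∞ (F j) := fun j =>
    hη.1.inner ℂ (((matCLM (rotMat (Pi.single j 1))).restrictScalars ℝ).contDiff.comp hθ.1)
  have hFp : ∀ j, LatticePeriodic b (F j) := fun j γ hγ y => by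
    simp only [hF]
    rw [hη.2 γ hγ, hθ.2 γ hγ]
  have hFd : ∀ j y v, fderiv ℝ (F j) y v
      = inner ℂ (η y) (matCLM (rotMat (Pi.single j 1)) (fderiv ℝ θ y v))
        + inner ℂ (fderiv ℝ η y v) (matCLM (rotMat (Pi.single j 1)) (θ y)) := fun j y v => by
    have h1 : HasFDerivAt (fun y => matCLM (rotMat (Pi.single j 1)) (θ y))
        (((matCLM (rotMat (Pi.single j 1))).restrictScalars ℝ).comp (fderiv ℝ θ y)) y :=
      ((matCLM (rotMat (Pi.single j 1))).restrictScalars ℝ).hasFDerivAt.comp y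
        (hθ.1.differentiable (by simp) y).hasFDerivAt
    have h2 := ((hη.1.differentiable (by simp) y).hasFDerivAt.inner ℂ h1).fderiv
    simp only [hF]
    rw [h2]
    rfl
  have key : ∀ y, inner ℂ (rotFun η y) (θ y) - inner ℂ (η y) (rotFun θ y)
      = Complex.I * ∑ j, fderiv ℝ (F j) y (EuclideanSpace.single j 1) := fun y => by
    simp only [rotFun, sum_inner, inner_sum, inner_smul_left, inner_smul_right, inner_matCLM,
      rotMat_single_conjTranspose, hFd, Finset.mul_sum, ← Finset.sum_sub_distrib]
    refine Finset.sum_congr rfl fun j _ => ?_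
    simp only [map_neg, Complex.conj_I]
    ring
  have hbd : ∀ {G : E3 → ℂ}, LatticePeriodic b G → Continuous G → Integrable G (cellMeasure b) :=
    fun hG hc => by
      obtain ⟨C, hC⟩ := hG.exists_bound b hc
      exact Integrable.of_bound hc.aestronglyMeasurable C (ae_of_all _ hC)
  have hrot : ∀ {θ : E3 → C6}, IsTestField b θ → LatticePeriodic b (rotFun θ) :=
    fun hθ γ hγ y => by
      simp only [rotFun]
      rw [hθ.latticePeriodic.fderiv b γ hγ y]
  have i1 : Integrable (fun y => inner ℂ (rotFun η y) (θ y)) (cellMeasure b) :=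
    hbd (fun γ hγ y => by rw [hrot hη γ hγ, hθ.2 γ hγ])
      (hη.continuous_rotFun.inner hθc)
  have i2 : Integrable (fun y => inner ℂ (η y) (rotFun θ y)) (cellMeasure b) :=
    hbd (fun γ hγ y => by rw [hrot hθ γ hγ, hη.2 γ hγ])
      (hηc.inner hθ.continuous_rotFun)
  rw [← sub_eq_zero, ← integral_sub i1 i2]
  simp only [key]
  rw [integral_const_mul, integral_finsetSum]
  · simp only [(hFp _).integral_fderiv b (hFs _), Finset.sum_const_zero, mul_zero]
  · intro j _
    exact hbd (fun γ hγ y => by rw [(hFp j).fderiv b γ hγ y])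
      (((hFs j).continuous_fderiv (by simp)).clm_apply continuous_const)

/-- A test field as an element of the domain. -/
def testVec {b : Module.Basis (Fin 3) ℝ E3} {θ : E3 → C6} (hθ : IsTestField b θ) : Dom b :=
  ⟨(hθ.memLp.toLp, hθ.memLp_rotFun.toLp), by
    intro η hη u v hu hv
    rw [L2.inner_def, L2.inner_def]
    have h := integral_inner_rotFun b hη hθ
    refine Eq.trans (integral_congr_ae ?_) (h.trans (integral_congr_ae ?_))
    · filter_upwards [hv, hθ.memLp.coeFn_toLp] with y h1 h2
      rw [h1, h2]
    · filter_upwards [hu, hθ.memLp_rotFun.coeFn_toLp] with y h1 h2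
      rw [h1, h2]⟩

theorem coeFn_incl_testVec {θ : E3 → C6} (hθ : IsTestField b θ) :
    incl b (testVec hθ) =ᵐ[cellMeasure b] θ := hθ.memLp.coeFn_toLp

theorem coeFn_rotOp_testVec {θ : E3 → C6} (hθ : IsTestField b θ) :
    rotOp b (testVec hθ) =ᵐ[cellMeasure b] rotFun θ := hθ.memLp_rotFun.coeFn_toLp

theorem inner_rotOp_testVec {θ : E3 → C6} (hθ : IsTestField b θ) (ψ : Dom b) :
    inner ℂ (rotOp b (testVec hθ)) (incl b ψ) = inner ℂ (incl b (testVec hθ)) (rotOp b ψ) :=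
  ψ.2 θ hθ _ _ (coeFn_incl_testVec b hθ) (coeFn_rotOp_testVec b hθ)

/-- The test-field criterion for membership in the domain. -/
theorem mem_MaxwellDomain_iff (p : Hcell b × Hcell b) :
    p ∈ MaxwellDomain b ↔ ∀ θ (hθ : IsTestField b θ),
      inner ℂ (rotOp b (testVec hθ)) p.1 = inner ℂ (incl b (testVec hθ)) p.2 := by
  refine ⟨fun h θ hθ => h θ hθ _ _ (coeFn_incl_testVec b hθ) (coeFn_rotOp_testVec b hθ),
    fun h θ hθ u v hu hv => ?_⟩
  have h1 : u = incl b (testVec hθ) := Lp.ext (hu.trans (coeFn_incl_testVec b hθ).symm)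
  have h2 : v = rotOp b (testVec hθ) := Lp.ext (hv.trans (coeFn_rotOp_testVec b hθ).symm)
  rw [h1, h2]
  exact h θ hθ

/-- Weak conditions are closed conditions. The resulting completeness of the domain allows the open
mapping theorem in `wInner_Mper`. -/
theorem isClosed_MaxwellDomain : IsClosed (MaxwellDomain b : Set (Hcell b × Hcell b)) := by
  have h : (MaxwellDomain b : Set (Hcell b × Hcell b)) = ⋂ θ, ⋂ hθ : IsTestField b θ,
      {p | inner ℂ (rotOp b (testVec hθ)) p.1 = inner ℂ (incl b (testVec hθ)) p.2} := by
    ext p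
    simp only [Set.mem_iInter, Set.mem_ofPred_eq]
    exact mem_MaxwellDomain_iff b p
  rw [h]
  refine isClosed_iInter fun θ => isClosed_iInter fun hθ => isClosed_eq ?_ ?_
  · exact continuous_const.inner continuous_fst
  · exact continuous_const.inner continuous_snd

instance : CompleteSpace (Dom b) := (isClosed_MaxwellDomain b).completeSpace_coe

end TestFields

/-! ### The material weight and the Bloch projection -/

section Band

variable {b : Module.Basis (Fin 3) ℝ E3} {Winv : E3 → Mat6}

theorem IsMaterialWeight.ae_hermitian (hW : IsMaterialWeight b Winv) :
    ∀ᵐ y ∂(cellMeasure b), (Winv y).conjTranspose = Winv y := by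
  filter_upwards [ae_restrict_of_ae hW.posDef] with y hy
  exact hy.isHermitian

theorem IsMaterialWeight.ae_hermitian_inv (hW : IsMaterialWeight b Winv) :
    ∀ᵐ y ∂(cellMeasure b), ((Winv y)⁻¹).conjTranspose = (Winv y)⁻¹ := by
  filter_upwards [hW.ae_hermitian] with y hy
  rw [Matrix.conjTranspose_nonsing_inv, hy]

theorem IsMaterialWeight.memLp_Winv_cell (hW : IsMaterialWeight b Winv) :
    MemLp (fun y => matCLM (Winv y)) ∞ (cellMeasure b) := hW.memLp_Winv.restrict _

theorem IsMaterialWeight.memLp_W_cell (hW : IsMaterialWeight b Winv) :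
    MemLp (fun y => matCLM (Winv y)⁻¹) ∞ (cellMeasure b) := hW.memLp_W.restrict _

theorem IsMaterialWeight.mulOp_Wop (hW : IsMaterialWeight b Winv) (u : Hcell b) :
    mulOp b Winv (Wop b Winv u) = u := by
  refine Lp.ext ?_
  filter_upwards [mulOp_coeFn b hW.memLp_Winv_cell (Wop b Winv u), mulOp_coeFn b hW.memLp_W_cell u,
    ae_restrict_of_ae hW.posDef] with y h1 h2 h3
  rw [h1, Wop, h2, ← matCLM_mul, Matrix.mul_nonsing_inv _ ((Matrix.isUnit_iff_isUnit_det _).1 h3.isUnit),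
    matCLM_one]

theorem IsMaterialWeight.inner_mulOp (hW : IsMaterialWeight b Winv) (u v : Hcell b) :
    inner ℂ (mulOp b Winv u) v = inner ℂ u (mulOp b Winv v) :=
  RayOptics.inner_mulOp b hW.memLp_Winv_cell hW.ae_hermitian u v

theorem IsMaterialWeight.inner_Wop (hW : IsMaterialWeight b Winv) (u v : Hcell b) :
    inner ℂ (Wop b Winv u) v = inner ℂ u (Wop b Winv v) :=
  RayOptics.inner_mulOp b hW.memLp_W_cell hW.ae_hermitian_inv u v

/-- The operator `rotMat k` of a real momentum. -/
def kOp (b : Module.Basis (Fin 3) ℝ E3) (k : E3) : Hcell b →L[ℂ] Hcell b :=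
  constOp b (rotMat fun j => (k j : ℂ))

theorem inner_kOp (k : E3) (u v : Hcell b) : inner ℂ (kOp b k u) v = inner ℂ u (kOp b k v) :=
  inner_constOp b (rotMat_conjTranspose k) u v

theorem Mper_apply (k : E3) (ψ : Dom b) :
    Mper b Winv k ψ = Wop b Winv (rotOp b ψ + kOp b k (incl b ψ)) := rfl

theorem IsMaterialWeight.mulOp_Mper (hW : IsMaterialWeight b Winv) (k : E3) (ψ : Dom b) :
    mulOp b Winv (Mper b Winv k ψ) = rotOp b ψ + kOp b k (incl b ψ) := by
  rw [Mper_apply, hW.mulOp_Wop]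

/-- Symmetry of `M_per(k)` when one of the arguments is a test field. -/
theorem IsMaterialWeight.inner_Mper_testVec (hW : IsMaterialWeight b Winv) (k : E3) (ψ : Dom b)
    {θ : E3 → C6} (hθ : IsTestField b θ) :
    inner ℂ (mulOp b Winv (Mper b Winv k ψ)) (incl b (testVec hθ))
      = inner ℂ (incl b ψ) (mulOp b Winv (Mper b Winv k (testVec hθ))) := by
  rw [hW.mulOp_Mper, hW.mulOp_Mper, inner_add_left, inner_add_right, inner_kOp]
  congr 1
  rw [← inner_conj_symm, ← inner_rotOp_testVec, inner_conj_symm]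

/-- A vector orthogonal to `(M_per(k) - z)θ` for all test fields, `z` a real resolvent point,
vanishes. -/
theorem IsMaterialWeight.eq_zero_of_inner_testVec (hW : IsMaterialWeight b Winv) (k : E3) (z : ℝ)
    (hz : (z : ℂ) ∉ specMper b Winv k) (w : Hcell b)
    (h : ∀ θ (hθ : IsTestField b θ),
      inner ℂ w ((Mper b Winv k - (z : ℂ) • incl b) (testVec hθ)) = 0) : w = 0 := by
  have hbij : Function.Bijective (Mper b Winv k - (z : ℂ) • incl b) := not_not.1 hz
  obtain ⟨u, hu⟩ : ∃ u, u = Wop b Winv w := ⟨_, rfl⟩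
  have hw : w = mulOp b Winv u := by rw [hu, hW.mulOp_Wop]
  -- For u = Ww the hypothesis is the weak form of Rot u = z w - `kOp b k u`. Thus u lies in the
  -- domain and (M_per(k) - z)u = 0, so injectivity gives u = 0.
  have hmem : (u, (z : ℂ) • w - kOp b k u) ∈ MaxwellDomain b := by
    rw [mem_MaxwellDomain_iff]
    intro θ hθ
    have h1 := h θ hθ
    rw [sub_apply, smul_apply, Mper_apply, inner_sub_right, inner_smul_right,
      ← hW.inner_Wop, ← hu, inner_add_right, ← inner_kOp] at h1
    have h2 : inner ℂ (rotOp b (testVec hθ)) u = (starRingEnd ℂ) (inner ℂ u (rotOp b (testVec hθ))) :=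
      (inner_conj_symm _ _).symm
    have h3 : inner ℂ u (rotOp b (testVec hθ))
        = z * inner ℂ w (incl b (testVec hθ)) - inner ℂ (kOp b k u) (incl b (testVec hθ)) := by
      linear_combination h1
    dsimp only
    rw [h2, h3, inner_sub_right, inner_smul_right, map_sub, map_mul, inner_conj_symm,
      inner_conj_symm, Complex.conj_ofReal]
  obtain ⟨p, e2, e1⟩ : ∃ p : Dom b, incl b p = u ∧ rotOp b p = (z : ℂ) • w - kOp b k u :=
    ⟨⟨_, hmem⟩, rfl, rfl⟩
  have h0 : (Mper b Winv k - (z : ℂ) • incl b) p = 0 := by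
    rw [sub_apply, smul_apply, Mper_apply, e1, e2, sub_add_cancel, (Wop b Winv).map_smul, ← hu,
      sub_self]
  have h1 : p = 0 := hbij.1 (h0.trans (map_zero _).symm)
  rw [hw, ← e2, h1, map_zero, map_zero]

variable {om : E3 → ℝ} {φ : E3 → Dom b}

-- Symmetry of M_per(k) against φ is immediate only on test fields, because the domain is defined
-- weakly. A real z in the gap replaces density of test fields in the graph norm: the defect of
-- symmetry, composed with (M_per(k) - z)⁻¹, is a bounded functional on L² that vanishes on the
-- image of the test fields, and `IsMaterialWeight.eq_zero_of_inner_testVec` shows that its Riesz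
-- vector is zero.
set_option maxHeartbeats 1000000 in
theorem wInner_Mper (hW : IsMaterialWeight b Winv) (hband : IsIsolatedBand b Winv om φ) (k : E3)
    (ψ : Dom b) :
    wInner b Winv (incl b (φ k)) (Mper b Winv k ψ)
      = om k * wInner b Winv (incl b (φ k)) (incl b ψ) := by
  obtain ⟨d, hd, hgap⟩ := hband.gap
  -- The distance d/2 to ω(k) is positive and less than the gap d, so z is a resolvent point.
  obtain ⟨z, hzdef⟩ : ∃ z : ℝ, z = om k + d / 2 := ⟨_, rfl⟩
  have hz : (z : ℂ) ∉ specMper b Winv k := fun hz => by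
    have hne : (z : ℂ) ≠ om k := by
      intro h
      have : z = om k := by exact_mod_cast h
      linarith
    have h1 := hgap k z hz hne
    have h2 : (z : ℂ) - om k = ((d / 2 : ℝ) : ℂ) := by rw [hzdef]; push_cast; ring
    rw [h2, Complex.norm_real, Real.norm_of_nonneg (by linarith)] at h1
    linarith
  have hbij : Function.Bijective (Mper b Winv k - (z : ℂ) • incl b) := not_not.1 hz
  obtain ⟨T, hTa⟩ : ∃ T : Dom b ≃L[ℂ] Hcell b,
      ∀ ψ, T ψ = (Mper b Winv k - (z : ℂ) • incl b) ψ :=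
    ⟨ContinuousLinearEquiv.ofBijective (Mper b Winv k - (z : ℂ) • incl b)
      (LinearMap.ker_eq_bot.2 hbij.1) (LinearMap.range_eq_top.2 hbij.2), fun ψ => rfl⟩
  obtain ⟨L, hLa⟩ : ∃ L : Hcell b →L[ℂ] ℂ, ∀ v, L v = wInner b Winv (incl b (φ k)) v :=
    ⟨(innerSL ℂ (incl b (φ k))).comp (mulOp b Winv), fun v => rfl⟩
  -- Chosen so that l(Tψ) = ⟨φ, Mψ⟩_W - ω⟨φ, ψ⟩_W, the defect of symmetry.
  obtain ⟨l, hl⟩ : ∃ l : Hcell b →L[ℂ] ℂ,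
      ∀ v, l v = L v - ((om k - z : ℝ) : ℂ) * L (incl b (T.symm v)) :=
    ⟨L - ((om k - z : ℝ) : ℂ) • L.comp ((incl b).comp (T.symm : Hcell b →L[ℂ] Dom b)),
      fun v => rfl⟩
  have hlT : ∀ ψ, l (T ψ) = L (Mper b Winv k ψ) - om k * L (incl b ψ) := fun ψ => by
    have h1 : L (T ψ) = L (Mper b Winv k ψ) - z * L (incl b ψ) := by
      have h2 : L ((z : ℂ) • incl b ψ) = z * L (incl b ψ) := L.map_smul _ _
      rw [hTa, ← h2, ← L.map_sub]
      rfl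
    rw [hl, T.symm_apply_apply, h1]
    push_cast
    ring
  obtain ⟨w, hwl⟩ : ∃ w, ∀ v, inner ℂ w v = l v :=
    ⟨(InnerProductSpace.toDual ℂ (Hcell b)).symm l,
      fun v => InnerProductSpace.toDual_symm_apply⟩
  have hw0 : w = 0 := by
    refine hW.eq_zero_of_inner_testVec k z hz w fun θ hθ => ?_
    rw [hwl, ← hTa, hlT, hLa, hLa, wInner, wInner, ← hW.inner_Mper_testVec, hband.eigen,
      (mulOp b Winv).map_smul, inner_smul_left, hW.inner_mulOp, Complex.conj_ofReal, sub_self]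
  have hl0 : l (T ψ) = 0 := by rw [← hwl, hw0, inner_zero_left]
  rw [hlT, hLa, hLa] at hl0
  exact sub_eq_zero.1 hl0

theorem bandProj_apply (X : Phase) (u : Hcell b) :
    bandProj b Winv φ X u = wInner b Winv (incl b (φ X.2)) u • φ X.2 := rfl

theorem Mper_comp_bandProj (hband : IsIsolatedBand b Winv om φ) (X : Phase) :
    (Mper b Winv X.2).comp (bandProj b Winv φ X)
      = (om X.2 : ℂ) • (incl b).comp (bandProj b Winv φ X) := by
  ext1 u
  rw [ContinuousLinearMap.comp_apply, smul_apply, ContinuousLinearMap.comp_apply, bandProj_apply,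
    map_smul, map_smul, hband.eigen, smul_comm]

theorem bandProj_comp_Mper (hW : IsMaterialWeight b Winv) (hband : IsIsolatedBand b Winv om φ)
    (X : Phase) :
    (bandProj b Winv φ X).comp (Mper b Winv X.2)
      = (om X.2 : ℂ) • (bandProj b Winv φ X).comp (incl b) := by
  ext1 u
  rw [ContinuousLinearMap.comp_apply, smul_apply, ContinuousLinearMap.comp_apply, bandProj_apply,
    bandProj_apply, wInner_Mper hW hband, mul_smul]

theorem bandProj_idem (hband : IsIsolatedBand b Winv om φ) (X : Phase) :
    (bandProj b Winv φ X).comp ((incl b).comp (bandProj b Winv φ X)) = bandProj b Winv φ X := by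
  ext1 u
  have h : bandProj b Winv φ X (incl b (φ X.2)) = φ X.2 := by
    rw [bandProj_apply, hband.normalized, one_smul]
  rw [ContinuousLinearMap.comp_apply, ContinuousLinearMap.comp_apply, bandProj_apply X u,
    map_smul, map_smul, h]

theorem incl_bandProj_ne_zero (hband : IsIsolatedBand b Winv om φ) (X : Phase) :
    (incl b).comp (bandProj b Winv φ X) ≠ 0 := fun h => by
  have h1 := hband.normalized X.2
  have h2 : (incl b).comp (bandProj b Winv φ X) (incl b (φ X.2)) = incl b (φ X.2) := by
    rw [ContinuousLinearMap.comp_apply, bandProj_apply, h1, one_smul]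
  rw [h, zero_apply] at h2
  rw [← h2, wInner, inner_zero_left] at h1
  exact zero_ne_one h1

end Band

/-! ### The dual lattice and equivariance -/

section Equivariance

variable (b : Module.Basis (Fin 3) ℝ E3)

/-- In the basis eᵢ dual to b the coefficients of k are ⟨k, bᵢ⟩. Rounding each down to a multiple of
2π gives g, with error at most 2π ∑ ‖eᵢ‖. -/
theorem exists_dualLattice_near : ∃ C : ℝ, ∀ k : E3, ∃ g ∈ dualLattice b, ‖k - g‖ ≤ C := by
  obtain ⟨e, he⟩ : ∃ e : Fin 3 → E3, ∀ i v, inner ℝ (e i) v = b.repr v i :=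
    ⟨fun i => (InnerProductSpace.toDual ℝ E3).symm (LinearMap.toContinuousLinearMap (b.coord i)),
      fun i v => InnerProductSpace.toDual_symm_apply⟩
  refine ⟨∑ i, 2 * Real.pi * ‖e i‖, fun k => ?_⟩
  have hk : k = ∑ i, inner ℝ k (b i) • e i := by
    refine ext_inner_right ℝ fun v => ?_
    conv_lhs => rw [← b.sum_repr v]
    rw [inner_sum, sum_inner]
    refine Finset.sum_congr rfl fun i _ => ?_
    rw [inner_smul_left, inner_smul_right, he]
    simp [mul_comm]
  refine ⟨∑ i, (2 * Real.pi * ⌊inner ℝ k (b i) / (2 * Real.pi)⌋) • e i, fun γ hγ => ?_, ?_⟩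
  · have hrepr : ∀ i, ∃ n : ℤ, b.repr γ i = n := fun i => by
      obtain ⟨n, hn⟩ := (Module.Basis.mem_span_iff_repr_mem ℤ b γ).1 hγ i
      exact ⟨n, hn.symm⟩
    choose n hn using hrepr
    refine ⟨∑ i, ⌊inner ℝ k (b i) / (2 * Real.pi)⌋ * n i, ?_⟩
    rw [sum_inner]
    push_cast
    rw [Finset.mul_sum]
    refine Finset.sum_congr rfl fun i _ => ?_
    rw [inner_smul_left, he, hn]
    simp
    ring
  · refine (congrArg norm (congrArg (· - _) hk)).le.trans ?_
    rw [← Finset.sum_sub_distrib]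
    refine (norm_sum_le _ _).trans (Finset.sum_le_sum fun i _ => ?_)
    rw [← sub_smul, norm_smul]
    refine mul_le_mul_of_nonneg_right ?_ (norm_nonneg _)
    have hpi := Real.two_pi_pos
    have h1 : inner ℝ k (b i) - 2 * Real.pi * ⌊inner ℝ k (b i) / (2 * Real.pi)⌋
        = 2 * Real.pi * Int.fract (inner ℝ k (b i) / (2 * Real.pi)) := by
      rw [Int.fract]
      field_simp
    rw [h1, Real.norm_of_nonneg (mul_nonneg hpi.le (Int.fract_nonneg _))]
    exact mul_le_of_le_one_right hpi.le (Int.fract_lt_one _).le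

theorem neg_mem_dualLattice {g : E3} (hg : g ∈ dualLattice b) : -g ∈ dualLattice b := fun γ hγ => by
  obtain ⟨n, hn⟩ := hg γ hγ
  exact ⟨-n, by rw [inner_neg_left, hn]; push_cast; ring⟩

theorem hasFDerivAt_phaseFun (g y : E3) : HasFDerivAt (phaseFun g)
    ((phaseFun g y * Complex.I) • Complex.ofRealCLM.comp (innerSL ℝ g)) y := by
  have h1 : HasFDerivAt (fun y : E3 => Complex.I * ((inner ℝ g y : ℝ) : ℂ))
      (Complex.I • Complex.ofRealCLM.comp (innerSL ℝ g)) y :=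
    ((Complex.ofRealCLM.comp (innerSL ℝ g)).hasFDerivAt).const_mul Complex.I
  have h2 := h1.cexp
  rw [smul_smul] at h2
  exact h2

theorem rotFun_phaseFun_smul {θ : E3 → C6} (hθ : Differentiable ℝ θ) (g y : E3) :
    rotFun (fun y => phaseFun g y • θ y) y
      = phaseFun g y • (rotFun θ y + matCLM (rotMat fun j => (g j : ℂ)) (θ y)) := by
  have hsum : matCLM (rotMat fun j => (g j : ℂ)) (θ y)
      = ∑ j, (g j : ℂ) • matCLM (rotMat (Pi.single j 1)) (θ y) := by
    rw [rotMat_eq_sum]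
    simp only [matCLM, map_sum, map_smul]
    rw [sum_apply]
    rfl
  rw [hsum, rotFun, rotFun, ← Finset.sum_add_distrib, Finset.smul_sum]
  refine Finset.sum_congr rfl fun j _ => ?_
  have h1 := ((hasFDerivAt_phaseFun g y).smul (hθ y).hasFDerivAt).fderiv
  have h2 : fderiv ℝ (fun y => phaseFun g y • θ y) y (EuclideanSpace.single j 1)
      = phaseFun g y • fderiv ℝ θ y (EuclideanSpace.single j 1)
        + (phaseFun g y * Complex.I * (g j : ℂ)) • θ y := by
    have h3 : (fun y => phaseFun g y • θ y) = phaseFun g • θ := rfl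
    rw [h3, h1]
    simp [EuclideanSpace.inner_single_right]
  rw [h2, map_add, map_smul, map_smul, smul_add, smul_add, smul_smul, smul_smul, smul_smul,
    smul_smul]
  congr 2
  · ring
  · linear_combination (-(phaseFun g y * (g j : ℂ))) * Complex.I_mul_I

variable {b}

/-- Multiplication of a test field by a lattice-periodic phase. -/
theorem IsTestField.phaseFun_smul {g : E3} (hg : g ∈ dualLattice b) {θ : E3 → C6}
    (hθ : IsTestField b θ) : IsTestField b fun y => phaseFun g y • θ y :=
  ⟨(contDiff_phaseFun g).smul hθ.1, fun γ hγ y => by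
    dsimp only
    rw [phaseFun_periodic b hg γ hγ, hθ.2 γ hγ]⟩

/-- The weak form of Rot e^{ig·y} = e^{ig·y}(Rot + `kOp b g`). The phase is moved onto the test
field, which stays periodic because g lies in the dual lattice. -/
theorem phaseOp_mem_MaxwellDomain {g : E3} (hg : g ∈ dualLattice b) (ψ : Dom b) :
    (phaseOp b g (incl b ψ), phaseOp b g (rotOp b ψ + kOp b g (incl b ψ))) ∈ MaxwellDomain b := by
  rw [mem_MaxwellDomain_iff]
  intro θ hθ
  have hθ' := hθ.phaseFun_smul (neg_mem_dualLattice b hg)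
  have e1 : phaseOp b (-g) (incl b (testVec hθ)) = incl b (testVec hθ') := by
    refine Lp.ext ?_
    filter_upwards [phaseOp_coeFn b (-g) (incl b (testVec hθ)), coeFn_incl_testVec b hθ,
      coeFn_incl_testVec b hθ'] with y h1 h2 h3
    rw [h1, h2, h3]
  have e2 : phaseOp b (-g) (rotOp b (testVec hθ))
      = rotOp b (testVec hθ') + kOp b g (incl b (testVec hθ')) := by
    refine Lp.ext ?_
    filter_upwards [phaseOp_coeFn b (-g) (rotOp b (testVec hθ)), coeFn_rotOp_testVec b hθ,
      coeFn_incl_testVec b hθ', coeFn_rotOp_testVec b hθ',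
      constOp_coeFn b (rotMat fun j => (g j : ℂ)) (incl b (testVec hθ')),
      Lp.coeFn_add (rotOp b (testVec hθ')) (kOp b g (incl b (testVec hθ')))] with y h1 h2 h3 h4 h5 h6
    rw [h1, h2, h6, Pi.add_apply, h4, kOp, h5, h3,
      rotFun_phaseFun_smul (hθ.1.differentiable (by simp))]
    have h7 : rotMat (fun j => (((-g) j : ℝ) : ℂ)) = (-1 : ℂ) • rotMat fun j => (g j : ℂ) := by
      rw [← rotMat_smul]
      congr 1
      ext j
      simp
    rw [h7, matCLM_smul, smul_add, map_smul]
    simp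
  rw [inner_phaseOp, inner_phaseOp, e1, e2, inner_add_left, inner_add_right, inner_rotOp_testVec,
    inner_kOp]

/-- Multiplication by a lattice-periodic phase on the domain. -/
def phaseDom {g : E3} (hg : g ∈ dualLattice b) : Dom b →L[ℂ] Dom b :=
  (((phaseOp b g).comp (incl b)).prod
    ((phaseOp b g).comp (rotOp b + (kOp b g).comp (incl b)))).codRestrict (MaxwellDomain b)
      (phaseOp_mem_MaxwellDomain hg)

theorem incl_phaseDom {g : E3} (hg : g ∈ dualLattice b) (ψ : Dom b) :
    incl b (phaseDom hg ψ) = phaseOp b g (incl b ψ) := rfl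

theorem rotOp_phaseDom {g : E3} (hg : g ∈ dualLattice b) (ψ : Dom b) :
    rotOp b (phaseDom hg ψ) = phaseOp b g (rotOp b ψ + kOp b g (incl b ψ)) := rfl

theorem kOp_sub (k g : E3) (u : Hcell b) : kOp b (k - g) u = kOp b k u - kOp b g u := by
  have h : (rotMat fun j => (((k - g) j : ℝ) : ℂ))
      = (rotMat fun j => (k j : ℂ)) + (-1 : ℂ) • rotMat fun j => (g j : ℂ) := by
    rw [← rotMat_smul, ← rotMat_add]
    congr 1
    ext j
    simp [sub_eq_add_neg]
  rw [kOp, h, constOp_add, constOp_smul, add_apply, smul_apply, neg_one_smul, ← sub_eq_add_neg]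
  rfl

variable {Winv : E3 → Mat6}

/-- The shift of k by g cancels the term that arises from commuting Rot with the phase. -/
theorem Mper_sub_phaseDom (hW : IsMaterialWeight b Winv) {g : E3} (hg : g ∈ dualLattice b) (k : E3)
    (ψ : Dom b) : Mper b Winv (k - g) (phaseDom hg ψ) = phaseOp b g (Mper b Winv k ψ) := by
  rw [Mper_apply, Mper_apply, incl_phaseDom, rotOp_phaseDom, Wop, ← mulOp_phaseOp b hW.memLp_W_cell,
    kOp_sub]
  congr 1
  have h : ∀ k, kOp b k (phaseOp b g (incl b ψ)) = phaseOp b g (kOp b k (incl b ψ)) :=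
    fun k => constOp_phaseOp b _ g _
  rw [h, h, map_add, map_add]
  abel

theorem SigmaOp_phaseOp (hW : IsMaterialWeight b Winv) (g : E3) (j : Fin 3) (u : Hcell b) :
    SigmaOp b Winv j (phaseOp b g u) = phaseOp b g (SigmaOp b Winv j u) := by
  rw [SigmaOp, ContinuousLinearMap.comp_apply, ContinuousLinearMap.comp_apply, constOp_phaseOp, Wop,
    mulOp_phaseOp b hW.memLp_W_cell]

theorem defect_sub_phaseDom (hW : IsMaterialWeight b Winv) (te tm : E3 → ℝ) {Ω : ℝ → Phase → ℂ}
    {lam : ℝ} (hΩ : IsPeriodicScalar b (Ω lam)) {g : E3} (hg : g ∈ dualLattice b) (X : Phase) :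
    (defect b Winv te tm Ω lam (X.1, X.2 - g)).comp (phaseDom hg)
      = (phaseOp b g).comp (defect b Winv te tm Ω lam X) := by
  ext1 ψ
  simp only [ContinuousLinearMap.comp_apply, defect, maxwellSymbol, sub_apply, smul_apply,
    sum_apply, incl_phaseDom, Mper_sub_phaseDom hW, SigmaOp_phaseOp hW,
    map_sub, map_smul, map_sum, hΩ g hg]

theorem incl_comp_injective {A B : Hcell b →L[ℂ] Dom b} (h : (incl b).comp A = (incl b).comp B) :
    A = B := by
  ext1 u
  exact incl_injective b (DFunLike.congr_fun h u)

/-- Equivariance is assumed in 𝓑(L²); it lifts because the phase preserves the domain and `incl` is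
injective. -/
theorem IsEquivariant.lift {P : Phase → Hcell b →L[ℂ] Dom b}
    (hP : IsEquivariant b fun X => (incl b).comp (P X)) {g : E3} (hg : g ∈ dualLattice b)
    (X : Phase) :
    P (X.1, X.2 - g) = (phaseDom hg).comp ((P X).comp (phaseOp b (-g))) := by
  refine incl_comp_injective ((hP g hg X.1 X.2).trans ?_)
  ext1 u
  rfl

/-- Conjugation with a phase. -/
def phaseConj (b : Module.Basis (Fin 3) ℝ E3) (g : E3) :
    (Hcell b →L[ℂ] Hcell b) →L[ℝ] (Hcell b →L[ℂ] Hcell b) :=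
  (((ContinuousLinearMap.compL ℂ (Hcell b) (Hcell b) (Hcell b) (phaseOp b g)).comp
    ((ContinuousLinearMap.compL ℂ (Hcell b) (Hcell b) (Hcell b)).flip (phaseOp b (-g))))).restrictScalars ℝ

theorem phaseConj_apply (g : E3) (A : Hcell b →L[ℂ] Hcell b) :
    phaseConj b g A = (phaseOp b g).comp (A.comp (phaseOp b (-g))) := rfl

theorem phaseConj_smul (g : E3) (c : ℂ) (A : Hcell b →L[ℂ] Hcell b) :
    phaseConj b g (c • A) = c • phaseConj b g A := by
  rw [phaseConj_apply, phaseConj_apply, ContinuousLinearMap.smul_comp, ContinuousLinearMap.comp_smul]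

end Equivariance

/-! ### The Poynting vector -/

section Poynting

variable {b : Module.Basis (Fin 3) ℝ E3} {Winv : E3 → Mat6}

theorem matCLM_apply (A : Mat6) (v : C6) (i : Fin 3 ⊕ Fin 3) :
    matCLM A v i = ∑ j, A i j * v j := by
  simp [matCLM, Matrix.mulVec, dotProduct]

/-- With z the j-th component of conj(u^E) × u^H, the two off-diagonal blocks together give -z +
conj z. -/
theorem inner_crossBlocks (u : C6) (j : Fin 3) :
    inner ℂ u (matCLM (Matrix.fromBlocks 0 (crossMat (Pi.single j 1))
        (crossMat (Pi.single j 1)) 0) u)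
      = -(2 * Complex.I) * ((crossProduct (fun i => star (u (Sum.inl i)))
          (fun i => u (Sum.inr i)) j).im : ℂ) := by
  obtain ⟨z, hz⟩ : ∃ z, z = crossProduct (fun i => star (u (Sum.inl i)))
      (fun i => u (Sum.inr i)) j := ⟨_, rfl⟩
  have h : inner ℂ u (matCLM (Matrix.fromBlocks 0 (crossMat (Pi.single j 1))
      (crossMat (Pi.single j 1)) 0) u) = -z + star z := by
    rw [hz, PiLp.inner_apply]
    simp only [matCLM_apply, Fintype.sum_sum_type, Matrix.fromBlocks_apply₁₁,
      Matrix.fromBlocks_apply₁₂, Matrix.fromBlocks_apply₂₁, Matrix.fromBlocks_apply₂₂, cross_apply]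
    fin_cases j <;> simp [crossMat, Fin.sum_univ_three] <;> ring
  rw [h, ← hz]
  apply Complex.ext <;> simp
  ring

theorem memLp_coord (u : Hcell b) (i : Fin 3 ⊕ Fin 3) :
    MemLp (fun y => u y i) 2 (cellMeasure b) :=
  (EuclideanSpace.proj (𝕜 := ℂ) i).comp_memLp' (Lp.memLp u)

theorem integrable_crossProduct (u : Hcell b) (j : Fin 3) :
    Integrable (fun y => crossProduct (fun i => star (u y (Sum.inl i)))
      (fun i => u y (Sum.inr i)) j) (cellMeasure b) := by
  have h : ∀ i l : Fin 3, Integrable (fun y => star (u y (Sum.inl i)) * u y (Sum.inr l))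
      (cellMeasure b) := fun i l =>
    (memLp_coord u (Sum.inl i)).star.integrable_mul (memLp_coord u (Sum.inr l))
  fin_cases j <;> simp only [cross_apply] <;> exact (h _ _).sub (h _ _)

/-- The weight W⁻¹ of the scalar product cancels the W in Σⱼ, which leaves the pointwise identity
`inner_crossBlocks` under the integral. -/
theorem wInner_SigmaOp (hW : IsMaterialWeight b Winv) (φ : E3 → Dom b) (k : E3) (j : Fin 3) :
    wInner b Winv (incl b (φ k)) (SigmaOp b Winv j (incl b (φ k)))
      = -(2 * Complex.I) * (poynting b φ k j : ℂ) := by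
  rw [wInner, SigmaOp, ContinuousLinearMap.comp_apply, hW.mulOp_Wop, L2.inner_def, poynting]
  have h1 := integral_im (integrable_crossProduct (incl b (φ k)) j)
  have h2 : (∫ y, crossProduct (fun i => star (incl b (φ k) y (Sum.inl i)))
      (fun i => incl b (φ k) y (Sum.inr i)) j ∂(cellMeasure b)).im
      = ∫ y, (crossProduct (fun i => star (incl b (φ k) y (Sum.inl i)))
        (fun i => incl b (φ k) y (Sum.inr i)) j).im ∂(cellMeasure b) := h1.symm
  rw [h2, ← integral_complex_ofReal, ← integral_const_mul]
  refine integral_congr_ae ?_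
  filter_upwards [constOp_coeFn b (Matrix.fromBlocks 0 (crossMat (Pi.single j 1))
    (crossMat (Pi.single j 1)) 0) (incl b (φ k))] with y hy
  rw [hy, inner_crossBlocks]

theorem bandProj_SigmaOp_bandProj (hW : IsMaterialWeight b Winv) (φ : E3 → Dom b) (X : Phase)
    (j : Fin 3) :
    (bandProj b Winv φ X).comp ((SigmaOp b Winv j).comp ((incl b).comp (bandProj b Winv φ X)))
      = (-(2 * Complex.I) * (poynting b φ X.2 j : ℂ)) • bandProj b Winv φ X := by
  ext1 u
  have h : bandProj b Winv φ X (SigmaOp b Winv j (incl b (φ X.2)))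
      = (-(2 * Complex.I) * (poynting b φ X.2 j : ℂ)) • φ X.2 := by
    rw [bandProj_apply, wInner_SigmaOp hW]
  simp only [ContinuousLinearMap.comp_apply, smul_apply]
  rw [bandProj_apply X u, map_smul, map_smul, map_smul, h, smul_comm]

end Poynting

/-! ### Smooth scalar factors -/

section Scalars

variable {b : Module.Basis (Fin 3) ℝ E3}

/-- Near X₀, choose v with A(X₀)v ≠ 0 and pair with A(X₀)v: f becomes a quotient of smooth scalar
functions. This supplies smoothness of ω and 𝒫, as the band is assumed only continuous and φ not
even that. -/
theorem contDiff_of_eq_smul {f : Phase → ℂ} {A B : Phase → Hcell b →L[ℂ] Hcell b}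
    (hA : ContDiff ℝ ∞ A) (hB : ContDiff ℝ ∞ B) (hne : ∀ X, A X ≠ 0)
    (h : ∀ X, B X = f X • A X) : ContDiff ℝ ∞ f := by
  rw [contDiff_iff_contDiffAt]
  intro X₀
  obtain ⟨v, hv⟩ : ∃ v, A X₀ v ≠ 0 := by
    by_contra! hc
    exact hne X₀ (ContinuousLinearMap.ext hc)
  obtain ⟨l, hl⟩ : ∃ l : (Hcell b →L[ℂ] Hcell b) →L[ℝ] ℂ, ∀ T, l T = inner ℂ (A X₀ v) (T v) :=
    ⟨((innerSL ℂ (A X₀ v)).comp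
      (ContinuousLinearMap.apply ℂ (Hcell b) v)).restrictScalars ℝ, fun T => rfl⟩
  have h0 : l (A X₀) ≠ 0 := by
    rw [hl]
    exact inner_self_ne_zero.2 hv
  have ha : ContDiff ℝ ∞ fun X => l (A X) := l.contDiff.comp hA
  have hb : ContDiff ℝ ∞ fun X => l (B X) := l.contDiff.comp hB
  refine (hb.contDiffAt.mul (ha.contDiffAt.inv h0)).congr_of_eventuallyEq ?_
  have hn : ∀ᶠ X in 𝓝 X₀, l (A X) ≠ 0 := ha.continuous.continuousAt.eventually_ne h0
  filter_upwards [hn] with X hX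
  have h1 : l (B X) = f X * l (A X) := by
    rw [h, hl, hl, smul_apply, inner_smul_right]
  rw [h1, Pi.inv_apply, mul_assoc, mul_inv_cancel₀ hX, mul_one]

variable {ι : Type*}

/-- All derivatives are periodic, hence bounded by their maxima over a compact ball that meets every
class modulo the dual lattice. -/
theorem uniformSymbol_of_dualLattice_periodic {V : Type*} [NormedAddCommGroup V] [NormedSpace ℝ V]
    {f : E3 → V} (hs : ContDiff ℝ ∞ f) (hp : ∀ g ∈ dualLattice b, ∀ k, f (k - g) = f k) :
    UniformSymbol (fun (_ : ι) (_ : E3) => (1 : ℝ)) (fun _ => f) := by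
  obtain ⟨C₀, hC₀⟩ := exists_dualLattice_near b
  refine ⟨fun _ => hs, fun n => ?_⟩
  obtain ⟨C, hC⟩ := (isCompact_closedBall (0 : E3) C₀).exists_bound_of_continuousOn
    (hs.continuous_iteratedFDeriv (m := n) (by exact_mod_cast le_top)).continuousOn
  refine ⟨max C 0, le_max_right _ _, fun _ k => ?_⟩
  obtain ⟨g, hg, hk⟩ := hC₀ k
  have h1 : iteratedFDeriv ℝ n f (k - g) = iteratedFDeriv ℝ n f k := by
    rw [← iteratedFDeriv_comp_sub]
    congr 1
    funext k
    exact hp g hg k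
  rw [mul_one, ← h1]
  exact (hC _ (by simpa using hk)).trans (le_max_left _ _)

theorem UniformSymbol.real_mul {E : Type*} [NormedAddCommGroup E] [NormedSpace ℝ E]
    {f g : ι → E → ℝ} (hf : UniformSymbol (fun _ _ => 1) f) (hg : UniformSymbol (fun _ _ => 1) g) :
    UniformSymbol (fun _ _ => 1) (fun i x => f i x * g i x) :=
  (hf.bilinear (ContinuousLinearMap.mul ℝ ℝ) hg).mono 1 zero_le_one fun _ _ => by simp

theorem uniformSymbol_inv {t : E3 → ℝ} (ht : UniformSymbol (fun (_ : ι) (_ : E3) => (1 : ℝ)) fun _ => t)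
    (hs : ContDiff ℝ ∞ t) {c : ℝ} (hc : 0 < c) (hct : ∀ r, c ≤ t r) :
    UniformSymbol (fun (_ : ι) (_ : E3) => (1 : ℝ)) fun _ r => (t r)⁻¹ := by
  have hpos : ∀ r, 0 < t r := fun r => hc.trans_le (hct r)
  have hinv : ContDiff ℝ ∞ fun r => (t r)⁻¹ := hs.inv fun r => (hpos r).ne'
  refine ⟨fun _ => hinv, fun n => ?_⟩
  induction n using Nat.strong_induction_on with
  | _ n ih =>
    cases n with
    | zero =>
      refine derivBound_zero_iff.2 ⟨c⁻¹, inv_nonneg.2 hc.le, fun _ r => ?_⟩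
      rw [norm_inv, Real.norm_of_nonneg (hpos r).le, mul_one]
      exact inv_anti₀ hc (hct r)
    | succ n =>
      rw [derivBound_succ_iff]
      have h1 : ∀ k ≤ n, DerivBound k (fun (_ : ι) (_ : E3) => (1 : ℝ)) (fun _ r => (t r)⁻¹) :=
        fun k hk => ih k (Nat.lt_succ_of_le hk)
      have h2 : ∀ k ≤ n, DerivBound k (fun (_ : ι) (_ : E3) => (1 : ℝ) * 1)
          (fun _ r => (t r)⁻¹ * (t r)⁻¹) := fun k hk =>
        DerivBound.bilinear (ContinuousLinearMap.mul ℝ ℝ) (fun _ => hinv) (fun _ => hinv)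
          (fun j hj => h1 j (hj.trans hk)) (fun j hj => h1 j (hj.trans hk))
      have h3 := DerivBound.bilinear (n := n)
        (-(ContinuousLinearMap.lsmul ℝ ℝ : ℝ →L[ℝ] (E3 →L[ℝ] ℝ) →L[ℝ] (E3 →L[ℝ] ℝ)))
        (fun _ => hinv.mul hinv) ht.fderiv.1 h2 (fun k _ => ht.fderiv.2 k)
      have e : (fun _ : ι => fderiv ℝ fun r => (t r)⁻¹) = fun (_ : ι) r =>
          (-(ContinuousLinearMap.lsmul ℝ ℝ : ℝ →L[ℝ] (E3 →L[ℝ] ℝ) →L[ℝ] (E3 →L[ℝ] ℝ)))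
            ((t r)⁻¹ * (t r)⁻¹) (fderiv ℝ t r) := by
        funext _ r
        have h' : HasFDerivAt (fun r => (t r)⁻¹) _ r :=
          (hasDerivAt_inv (hpos r).ne').comp_hasFDerivAt r
            (hs.differentiable (by simp) r).hasFDerivAt
        rw [h'.fderiv]
        ext
        simp [pow_two]
      rw [e]
      exact h3.mono 1 zero_le_one fun _ _ => by simp

theorem IsModulation.uniformSymbol {t : E3 → ℝ} (ht : IsModulation t) :
    UniformSymbol (fun (_ : ι) (_ : E3) => (1 : ℝ)) fun _ => t :=
  ⟨fun _ => ht.smooth, fun n => by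
    obtain ⟨C, hC⟩ := ht.bounded n
    exact ⟨max C 0, le_max_right _ _, fun _ r => by
      rw [mul_one]
      exact (hC r).trans (le_max_left _ _)⟩⟩

theorem IsModulation.pos {t : E3 → ℝ} (ht : IsModulation t) (r : E3) : 0 < t r := by
  obtain ⟨c, hc, h⟩ := ht.lower
  exact hc.trans_le (h r)

theorem tau_sq {te tm : E3 → ℝ} (hte : IsModulation te) (htm : IsModulation tm) (r : E3) :
    tau te tm r ^ 2 = te r * tm r :=
  Real.sq_sqrt (mul_pos (hte.pos r) (htm.pos r)).le

theorem uniformSymbol_tau_sq {te tm : E3 → ℝ} (hte : IsModulation te) (htm : IsModulation tm) :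
    UniformSymbol (fun (_ : ι) (_ : E3) => (1 : ℝ)) fun _ r => tau te tm r ^ 2 :=
  (hte.uniformSymbol.real_mul htm.uniformSymbol).congr fun _ r => tau_sq hte htm r

theorem gradLog_apply {te tm : E3 → ℝ} (hte : IsModulation te) (htm : IsModulation tm) (r : E3)
    (j : Fin 3) : gradLog te tm r j
      = fderiv ℝ te r (EuclideanSpace.single j 1) * (te r)⁻¹
        - fderiv ℝ tm r (EuclideanSpace.single j 1) * (tm r)⁻¹ := by
  have h1 : (fun s => Real.log (te s / tm s)) = fun s => Real.log (te s) - Real.log (tm s) := by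
    funext s
    exact Real.log_div (hte.pos s).ne' (htm.pos s).ne'
  have h2 := ((hte.smooth.differentiable (by simp) r).hasFDerivAt.log (hte.pos r).ne').sub
    ((htm.smooth.differentiable (by simp) r).hasFDerivAt.log (htm.pos r).ne')
  have h3 : gradLog te tm r j = inner ℝ (gradLog te tm r) (EuclideanSpace.single j 1) := by
    rw [EuclideanSpace.inner_single_right]
    simp
  rw [h3, gradLog, gradient, InnerProductSpace.toDual_symm_apply, h1]
  have h4 : fderiv ℝ (fun s => Real.log (te s) - Real.log (tm s)) r = _ := h2.fderiv
  rw [h4]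
  simp [mul_comm]

theorem uniformSymbol_gradLog {te tm : E3 → ℝ} (hte : IsModulation te) (htm : IsModulation tm)
    (j : Fin 3) : UniformSymbol (fun (_ : ι) (_ : E3) => (1 : ℝ)) fun _ r => gradLog te tm r j := by
  have h : ∀ {t : E3 → ℝ}, IsModulation t → UniformSymbol (fun (_ : ι) (_ : E3) => (1 : ℝ))
      fun _ r => fderiv ℝ t r (EuclideanSpace.single j 1) * (t r)⁻¹ := fun ht => by
    obtain ⟨c, hc, hct⟩ := ht.lower
    exact (ht.uniformSymbol.fderiv.clm_comp
      (ContinuousLinearMap.apply ℝ ℝ (EuclideanSpace.single j 1))).real_mul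
        (uniformSymbol_inv ht.uniformSymbol ht.smooth hc hct)
  exact ((h hte).sub (h htm)).congr fun _ r => gradLog_apply hte htm r j

theorem gradLog_self {te : E3 → ℝ} (hte : IsModulation te) (r : E3) (j : Fin 3) :
    gradLog te te r j = 0 := by
  rw [gradLog_apply hte hte, sub_self]

end Scalars

/-! ### Semiclassical expansion of a threefold Weyl product -/

section Sandwich

variable {ι : Type*} {F₀ F₁ F₂ F₃ : Type*}
  [NormedAddCommGroup F₀] [NormedSpace ℂ F₀] [NormedSpace ℝ F₀] [IsScalarTower ℝ ℂ F₀]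
  [NormedAddCommGroup F₁] [NormedSpace ℂ F₁] [NormedSpace ℝ F₁] [IsScalarTower ℝ ℂ F₁]
  [NormedAddCommGroup F₂] [NormedSpace ℂ F₂] [NormedSpace ℝ F₂] [IsScalarTower ℝ ℂ F₂]
  [NormedAddCommGroup F₃] [NormedSpace ℂ F₃] [NormedSpace ℝ F₃] [IsScalarTower ℝ ℂ F₃]
  {lam : ι → ℝ} {Λ : ℝ} {N M N' M' K L : ℕ}

theorem UniformSymbol.ord_comp {f : ι → Phase → F₂ →L[ℂ] F₃} {g : ι → Phase → F₁ →L[ℂ] F₂}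
    (hf : UniformSymbol (ordWeight lam N M) f) (hg : UniformSymbol (ordWeight lam N' M') g)
    (hK : N + N' = K := by rfl) (hL : M + M' = L := by rfl) :
    UniformSymbol (ordWeight lam K L) (fun i X => (f i X).comp (g i X)) :=
  (hf.bilinear (compR F₁ F₂ F₃) hg).mono 1 zero_le_one fun i X => by
    rw [ordWeight_mul, one_mul, hK, hL]

theorem UniformSymbol.ord_smul {V : Type*} [NormedAddCommGroup V] [NormedSpace ℂ V]
    [NormedSpace ℝ V] [IsScalarTower ℝ ℂ V] {f : ι → Phase → ℂ} {g : ι → Phase → V}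
    (hf : UniformSymbol (ordWeight lam N M) f) (hg : UniformSymbol (ordWeight lam N' M') g)
    (hK : N + N' = K := by rfl) (hL : M + M' = L := by rfl) :
    UniformSymbol (ordWeight lam K L) (fun i X => f i X • g i X) :=
  (hf.smul hg).mono 1 zero_le_one fun i X => by
    rw [ordWeight_mul, one_mul, hK, hL]

theorem uniformSymbol_lam (hlam : ∀ i, lam i ∈ Set.Icc 0 Λ) :
    UniformSymbol (ordWeight lam 1 0) (fun i (_ : Phase) => ((lam i : ℝ) : ℂ)) :=
  (UniformSymbol.const (c := lam) (E := Phase) (fun i => ((lam i : ℝ) : ℂ)) fun i => by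
    rw [Complex.norm_real, Real.norm_of_nonneg (hlam i).1]).mono 1 zero_le_one fun i X => by
      simp [ordWeight]

theorem UniformSymbol.ord_lam_smul {V : Type*} [NormedAddCommGroup V] [NormedSpace ℂ V]
    [NormedSpace ℝ V] [IsScalarTower ℝ ℂ V] (hlam : ∀ i, lam i ∈ Set.Icc 0 Λ) {g : ι → Phase → V}
    (hg : UniformSymbol (ordWeight lam N M) g) (hK : 1 + N = K := by rfl) :
    UniformSymbol (ordWeight lam K M) (fun i X => ((lam i : ℝ) : ℂ) • g i X) :=
  (uniformSymbol_lam hlam).ord_smul hg hK (zero_add M)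

theorem UniformSymbol.ord_mono {V : Type*} [NormedAddCommGroup V] [NormedSpace ℝ V]
    (hlam : ∀ i, lam i ∈ Set.Icc 0 Λ) {f : ι → Phase → V}
    (hf : UniformSymbol (ordWeight lam N M) f) (hK : K ≤ N) (hL : M ≤ L) :
    UniformSymbol (ordWeight lam K L) f := by
  refine hf.mono (max Λ 0 ^ (N - K)) (by positivity) fun i X => ?_
  have h0 := (hlam i).1
  have h1 : lam i ^ N ≤ max Λ 0 ^ (N - K) * lam i ^ K := by
    rw [← Nat.sub_add_cancel hK, pow_add, Nat.sub_add_cancel hK]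
    gcongr
    exact (hlam i).2.trans (le_max_left _ _)
  have h2 : (1 + ‖X.2‖) ^ M ≤ (1 + ‖X.2‖) ^ L :=
    pow_le_pow_right₀ (by linarith [norm_nonneg X.2]) hL
  calc ordWeight lam N M i X ≤ (max Λ 0 ^ (N - K) * lam i ^ K) * (1 + ‖X.2‖) ^ L := by
        unfold ordWeight
        gcongr
    _ = _ := by rw [ordWeight, mul_assoc]

theorem UniformSymbol.ord_weylBracket {f : ι → Phase → F₂ →L[ℂ] F₃} {g : ι → Phase → F₁ →L[ℂ] F₂}
    (hf : UniformSymbol (ordWeight lam N M) f) (hg : UniformSymbol (ordWeight lam N' M') g)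
    (hK : N + N' = K := by rfl) (hL : M + M' = L := by rfl) :
    UniformSymbol (ordWeight lam K L) (fun i => weylBracket (f i) (g i)) :=
  UniformSymbol.sum _ fun _ _ =>
    ((hf.fderiv_apply _).ord_comp (hg.fderiv_apply _) hK hL).sub
      ((hf.fderiv_apply _).ord_comp (hg.fderiv_apply _) hK hL)

theorem weylBracket_sub {f f₀ : Phase → F₂ →L[ℂ] F₃} {g g₀ : Phase → F₁ →L[ℂ] F₂}
    (hf : Differentiable ℝ f) (hf₀ : Differentiable ℝ f₀) (hg : Differentiable ℝ g)
    (hg₀ : Differentiable ℝ g₀) (X : Phase) :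
    weylBracket f g X - weylBracket f₀ g₀ X
      = weylBracket (fun X => f X - f₀ X) g X + weylBracket f₀ (fun X => g X - g₀ X) X := by
  have e1 : fderiv ℝ (fun X => f X - f₀ X) X = fderiv ℝ f X - fderiv ℝ f₀ X :=
    fderiv_sub (hf X) (hf₀ X)
  have e2 : fderiv ℝ (fun X => g X - g₀ X) X = fderiv ℝ g X - fderiv ℝ g₀ X :=
    fderiv_sub (hg X) (hg₀ X)
  simp only [weylBracket, e1, e2, sub_apply, ContinuousLinearMap.sub_comp,
    ContinuousLinearMap.comp_sub, ← Finset.sum_sub_distrib, ← Finset.sum_add_distrib]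
  refine Finset.sum_congr rfl fun j _ => ?_
  abel

variable [CompleteSpace F₃] [CompleteSpace F₂]
  {p p₀ : ι → Phase → F₂ →L[ℂ] F₃} {D D₀ D₁ : ι → Phase → F₁ →L[ℂ] F₂}
  {P P₀ P₁ : ι → Phase → F₀ →L[ℂ] F₁}

/-- Leading order of `p ♯ (D ♯ P)`. -/
theorem uniformSymbol_sandwich_zero (hlam : ∀ i, lam i ∈ Set.Icc 0 Λ)
    (hp : UniformSymbol (ordWeight lam 0 0) p) (hD : UniformSymbol (ordWeight lam 0 1) D)
    (hP : UniformSymbol (ordWeight lam 0 1) P) (hp₀ : UniformSymbol (ordWeight lam 0 0) p₀)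
    (hD₀ : UniformSymbol (ordWeight lam 0 1) D₀)
    (hp' : UniformSymbol (ordWeight lam 1 0) fun i X => p i X - p₀ i X)
    (hD' : UniformSymbol (ordWeight lam 1 1) fun i X => D i X - D₀ i X)
    (hP' : UniformSymbol (ordWeight lam 1 1) fun i X => P i X - P₀ i X) :
    UniformSymbol (ordWeight lam 1 2) fun i X => weyl (lam i) (p i) (weyl (lam i) (D i) (P i)) X
      - (p₀ i X).comp ((D₀ i X).comp (P₀ i X)) := by
  have hG := UniformSymbol.weyl hlam hD hP
  -- Telescoping: both Weyl products are replaced by compositions, then p, D and P by their leading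
  -- coefficients, one at a time.
  have h1 := UniformSymbol.weyl_sub hlam hp hG
  have h2 := hp.ord_comp (UniformSymbol.weyl_sub hlam hD hP) (K := 1) (L := 2)
  have h3 := hp'.ord_comp (hD.ord_comp hP (K := 0) (L := 2)) (K := 1) (L := 2)
  have h4 := hp₀.ord_comp (hD'.ord_comp hP (K := 1) (L := 2)) (K := 1) (L := 2)
  have h5 := hp₀.ord_comp (hD₀.ord_comp hP' (K := 1) (L := 2)) (K := 1) (L := 2)
  refine ((((h1.add h2).add h3).add h4).add h5).congr fun i X => ?_
  simp only [ContinuousLinearMap.sub_comp, ContinuousLinearMap.comp_sub]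
  abel

/-- First order of `p ♯ (D ♯ P)` when the leading order of `D P` vanishes. -/
theorem uniformSymbol_sandwich_one (hlam : ∀ i, lam i ∈ Set.Icc 0 Λ)
    (hp : UniformSymbol (ordWeight lam 0 0) p) (hD : UniformSymbol (ordWeight lam 0 1) D)
    (hP : UniformSymbol (ordWeight lam 0 1) P) (hp₀ : UniformSymbol (ordWeight lam 0 0) p₀)
    (hD₀ : UniformSymbol (ordWeight lam 0 1) D₀) (hP₀ : UniformSymbol (ordWeight lam 0 1) P₀)
    (hD₁ : UniformSymbol (ordWeight lam 0 1) D₁) (hP₁ : UniformSymbol (ordWeight lam 0 1) P₁)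
    (hp' : UniformSymbol (ordWeight lam 1 0) fun i X => p i X - p₀ i X)
    (hD' : UniformSymbol (ordWeight lam 1 1) fun i X => D i X - D₀ i X)
    (hP' : UniformSymbol (ordWeight lam 1 1) fun i X => P i X - P₀ i X)
    (hD'' : UniformSymbol (ordWeight lam 2 1) fun i X => D i X - D₀ i X - ((lam i : ℝ) : ℂ) • D₁ i X)
    (hP'' : UniformSymbol (ordWeight lam 2 1) fun i X => P i X - P₀ i X - ((lam i : ℝ) : ℂ) • P₁ i X)
    (hDP : ∀ i X, (D₀ i X).comp (P₀ i X) = 0) :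
    UniformSymbol (ordWeight lam 2 2) fun i X => weyl (lam i) (p i) (weyl (lam i) (D i) (P i)) X
      - ((lam i : ℝ) : ℂ) • (p₀ i X).comp ((D₁ i X).comp (P₀ i X) + (D₀ i X).comp (P₁ i X)
        + (Complex.I / 2) • weylBracket (D₀ i) (P₀ i) X) := by
  obtain ⟨G, hGdef⟩ : ∃ G : ι → Phase → F₀ →L[ℂ] F₂,
      G = fun i => RayOptics.weyl (lam i) (D i) (P i) := ⟨_, rfl⟩
  obtain ⟨G₁, hG₁def⟩ : ∃ G₁ : ι → Phase → F₀ →L[ℂ] F₂,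
      G₁ = fun i X => (D₁ i X).comp (P₀ i X) + (D₀ i X).comp (P₁ i X)
        + (Complex.I / 2) • weylBracket (D₀ i) (P₀ i) X := ⟨_, rfl⟩
  have hG₁ : UniformSymbol (ordWeight lam 0 2) G₁ := by
    rw [hG₁def]
    exact ((hD₁.ord_comp hP₀).add (hD₀.ord_comp hP₁)).add
      ((hD₀.ord_weylBracket hP₀).const_smul _)
  -- Second-order expansion of the inner product; the term of order λ⁰ is D₀P₀ = 0.
  have hGG₁ : UniformSymbol (ordWeight lam 2 2)
      fun i X => G i X - ((lam i : ℝ) : ℂ) • G₁ i X := by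
    have h1 := UniformSymbol.weyl_sub_sub hlam hD hP
    have h2 := ((((hD'.ord_weylBracket hP (K := 1) (L := 2)).add
      (hD₀.ord_weylBracket hP' (K := 1) (L := 2))).ord_lam_smul hlam (K := 2)).const_smul
        (Complex.I / 2))
    have h3 := hD''.ord_comp hP (K := 2) (L := 2)
    have h4 := (hD₁.ord_comp hP' (K := 1) (L := 2)).ord_lam_smul hlam (K := 2)
    have h5 := hD₀.ord_comp hP'' (K := 2) (L := 2)
    refine ((((h1.add h2).add h3).add h4).add h5).congr fun i X => ?_
    rw [hGdef, hG₁def]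
    dsimp only
    rw [← weylBracket_sub (hD.differentiable i) (hD₀.differentiable i) (hP.differentiable i)
      (hP₀.differentiable i)]
    simp only [ContinuousLinearMap.sub_comp, ContinuousLinearMap.comp_sub,
      ContinuousLinearMap.smul_comp, ContinuousLinearMap.comp_smul, hDP]
    module
  -- As G is already O(λ), the bracket of the outer product contributes only at order λ², and the
  -- zeroth-order expansion of that product is enough.
  have hG : UniformSymbol (ordWeight lam 1 2) G :=
    ((hGG₁.ord_mono hlam one_le_two le_rfl).add (hG₁.ord_lam_smul hlam)).congr fun i X => by
      rw [sub_add_cancel]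
  have h1 := UniformSymbol.weyl_sub hlam hp hG
  have h2 := hp'.ord_comp hG (K := 2) (L := 2)
  have h3 := hp₀.ord_comp hGG₁ (K := 2) (L := 2)
  refine ((h1.add h2).add h3).congr fun i X => ?_
  rw [hGdef, hG₁def]
  simp only [ContinuousLinearMap.sub_comp, ContinuousLinearMap.comp_sub,
    ContinuousLinearMap.comp_smul]
  abel

end Sandwich

/-! ### Symbol classes as uniform families -/

section Conversion

variable {V : Type*} [NormedAddCommGroup V] [NormedSpace ℝ V] {ι : Type*}

/-- The semiclassical parameter on `(0, λ₀)`. -/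
abbrev lamVal (lam0 : ℝ) (i : Set.Ioo (0 : ℝ) lam0) : ℝ := i

theorem lamVal_mem {lam0 : ℝ} (i : Set.Ioo (0 : ℝ) lam0) : lamVal lam0 i ∈ Set.Icc 0 lam0 :=
  ⟨i.2.1.le, i.2.2.le⟩

theorem sqrt_rpow_le (k : E3) {m : ℝ} {M : ℕ} (hm : m = M) :
    Real.sqrt (1 + ‖k‖ ^ 2) ^ m ≤ (1 + ‖k‖) ^ M := by
  rw [hm, Real.rpow_natCast]
  refine pow_le_pow_left₀ (Real.sqrt_nonneg _) ?_ M
  rw [Real.sqrt_le_left (by positivity)]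
  nlinarith [norm_nonneg k]

theorem ordWeight_zero_zero (lam : ι → ℝ) (i : ι) (X : Phase) : ordWeight lam 0 0 i X = 1 := by
  simp [ordWeight]

theorem IsSymbol.uniformSymbol {m : ℝ} {f : Phase → V} (hf : IsSymbol m f) (lam : ι → ℝ) {M : ℕ}
    (hm : m = M) : UniformSymbol (ordWeight lam 0 M) fun _ => f :=
  ⟨fun _ => hf.1, fun n => by
    obtain ⟨C, hC⟩ := hf.2 n
    refine ⟨max C 0, le_max_right _ _, fun i X => (hC X).trans ?_⟩
    rw [ordWeight, pow_zero, one_mul]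
    exact mul_le_mul (le_max_left _ _) (sqrt_rpow_le _ hm)
      (Real.rpow_nonneg (Real.sqrt_nonneg _) _) (le_max_right _ _)⟩

theorem isSymbol_of_uniformSymbol {f : Phase → V}
    (hf : UniformSymbol (fun (_ : Unit) (_ : Phase) => (1 : ℝ)) fun _ => f) : IsSymbol 0 f :=
  ⟨hf.1 (), fun n => by
    obtain ⟨C, -, hC⟩ := hf.2 n
    exact ⟨C, fun X => by simpa using hC () X⟩⟩

theorem IsSemiclassical.uniformSymbol {lam0 m : ℝ} {f : ℝ → Phase → V} {c : ℕ → Phase → V}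
    (hf : IsSemiclassical lam0 m f c) {M : ℕ} (hm : m = M) (N : ℕ) :
    UniformSymbol (ordWeight (lamVal lam0) N M)
      fun i X => f i X - ∑ j ∈ Finset.range N, (i : ℝ) ^ j • c j X := by
  have hmem : ∀ i : Set.Ioo (0 : ℝ) lam0, (i : ℝ) ∈ Set.Ico 0 lam0 := fun i => ⟨i.2.1.le, i.2.2⟩
  refine ⟨fun i => (hf.symbol i (hmem i)).1.sub
    (ContDiff.sum fun j _ => (hf.coeff j).1.const_smul _), fun n => ?_⟩
  obtain ⟨C, hC⟩ := hf.expansion N n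
  refine ⟨max C 0, le_max_right _ _, fun i X => (hC i (hmem i) X).trans ?_⟩
  have h0 : (0 : ℝ) ≤ (i : ℝ) ^ N := pow_nonneg i.2.1.le N
  rw [ordWeight, mul_assoc]
  refine mul_le_mul (le_max_left _ _) ?_
    (mul_nonneg h0 (Real.rpow_nonneg (Real.sqrt_nonneg _) _)) (le_max_right _ _)
  exact mul_le_mul_of_nonneg_left (sqrt_rpow_le _ hm) h0

theorem UniformSymbol.comp_fst {w : ι → E3 → ℝ} {a : ι → E3 → V} (h : UniformSymbol w a) :
    UniformSymbol (fun i (X : Phase) => w i X.1) (fun i X => a i X.1) := by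
  have := h.comp_affine (fun _ => ContinuousLinearMap.fst ℝ E3 E3) (fun _ => 0) (K := 1)
    (fun _ => ContinuousLinearMap.norm_fst_le ℝ E3 E3)
  simpa using this

theorem UniformSymbol.comp_snd {w : ι → E3 → ℝ} {a : ι → E3 → V} (h : UniformSymbol w a) :
    UniformSymbol (fun i (X : Phase) => w i X.2) (fun i X => a i X.2) := by
  have := h.comp_affine (fun _ => ContinuousLinearMap.snd ℝ E3 E3) (fun _ => 0) (K := 1)
    (fun _ => ContinuousLinearMap.norm_snd_le ℝ E3 E3)
  simpa using this

theorem UniformSymbol.ofReal {E : Type*} [NormedAddCommGroup E] [NormedSpace ℝ E] {w : ι → E → ℝ}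
    {a : ι → E → ℝ} (h : UniformSymbol w a) : UniformSymbol w (fun i x => (a i x : ℂ)) :=
  h.clm_comp Complex.ofRealCLM

theorem UniformSymbol.ord_zero {f : ι → Phase → V} (h : UniformSymbol (fun _ _ => 1) f)
    (lam : ι → ℝ) : UniformSymbol (ordWeight lam 0 0) f :=
  h.mono 1 zero_le_one fun i X => by rw [ordWeight_zero_zero, one_mul]

theorem uniformSymbol_const (lam : ι → ℝ) (v : V) :
    UniformSymbol (ordWeight lam 0 0) fun _ _ => v :=
  (UniformSymbol.const (c := fun _ => ‖v‖) (E := Phase) (fun _ : ι => v) fun _ => le_rfl).mono ‖v‖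
    (norm_nonneg v) fun i X => by rw [ordWeight_zero_zero, mul_one]

end Conversion

/-! ### Growth in k of equivariant symbols -/

section Equivariant

variable {ι : Type*} {b : Module.Basis (Fin 3) ℝ E3} {lam : ι → ℝ}

/-- For equivariant symbols all polynomial orders in `k` coincide. -/
theorem UniformSymbol.of_equivariant {N M : ℕ} {A : ι → Phase → Hcell b →L[ℂ] Hcell b}
    (hlam : ∀ i, 0 ≤ lam i) (hA : UniformSymbol (ordWeight lam N M) A)
    (heq : ∀ i, IsEquivariant b (A i)) : UniformSymbol (ordWeight lam N 0) A := by
  obtain ⟨C₀, hC₀⟩ := exists_dualLattice_near b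
  refine ⟨hA.1, fun n => ?_⟩
  obtain ⟨C, hC0, hC⟩ := hA.2 n
  refine ⟨C * (1 + max C₀ 0) ^ M, by positivity, fun i X => ?_⟩
  obtain ⟨g, hg, hk⟩ := hC₀ X.2
  -- The phases act isometrically, so conjugation does not increase norms.
  have hT : ‖phaseConj b (-g)‖ ≤ 1 := by
    refine ContinuousLinearMap.opNorm_le_bound _ zero_le_one fun T => ?_
    rw [phaseConj_apply, one_mul]
    refine (ContinuousLinearMap.opNorm_comp_le _ _).trans ?_
    refine (mul_le_of_le_one_left (norm_nonneg _) (norm_phaseOp_le b _)).trans ?_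
    refine (ContinuousLinearMap.opNorm_comp_le _ _).trans ?_
    exact mul_le_of_le_one_right (norm_nonneg _) (norm_phaseOp_le b _)
  -- Equivariance writes the symbol as a conjugate of its own translate; its derivatives at k are
  -- thereby dominated by those at k - g, where the momentum is bounded.
  have h1 : A i = fun Y => phaseConj b (-g) (A i (Y - ((0 : E3), g))) := by
    funext Y
    have h := heq i (-g) (neg_mem_dualLattice b hg) Y.1 (Y.2 - g)
    rw [sub_neg_eq_add, sub_add_cancel] at h
    rw [phaseConj_apply, h]
    simp [Prod.sub_def]
  have hs : ContDiff ℝ ∞ fun Y => A i (Y - ((0 : E3), g)) :=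
    (hA.1 i).comp (contDiff_id.sub contDiff_const)
  have h2 : ‖iteratedFDeriv ℝ n (A i) X‖ ≤ ‖iteratedFDeriv ℝ n (A i) (X - ((0 : E3), g))‖ := by
    conv_lhs => rw [h1]
    have h3 := (phaseConj b (-g)).norm_iteratedFDeriv_comp_left (x := X)
      (hs.contDiffAt (x := X)) (n := n) (by exact_mod_cast le_top)
    refine h3.trans ?_
    rw [iteratedFDeriv_comp_sub]
    exact mul_le_of_le_one_left (norm_nonneg _) hT
  refine h2.trans ((hC i _).trans ?_)
  rw [mul_assoc]
  refine mul_le_mul_of_nonneg_left ?_ hC0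
  have hk' : ‖(X - ((0 : E3), g)).2‖ ≤ max C₀ 0 := hk.trans (le_max_left _ _)
  have hl := pow_nonneg (hlam i) N
  calc ordWeight lam N M i (X - ((0 : E3), g)) ≤ lam i ^ N * (1 + max C₀ 0) ^ M := by
        unfold ordWeight
        gcongr
    _ = _ := by simp [ordWeight, mul_comm]

end Equivariant

/-! ### Operator families with scalar coefficients -/

section Coefficients

variable {ι : Type*} {F₁ F₂ : Type*}
  [NormedAddCommGroup F₁] [NormedSpace ℂ F₁] [NormedSpace ℝ F₁] [IsScalarTower ℝ ℂ F₁]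
  [NormedAddCommGroup F₂] [NormedSpace ℂ F₂] [NormedSpace ℝ F₂] [IsScalarTower ℝ ℂ F₂]

theorem uniformSymbol_affine (lam : ι → ℝ) (A : F₁ →L[ℂ] F₂) (B : Fin 3 → F₁ →L[ℂ] F₂) :
    UniformSymbol (ordWeight lam 0 1)
      fun _ (X : Phase) => A + ∑ j : Fin 3, ((X.2 j : ℝ) : ℂ) • B j := by
  have hk : ∀ j, UniformSymbol (ordWeight lam 0 1) fun _ (X : Phase) => ((X.2 j : ℝ) : ℂ) := fun j =>
    ((UniformSymbol.linear (ι := ι)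
      (c := fun _ => ‖(EuclideanSpace.proj (𝕜 := ℝ) j : E3 →L[ℝ] ℝ)‖)
      (fun _ => (EuclideanSpace.proj (𝕜 := ℝ) j : E3 →L[ℝ] ℝ)) fun _ => le_rfl).comp_snd.mono
        ‖(EuclideanSpace.proj (𝕜 := ℝ) j : E3 →L[ℝ] ℝ)‖ (norm_nonneg _) fun i X => by
          simp [ordWeight]).ofReal
  have h1 : UniformSymbol (ordWeight lam 0 1)
      fun _ (X : Phase) => ∑ j : Fin 3, ((X.2 j : ℝ) : ℂ) • B j :=
    UniformSymbol.sum _ fun j _ => (hk j).ord_smul (uniformSymbol_const lam _)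
  have h2 : UniformSymbol (ordWeight lam 0 1) fun _ (_ : Phase) => A :=
    (uniformSymbol_const lam A).mono 1 zero_le_one fun i X => by
      simp [ordWeight]
  exact h2.add h1

theorem uniformSymbol_smul_sum_smul {lam : ι → ℝ} {s : ι → Phase → ℂ} {g : Fin 3 → ι → Phase → ℂ}
    (hs : UniformSymbol (ordWeight lam 0 0) s) (hg : ∀ j, UniformSymbol (ordWeight lam 0 0) (g j))
    (B : Fin 3 → F₁ →L[ℂ] F₂) :
    UniformSymbol (ordWeight lam 0 0) fun i X => s i X • ∑ j : Fin 3, g j i X • B j :=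
  hs.ord_smul (UniformSymbol.sum _ fun j _ => (hg j).ord_smul (uniformSymbol_const lam _))

theorem sub_sub_smul_eq (A B S : F₁ →L[ℂ] F₂) (l s : ℝ) :
    A - (B - (((l * s : ℝ) : ℂ) * (Complex.I / 2)) • S)
      = A - B + (l : ℂ) • ((s : ℂ) * (Complex.I / 2)) • S := by
  rw [Complex.ofReal_mul, smul_smul, mul_assoc, sub_sub_eq_add_sub, sub_add_eq_add_sub]

end Coefficients

/-! ### The Maxwell symbol and the defect -/

section Maxwell

variable {ι : Type*} {b : Module.Basis (Fin 3) ℝ E3} {Winv : E3 → Mat6} {lam : ι → ℝ}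

theorem Mper_eq_sum (k : E3) : Mper b Winv k = (Wop b Winv).comp (rotOp b)
    + ∑ j, (k j : ℂ) • (Wop b Winv).comp ((constOp b (rotMat (Pi.single j 1))).comp (incl b)) := by
  have h : constOp b (rotMat fun j => (k j : ℂ))
      = ∑ j, (k j : ℂ) • constOp b (rotMat (Pi.single j 1)) := by
    rw [rotMat_eq_sum, Fin.sum_univ_three, Fin.sum_univ_three, constOp_add, constOp_add,
      constOp_smul, constOp_smul, constOp_smul]
  ext1 ψ
  rw [Mper, h]
  simp only [ContinuousLinearMap.comp_apply, add_apply, sum_apply, smul_apply, map_add, map_sum,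
    map_smul]

variable (b Winv) in
/-- The subprincipal part of `-𝓜_λ`. -/
def sigmaSymbol (te tm : E3 → ℝ) (X : Phase) : Dom b →L[ℂ] Hcell b :=
  (((tau te tm X.1 ^ 2 : ℝ) : ℂ) * (Complex.I / 2)) •
    ∑ j : Fin 3, ((gradLog te tm X.1 j : ℝ) : ℂ) • (SigmaOp b Winv j).comp (incl b)

theorem defect_eq (te tm : E3 → ℝ) (Ω : ℝ → Phase → ℂ) (l : ℝ) (X : Phase) :
    defect b Winv te tm Ω l X = Ω l X • incl b - ((tau te tm X.1 ^ 2 : ℝ) : ℂ) • Mper b Winv X.2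
      + (l : ℂ) • sigmaSymbol b Winv te tm X := by
  rw [defect, maxwellSymbol, sigmaSymbol]
  exact sub_sub_smul_eq _ _ _ _ _

variable {te tm : E3 → ℝ}

theorem uniformSymbol_Mper (lam : ι → ℝ) :
    UniformSymbol (ordWeight lam 0 1) fun _ (X : Phase) => Mper b Winv X.2 :=
  (uniformSymbol_affine lam ((Wop b Winv).comp (rotOp b)) fun j =>
    (Wop b Winv).comp ((constOp b (rotMat (Pi.single j 1))).comp (incl b))).congr
      fun _ X => Mper_eq_sum X.2

theorem uniformSymbol_sigmaSymbol (hte : IsModulation te) (htm : IsModulation tm) (lam : ι → ℝ) :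
    UniformSymbol (ordWeight lam 0 0) fun _ => sigmaSymbol b Winv te tm :=
  uniformSymbol_smul_sum_smul
    ((((uniformSymbol_tau_sq hte htm).comp_fst.ofReal.ord_zero lam).ord_smul
      (uniformSymbol_const lam (Complex.I / 2)) (K := 0) (L := 0)))
    (fun j => (uniformSymbol_gradLog hte htm j).comp_fst.ofReal.ord_zero lam)
    fun j => (SigmaOp b Winv j).comp (incl b)

theorem uniformSymbol_tau_sq_phase (hte : IsModulation te) (htm : IsModulation tm) :
    UniformSymbol (ordWeight lam 0 0) fun _ (X : Phase) => ((tau te tm X.1 ^ 2 : ℝ) : ℂ) :=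
  (uniformSymbol_tau_sq hte htm).comp_fst.ofReal.ord_zero lam

end Maxwell

/-! ### The sandwiched defect of a band -/

theorem fderiv_comp_snd_apply_fst {V : Type*} [NormedAddCommGroup V] [NormedSpace ℝ V] {F : E3 → V}
    (hF : Differentiable ℝ fun X : Phase => F X.2) (X : Phase) (v : E3) :
    fderiv ℝ (fun X : Phase => F X.2) X (v, 0) = 0 := by
  have h1 : HasDerivAt (fun s : ℝ => X + s • ((v, 0) : Phase)) ((v, 0) : Phase) 0 := by
    simpa using ((hasDerivAt_id (0 : ℝ)).smul_const ((v, 0) : Phase)).const_add X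
  have h0 : X + (0 : ℝ) • ((v, 0) : Phase) = X := by simp
  have h2 := ((hF (X + (0 : ℝ) • ((v, 0) : Phase))).hasFDerivAt).comp_hasDerivAt (0 : ℝ) h1
  have h3 : ((fun X : Phase => F X.2) ∘ fun s : ℝ => X + s • ((v, 0) : Phase)) = fun _ => F X.2 := by
    funext s
    simp
  rw [h3, h0] at h2
  exact h2.unique (hasDerivAt_const _ _)

/-! ### The threefold product for an abstract band -/

section Abstract

variable {ι : Type*} {F H : Type*}
  [NormedAddCommGroup F] [NormedSpace ℂ F] [NormedSpace ℝ F] [IsScalarTower ℝ ℂ F]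
  [NormedAddCommGroup H] [NormedSpace ℂ H] [NormedSpace ℝ H] [IsScalarTower ℝ ℂ H]
  {lam : ι → ℝ} {Λ : ℝ}

/-- Symbol estimates for the ingredients of `π ♯ (Ω - 𝓜) ♯ π`: an embedding `J`, an operator family
`T - λ S` with `T(r,k) = t(r) M(k)`, a scalar symbol `Ω ≍ c₀ + λ c₁ + …` and an operator symbol
`P ≍ π₀ + λ P₁ + …`. -/
structure BandEstimates (lam : ι → ℝ) (J : F →L[ℂ] H) (M : E3 → F →L[ℂ] H) (t : E3 → ℂ)
    (S : Phase → F →L[ℂ] H) (Ω : ι → Phase → ℂ) (c₀ c₁ : Phase → ℂ) (P : ι → Phase → H →L[ℂ] F)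
    (π₀ : E3 → H →L[ℂ] F) (P₁ : Phase → H →L[ℂ] F) : Prop where
  symbol_M : UniformSymbol (ordWeight lam 0 1) fun _ X => M X.2
  symbol_t : UniformSymbol (ordWeight lam 0 0) fun _ X => t X.1
  symbol_S : UniformSymbol (ordWeight lam 0 0) fun _ => S
  symbol_c₀ : UniformSymbol (ordWeight lam 0 0) fun _ => c₀
  symbol_c₁ : UniformSymbol (ordWeight lam 0 0) fun _ => c₁
  omega_sub : UniformSymbol (ordWeight lam 1 0) fun i X => Ω i X - c₀ X
  omega_sub_sub : UniformSymbol (ordWeight lam 2 0) fun i X => Ω i X - c₀ X - (lam i : ℂ) * c₁ X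
  symbol_P : UniformSymbol (ordWeight lam 0 1) P
  symbol_π₀ : UniformSymbol (ordWeight lam 0 1) fun _ X => π₀ X.2
  symbol_P₁ : UniformSymbol (ordWeight lam 0 1) fun _ => P₁
  P_sub : UniformSymbol (ordWeight lam 1 1) fun i X => P i X - π₀ X.2
  P_sub_sub : UniformSymbol (ordWeight lam 2 1) fun i X => P i X - π₀ X.2 - (lam i : ℂ) • P₁ X
  symbol_JP : UniformSymbol (ordWeight lam 0 0) fun i X => J.comp (P i X)
  symbol_Jπ₀ : UniformSymbol (ordWeight lam 0 0) fun _ X => J.comp (π₀ X.2)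
  JP_sub : UniformSymbol (ordWeight lam 1 0) fun i X => J.comp (P i X) - J.comp (π₀ X.2)

namespace BandEstimates

variable {J : F →L[ℂ] H} {M : E3 → F →L[ℂ] H} {t : E3 → ℂ} {S : Phase → F →L[ℂ] H}
  {Ω : ι → Phase → ℂ} {c₀ c₁ : Phase → ℂ} {P : ι → Phase → H →L[ℂ] F} {π₀ : E3 → H →L[ℂ] F}
  {P₁ : Phase → H →L[ℂ] F} {D : ι → Phase → F →L[ℂ] H}

theorem leading (h : BandEstimates lam J M t S Ω c₀ c₁ P π₀ P₁)
    (hlam : ∀ i, lam i ∈ Set.Icc 0 Λ) :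
    UniformSymbol (ordWeight lam 0 1) fun _ X => c₀ X • J - t X.1 • M X.2 :=
  ((h.symbol_c₀.ord_smul (uniformSymbol_const lam J) (K := 0) (L := 0)).ord_mono hlam le_rfl
    zero_le_one).sub (h.symbol_t.ord_smul h.symbol_M (K := 0) (L := 1))

theorem subleading (h : BandEstimates lam J M t S Ω c₀ c₁ P π₀ P₁) :
    UniformSymbol (ordWeight lam 0 0) fun _ X => c₁ X • J + S X :=
  (h.symbol_c₁.ord_smul (uniformSymbol_const lam J) (K := 0) (L := 0)).add h.symbol_S

theorem defect_sub (h : BandEstimates lam J M t S Ω c₀ c₁ P π₀ P₁)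
    (hlam : ∀ i, lam i ∈ Set.Icc 0 Λ)
    (hD : ∀ i X, D i X = Ω i X • J - t X.1 • M X.2 + (lam i : ℂ) • S X) :
    UniformSymbol (ordWeight lam 1 1) fun i X => D i X - (c₀ X • J - t X.1 • M X.2) := by
  have h1 := h.omega_sub.ord_smul (uniformSymbol_const lam J) (K := 1) (L := 0)
  have h2 := h.symbol_S.ord_lam_smul hlam (K := 1)
  refine ((h1.add h2).ord_mono hlam le_rfl zero_le_one).congr fun i X => ?_
  rw [hD]
  module

theorem defect_symbol (h : BandEstimates lam J M t S Ω c₀ c₁ P π₀ P₁)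
    (hlam : ∀ i, lam i ∈ Set.Icc 0 Λ)
    (hD : ∀ i X, D i X = Ω i X • J - t X.1 • M X.2 + (lam i : ℂ) • S X) :
    UniformSymbol (ordWeight lam 0 1) D :=
  (((h.defect_sub hlam hD).ord_mono hlam zero_le_one le_rfl).add (h.leading hlam)).congr
    fun i X => by rw [sub_add_cancel]

theorem defect_sub_sub (h : BandEstimates lam J M t S Ω c₀ c₁ P π₀ P₁)
    (hlam : ∀ i, lam i ∈ Set.Icc 0 Λ)
    (hD : ∀ i X, D i X = Ω i X • J - t X.1 • M X.2 + (lam i : ℂ) • S X) :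
    UniformSymbol (ordWeight lam 2 1) fun i X => D i X - (c₀ X • J - t X.1 • M X.2)
      - (lam i : ℂ) • (c₁ X • J + S X) := by
  have h1 := h.omega_sub_sub.ord_smul (uniformSymbol_const lam J) (K := 2) (L := 0)
  refine (h1.ord_mono hlam le_rfl zero_le_one).congr fun i X => ?_
  rw [hD]
  module

variable [CompleteSpace H]

theorem sandwich_symbol (h : BandEstimates lam J M t S Ω c₀ c₁ P π₀ P₁)
    (hlam : ∀ i, lam i ∈ Set.Icc 0 Λ)
    (hD : ∀ i X, D i X = Ω i X • J - t X.1 • M X.2 + (lam i : ℂ) • S X) :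
    UniformSymbol (ordWeight lam 0 2) fun i =>
      weyl (lam i) (fun X => J.comp (P i X)) (weyl (lam i) (D i) (P i)) :=
  UniformSymbol.weyl hlam h.symbol_JP (UniformSymbol.weyl hlam (h.defect_symbol hlam hD) h.symbol_P)

variable {om : E3 → ℂ}

/-- From Mπ₀ = ωJπ₀ and π₀Jπ₀ = π₀ one gets π₀(c₀J - tM)π₀ = (c₀ - tω)π₀. -/
theorem sandwich_leading (h : BandEstimates lam J M t S Ω c₀ c₁ P π₀ P₁)
    (hlam : ∀ i, lam i ∈ Set.Icc 0 Λ)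
    (hD : ∀ i X, D i X = Ω i X • J - t X.1 • M X.2 + (lam i : ℂ) • S X)
    (hM : ∀ k, (M k).comp (π₀ k) = om k • J.comp (π₀ k))
    (hid : ∀ k, (π₀ k).comp (J.comp (π₀ k)) = π₀ k) :
    UniformSymbol (ordWeight lam 1 2) fun i X =>
      weyl (lam i) (fun X => J.comp (P i X)) (weyl (lam i) (D i) (P i)) X
        - (c₀ X - t X.1 * om X.2) • J.comp (π₀ X.2) := by
  refine (uniformSymbol_sandwich_zero hlam h.symbol_JP (h.defect_symbol hlam hD) h.symbol_P
    h.symbol_Jπ₀ (h.leading hlam) h.JP_sub (h.defect_sub hlam hD) h.P_sub).congr fun i X => ?_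
  congr 1
  rw [ContinuousLinearMap.sub_comp, ContinuousLinearMap.smul_comp, ContinuousLinearMap.smul_comp,
    hM, smul_smul, ← sub_smul, ContinuousLinearMap.comp_smul, ContinuousLinearMap.comp_assoc, hid]

/-- For c₀ = tω the leading coefficient factors as t(r) times (ωJ - M)(k), which π₀ annihilates on
both sides. This removes the contributions of P₁ and of the bracket. The index i₀ serves to read
differentiability off the families. -/
theorem sandwich_subleading (h : BandEstimates lam J M t S Ω c₀ c₁ P π₀ P₁)
    (hlam : ∀ i, lam i ∈ Set.Icc 0 Λ)
    (hD : ∀ i X, D i X = Ω i X • J - t X.1 • M X.2 + (lam i : ℂ) • S X)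
    (hM : ∀ k, (M k).comp (π₀ k) = om k • J.comp (π₀ k))
    (hM' : ∀ k, (π₀ k).comp (M k) = om k • (π₀ k).comp J)
    (hid : ∀ k, (π₀ k).comp (J.comp (π₀ k)) = π₀ k)
    (hom : Differentiable ℝ fun X : Phase => om X.2)
    {s : Phase → ℂ} (hS : ∀ X, (π₀ X.2).comp ((S X).comp (π₀ X.2)) = s X • π₀ X.2)
    (hc₀ : ∀ X, c₀ X = t X.1 * om X.2) (i₀ : ι) :
    UniformSymbol (ordWeight lam 2 2) fun i X =>
      weyl (lam i) (fun X => J.comp (P i X)) (weyl (lam i) (D i) (P i)) X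
        - ((lam i : ℂ) * (c₁ X + s X)) • J.comp (π₀ X.2) := by
  have hD₀ : (fun X : Phase => c₀ X • J - t X.1 • M X.2)
      = fun X => t X.1 • (om X.2 • J - M X.2) := by
    funext X
    rw [hc₀, smul_sub, smul_smul]
  have hπB : ∀ k, (π₀ k).comp (om k • J - M k) = 0 := fun k => by
    rw [ContinuousLinearMap.comp_sub, ContinuousLinearMap.comp_smul, hM', sub_self]
  have hDP : ∀ X : Phase, (c₀ X • J - t X.1 • M X.2).comp (π₀ X.2) = 0 := fun X => by
    rw [hc₀, ContinuousLinearMap.sub_comp, ContinuousLinearMap.smul_comp,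
      ContinuousLinearMap.smul_comp, hM, smul_smul, sub_self]
  -- Since π₀ does not depend on r, only ∂_r D₀ ∂_k π₀ remains; ∂_r D₀ is ∂_r t times ωJ - M and is
  -- killed by π₀ from the left.
  have hbr : ∀ X : Phase, (π₀ X.2).comp (weylBracket (fun X => c₀ X • J - t X.1 • M X.2)
      (fun X => π₀ X.2) X) = 0 := fun X => by
    have hdt : Differentiable ℝ fun X : Phase => t X.1 := h.symbol_t.differentiable i₀
    have hdB : Differentiable ℝ fun X : Phase => om X.2 • J - M X.2 :=
      (hom.smul_const J).sub (h.symbol_M.differentiable i₀)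
    have e1 : ∀ v, fderiv ℝ (fun X : Phase => c₀ X • J - t X.1 • M X.2) X (v, 0)
        = (fderiv ℝ (fun X : Phase => t X.1) X (v, 0)) • (om X.2 • J - M X.2) := fun v => by
      rw [hD₀]
      have h1 := ((hdt X).hasFDerivAt.smul (hdB X).hasFDerivAt).fderiv
      have h2 := fderiv_comp_snd_apply_fst (F := fun k => om k • J - M k) hdB X v
      have h3 : fderiv ℝ (fun X : Phase => t X.1 • (om X.2 • J - M X.2)) X = _ := h1
      rw [h3, add_apply, smul_apply, h2, smul_zero, zero_add]
      rfl
    have e2 : ∀ v, fderiv ℝ (fun X : Phase => π₀ X.2) X (v, 0) = 0 := fun v =>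
      fderiv_comp_snd_apply_fst (h.symbol_π₀.differentiable i₀) X v
    simp only [weylBracket, e1, e2, ContinuousLinearMap.comp_zero, sub_zero,
      ContinuousLinearMap.smul_comp]
    ext1 u
    simp only [ContinuousLinearMap.comp_apply, sum_apply, map_sum, smul_apply, map_smul]
    refine Finset.sum_eq_zero fun j _ => ?_
    have h4 := DFunLike.congr_fun (hπB X.2)
      (fderiv ℝ (fun X : Phase => π₀ X.2) X (0, EuclideanSpace.single j 1) u)
    rw [ContinuousLinearMap.comp_apply, zero_apply] at h4
    rw [h4, smul_zero]
  refine (uniformSymbol_sandwich_one hlam h.symbol_JP (h.defect_symbol hlam hD) h.symbol_P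
    h.symbol_Jπ₀ (h.leading hlam) h.symbol_π₀ (h.subleading.ord_mono hlam le_rfl zero_le_one)
    h.symbol_P₁ h.JP_sub (h.defect_sub hlam hD) h.P_sub (h.defect_sub_sub hlam hD) h.P_sub_sub
    (fun _ => hDP)).congr fun i X => ?_
  congr 1
  have h1 : (π₀ X.2).comp ((c₁ X • J + S X).comp (π₀ X.2)) = (c₁ X + s X) • π₀ X.2 := by
    rw [ContinuousLinearMap.add_comp, ContinuousLinearMap.smul_comp, ContinuousLinearMap.comp_add,
      ContinuousLinearMap.comp_smul, hid, hS, add_smul]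
  have h2 : (π₀ X.2).comp ((c₀ X • J - t X.1 • M X.2).comp (P₁ X)) = 0 := by
    rw [← ContinuousLinearMap.comp_assoc, hc₀, mul_smul, ← smul_sub, ContinuousLinearMap.comp_smul,
      hπB, smul_zero, ContinuousLinearMap.zero_comp]
  rw [ContinuousLinearMap.comp_assoc, ContinuousLinearMap.comp_add (π₀ X.2),
    ContinuousLinearMap.comp_add (π₀ X.2), ContinuousLinearMap.comp_smul (π₀ X.2), hbr, h1, h2,
    smul_zero, add_zero, add_zero, ContinuousLinearMap.comp_smul, smul_smul]

end BandEstimates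

end Abstract

/-! ### Symbol properties of the band data -/

section BandSymbols

variable {b : Module.Basis (Fin 3) ℝ E3} {Winv : E3 → Mat6} {om : E3 → ℝ} {φ : E3 → Dom b}

theorem weyl_equivariant {lam : ℝ} {f g : Phase → Hcell b →L[ℂ] Hcell b}
    (h : Tempered (weylAmplitude f g)) (hf : IsEquivariant b f) (hg : IsEquivariant b g) :
    IsEquivariant b (weyl lam f g) := by
  intro γ hγ r k
  have e : ∀ X : Phase, X + ((0 : E3), -γ) = (X.1, X.2 - γ) := fun X => by
    ext <;> simp [sub_eq_add_neg]
  have key := weyl_translate (lam := lam) h ((0 : E3), -γ) (phaseConj b γ) (phaseConj_smul γ)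
    (fun X X' => ?_) (r, k)
  · rw [e] at key
    exact key
  · rw [e, e, hf γ hγ, hg γ hγ, phaseConj_apply]
    ext1 u
    simp only [ContinuousLinearMap.comp_apply, phaseOp_neg_phaseOp]

theorem weyl_defect_equivariant (hW : IsMaterialWeight b Winv) (te tm : E3 → ℝ)
    {Ω : ℝ → Phase → ℂ} {lam : ℝ} (hΩ : IsPeriodicScalar b (Ω lam))
    {P : Phase → Hcell b →L[ℂ] Dom b} (hP : IsEquivariant b fun X => (incl b).comp (P X))
    (h : Tempered (weylAmplitude (defect b Winv te tm Ω lam) P)) :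
    IsEquivariant b (weyl lam (defect b Winv te tm Ω lam) P) := by
  intro γ hγ r k
  have e : ∀ X : Phase, X + ((0 : E3), -γ) = (X.1, X.2 - γ) := fun X => by
    ext <;> simp [sub_eq_add_neg]
  have key := weyl_translate (lam := lam) h ((0 : E3), -γ) (phaseConj b γ) (phaseConj_smul γ)
    (fun X X' => ?_) (r, k)
  · rw [e] at key
    exact key
  · rw [e, e, hP.lift hγ X', ← ContinuousLinearMap.comp_assoc, defect_sub_phaseDom hW te tm hΩ hγ,
      phaseConj_apply]
    rfl

/-- Mπ₀ = ω Jπ₀, with smooth operator functions on both sides and Jπ₀ nowhere zero. -/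
theorem contDiff_om (hband : IsIsolatedBand b Winv om φ)
    (hπ : IsSymbol 1 (bandProj b Winv φ))
    (hJπ : IsSymbol 0 fun X => (incl b).comp (bandProj b Winv φ X)) : ContDiff ℝ ∞ om := by
  have hB := ((uniformSymbol_Mper (b := b) (Winv := Winv) (fun _ : Unit => (0 : ℝ))).ord_comp
    (hπ.uniformSymbol (fun _ : Unit => (0 : ℝ)) (M := 1) (by simp)) (K := 0) (L := 2)).contDiff ()
  have h := contDiff_of_eq_smul (f := fun X : Phase => (om X.2 : ℂ)) hJπ.1 hB
    (incl_bandProj_ne_zero hband) (Mper_comp_bandProj hband)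
  have h2 : ContDiff ℝ ∞ fun k : E3 => Complex.reCLM (((om ((0 : E3), k).2 : ℝ) : ℂ)) :=
    Complex.reCLM.contDiff.comp (h.comp (contDiff_const.prodMk contDiff_id))
  simpa using h2

theorem contDiff_poynting (hW : IsMaterialWeight b Winv) (hband : IsIsolatedBand b Winv om φ)
    (hJπ : IsSymbol 0 fun X => (incl b).comp (bandProj b Winv φ X)) (j : Fin 3) :
    ContDiff ℝ ∞ fun k => poynting b φ k j := by
  have hA := hJπ.uniformSymbol (fun _ : Unit => (0 : ℝ)) (M := 0) (by simp)
  have hB := (hA.ord_comp ((uniformSymbol_const (fun _ : Unit => (0 : ℝ))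
    (SigmaOp b Winv j)).ord_comp hA (K := 0) (L := 0)) (K := 0) (L := 0)).contDiff ()
  have h := contDiff_of_eq_smul
    (f := fun X : Phase => -(2 * Complex.I) * (poynting b φ X.2 j : ℂ)) hJπ.1 hB
    (incl_bandProj_ne_zero hband) (fun X => by
      rw [ContinuousLinearMap.comp_assoc, bandProj_SigmaOp_bandProj hW, ContinuousLinearMap.comp_smul])
  have h2 : ContDiff ℝ ∞ fun k : E3 => Complex.reCLM
      (Complex.I / 2 * (-(2 * Complex.I) * (poynting b φ ((0 : E3), k).2 j : ℂ))) :=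
    Complex.reCLM.contDiff.comp
      (contDiff_const.mul (h.comp (contDiff_const.prodMk contDiff_id)))
  have e : ∀ x : ℝ, Complex.I / 2 * (-(2 * Complex.I) * (x : ℂ)) = x := fun x => by
    linear_combination (-(x : ℂ)) * Complex.I_mul_I
  simpa [e] using h2

/-- Σⱼ commutes with the phases, so 𝒫ⱼ(k) and 𝒫ⱼ(k - γ*) appear as the scalar factor of one and the
same nonzero operator. -/
theorem poynting_periodic (hW : IsMaterialWeight b Winv) (hband : IsIsolatedBand b Winv om φ)
    (heq : IsEquivariant b fun X => (incl b).comp (bandProj b Winv φ X)) (j : Fin 3)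
    {g : E3} (hg : g ∈ dualLattice b) (k : E3) : poynting b φ (k - g) j = poynting b φ k j := by
  have h1 : ∀ X : Phase, ((incl b).comp (bandProj b Winv φ X)).comp ((SigmaOp b Winv j).comp
      ((incl b).comp (bandProj b Winv φ X)))
        = (-(2 * Complex.I) * (poynting b φ X.2 j : ℂ)) • (incl b).comp (bandProj b Winv φ X) :=
    fun X => by
      rw [ContinuousLinearMap.comp_assoc, bandProj_SigmaOp_bandProj hW, ContinuousLinearMap.comp_smul]
  have h2 := h1 ((0 : E3), k - g)
  have h3 := h1 ((0 : E3), k)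
  have h4 : ((incl b).comp (bandProj b Winv φ (0, k - g))).comp ((SigmaOp b Winv j).comp
      ((incl b).comp (bandProj b Winv φ (0, k - g))))
        = (-(2 * Complex.I) * (poynting b φ k j : ℂ))
          • (incl b).comp (bandProj b Winv φ (0, k - g)) := by
    have e := heq g hg 0 k
    dsimp only at e h3
    rw [e, ← ContinuousLinearMap.comp_smul, ← ContinuousLinearMap.smul_comp, ← h3]
    ext1 u
    simp only [ContinuousLinearMap.comp_apply, SigmaOp_phaseOp hW, phaseOp_neg_phaseOp]
  rw [h4] at h2
  have h5 := smul_left_injective ℂ (incl_bandProj_ne_zero hband ((0 : E3), k - g)) h2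
  have h6 : (-(2 * Complex.I)) ≠ 0 := by simp
  exact_mod_cast (mul_left_cancel₀ h6 h5).symm

variable {te tm : E3 → ℝ}

theorem isSymbol_Omega0 (hte : IsModulation te) (htm : IsModulation tm)
    (hband : IsIsolatedBand b Winv om φ) (hom : ContDiff ℝ ∞ om) :
    IsSymbol 0 (Omega0 te tm om) :=
  isSymbol_of_uniformSymbol ((uniformSymbol_tau_sq hte htm).comp_fst.real_mul
    (uniformSymbol_of_dualLattice_periodic hom hband.periodic).comp_snd)

theorem isSymbol_Omega1 (hte : IsModulation te) (htm : IsModulation tm)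
    (hs : ∀ j, ContDiff ℝ ∞ fun k => poynting b φ k j)
    (hp : ∀ j, ∀ g ∈ dualLattice b, ∀ k, poynting b φ (k - g) j = poynting b φ k j) :
    IsSymbol 0 (Omega1 b te tm φ) :=
  isSymbol_of_uniformSymbol ((uniformSymbol_tau_sq hte htm).comp_fst.real_mul
    (UniformSymbol.sum _ fun j _ =>
      (uniformSymbol_of_dualLattice_periodic (hs j) (hp j)).comp_snd.real_mul
        (uniformSymbol_gradLog hte htm j).comp_fst)).neg

/-- The factor i/2 of the symbol meets -2i from `wInner_SigmaOp`; their product is 1, which leaves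
τ² 𝒫·∇ln(τ_ε/τ_μ) = -Ω₁. -/
theorem bandProj_sigmaSymbol_bandProj (hW : IsMaterialWeight b Winv) (X : Phase) :
    (bandProj b Winv φ X).comp ((sigmaSymbol b Winv te tm X).comp (bandProj b Winv φ X))
      = (-(Omega1 b te tm φ X : ℂ)) • bandProj b Winv φ X := by
  ext1 u
  have h : ∀ j, bandProj b Winv φ X (SigmaOp b Winv j (incl b (bandProj b Winv φ X u)))
      = (-(2 * Complex.I) * (poynting b φ X.2 j : ℂ)) • bandProj b Winv φ X u := fun j =>
    DFunLike.congr_fun (bandProj_SigmaOp_bandProj hW φ X j) u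
  simp only [sigmaSymbol, ContinuousLinearMap.comp_apply, smul_apply, sum_apply, map_smul, map_sum,
    h, smul_smul, ← Finset.sum_smul]
  congr 1
  rw [Omega1, Finset.mul_sum, Finset.mul_sum]
  push_cast
  rw [neg_neg]
  refine Finset.sum_congr rfl fun j _ => ?_
  linear_combination (-((tau te tm X.1 : ℂ) ^ 2 * (gradLog te tm X.1 j : ℂ)
    * (poynting b φ X.2 j : ℂ))) * Complex.I_mul_I

end BandSymbols

/-! ### The characterization of the band symbol -/

section Final

variable {b : Module.Basis (Fin 3) ℝ E3} {Winv : E3 → Mat6} {om : E3 → ℝ} {φ : E3 → Dom b}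
  {te tm : E3 → ℝ}

theorem IsSemiclassical.sub_sub {V : Type*} [NormedAddCommGroup V] [NormedSpace ℂ V]
    [NormedSpace ℝ V] [IsScalarTower ℝ ℂ V] {lam0 m : ℝ} {f : ℝ → Phase → V} {c : ℕ → Phase → V}
    (hf : IsSemiclassical lam0 m f c) {M : ℕ} (hm : m = M) :
    UniformSymbol (ordWeight (lamVal lam0) 0 M) (fun i => f i) ∧
    UniformSymbol (ordWeight (lamVal lam0) 1 M) (fun i X => f i X - c 0 X) ∧
    UniformSymbol (ordWeight (lamVal lam0) 2 M)
      (fun i X => f i X - c 0 X - ((lamVal lam0 i : ℝ) : ℂ) • c 1 X) :=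
  ⟨(hf.uniformSymbol hm 0).congr fun i X => by simp,
    (hf.uniformSymbol hm 1).congr fun i X => by simp,
    (hf.uniformSymbol hm 2).congr fun i X => by
      rw [Finset.sum_range_succ, Finset.sum_range_one, pow_zero, one_smul, pow_one,
        _root_.sub_sub, real_smul_eq_coe_smul]⟩

-- `bandProj` does not depend on r; inserting r = 0 exhibits π₀ as a function of k.
set_option maxHeartbeats 1000000 in
theorem bandEstimates (hte : IsModulation te) (htm : IsModulation tm) {lam0 : ℝ}
    {P : ℝ → Phase → Hcell b →L[ℂ] Dom b} {d : ℕ → Phase → Hcell b →L[ℂ] Dom b}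
    (hd : d 0 = bandProj b Winv φ) (hP : IsSemiclassical lam0 1 P d)
    (hJP : IsSemiclassical lam0 0 (fun lam X => (incl b).comp (P lam X))
      (fun n X => (incl b).comp (d n X)))
    {Ω : ℝ → Phase → ℂ} {c : ℕ → Phase → ℂ} (hΩ : IsSemiclassical lam0 0 Ω c) :
    BandEstimates (lamVal lam0) (incl b) (Mper b Winv)
      (fun r => ((tau te tm r ^ 2 : ℝ) : ℂ)) (sigmaSymbol b Winv te tm) (fun i => Ω i) (c 0) (c 1)
      (fun i => P i) (fun k => bandProj b Winv φ (0, k)) (d 1) := by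
  have h1 := hP.sub_sub (M := 1) (by simp)
  have h2 := hJP.sub_sub (M := 0) (by simp)
  have h3 := hΩ.sub_sub (M := 0) (by simp)
  rw [hd] at h1 h2
  exact
  { symbol_M := uniformSymbol_Mper _
    symbol_t := uniformSymbol_tau_sq_phase hte htm
    symbol_S := uniformSymbol_sigmaSymbol hte htm _
    symbol_c₀ := (hΩ.coeff 0).uniformSymbol _ (by simp)
    symbol_c₁ := (hΩ.coeff 1).uniformSymbol _ (by simp)
    omega_sub := h3.2.1
    omega_sub_sub := h3.2.2
    symbol_P := h1.1
    symbol_π₀ := by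
      have := (hP.coeff 0).uniformSymbol (lamVal lam0) (M := 1) (by simp)
      rw [hd] at this
      exact this
    symbol_P₁ := (hP.coeff 1).uniformSymbol _ (by simp)
    P_sub := h1.2.1
    P_sub_sub := h1.2.2
    symbol_JP := h2.1
    symbol_Jπ₀ := by
      have := (hJP.coeff 0).uniformSymbol (lamVal lam0) (M := 0) (by simp)
      rw [hd] at this
      exact this
    JP_sub := h2.2.1 }

/-- A nonnegative constant dominated by a multiple of every small `λ` vanishes. -/
theorem eq_zero_of_le_mul {lam0 x C : ℝ} (hlam0 : 0 < lam0) (hx : 0 ≤ x)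
    (h : ∀ lam ∈ Set.Ioo 0 lam0, x ≤ C * lam) : x = 0 := by
  have h1 : Tendsto (fun l : ℝ => C * l) (𝓝[>] 0) (𝓝 0) := by
    have : Tendsto (fun l : ℝ => C * l) (𝓝 0) (𝓝 (C * 0)) := tendsto_id.const_mul C
    rw [mul_zero] at this
    exact this.mono_left nhdsWithin_le_nhds
  refine le_antisymm (ge_of_tendsto h1 ?_) hx
  filter_upwards [Ioo_mem_nhdsGT hlam0] with l hl
  exact h l hl

/-- Division by λ^N leaves ‖a • v‖ ≤ (C + C')λ for all small λ. -/
theorem eq_zero_of_norm_sub_smul_le {V : Type*} [NormedAddCommGroup V] [NormedSpace ℂ V]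
    {lam0 C C' : ℝ} (hlam0 : 0 < lam0) {u : ℝ → V} {v : V} (hv : v ≠ 0) {a : ℂ} {N : ℕ}
    (h1 : ∀ lam ∈ Set.Ioo 0 lam0, ‖u lam - ((lam : ℂ) ^ N * a) • v‖ ≤ C' * lam ^ (N + 1))
    (h2 : ∀ lam ∈ Set.Ioo 0 lam0, ‖u lam‖ ≤ C * lam ^ (N + 1)) : a = 0 := by
  have h0 : ‖a • v‖ = 0 := by
    refine eq_zero_of_le_mul (C := C + C') hlam0 (norm_nonneg _) fun lam hlam => ?_
    have h3 := norm_sub_norm_le (((lam : ℂ) ^ N * a) • v) (u lam)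
    rw [norm_sub_rev, mul_smul, norm_smul, norm_pow, Complex.norm_real,
      Real.norm_of_nonneg hlam.1.le, ← mul_smul] at h3
    refine le_of_mul_le_mul_left ?_ (pow_pos hlam.1 N)
    calc _ ≤ C' * lam ^ (N + 1) + C * lam ^ (N + 1) := by linarith [h1 lam hlam, h2 lam hlam]
      _ = _ := by ring
  exact (smul_eq_zero.1 (norm_eq_zero.1 h0)).resolve_right hv

theorem symbolBigO_of_uniformSymbol {lam0 : ℝ} {N : ℕ} {R : ℝ → Phase → Hcell b →L[ℂ] Hcell b}
    (h : UniformSymbol (ordWeight (lamVal lam0) N 0) fun i => R i) : SymbolBigO lam0 0 N R :=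
  fun n => by
    obtain ⟨C, -, hC⟩ := h.2 n
    exact ⟨C, fun lam hlam X => by simpa [ordWeight, mul_assoc] using hC ⟨lam, hlam⟩ X⟩

-- Necessity is pointwise in X: comparison with the leading term gives c₀, and only then is the
-- first-order formula available to give c₁. Sufficiency reads the same formula backwards, now with
-- all derivatives.
set_option maxHeartbeats 2000000 in
theorem exists_sandwich (hW : IsMaterialWeight b Winv) (hte : IsModulation te)
    (htm : IsModulation tm) (hband : IsIsolatedBand b Winv om φ) {lam0 : ℝ} (hlam0 : 0 < lam0)
    {P : ℝ → Phase → Hcell b →L[ℂ] Dom b} (hP : IsBandSymbol b Winv φ lam0 P)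
    {Ω : ℝ → Phase → ℂ} {c : ℕ → Phase → ℂ} (hΩ : IsScalarSemiclassical b lam0 Ω c) :
    ∃ R : ℝ → Phase → Hcell b →L[ℂ] Hcell b,
      IsSandwich b Winv te tm lam0 P Ω R ∧
      (SymbolBigO lam0 0 2 R ↔
        (∀ X, c 0 X = (Omega0 te tm om X : ℂ)) ∧ (∀ X, c 1 X = (Omega1 b te tm φ X : ℂ))) := by
  obtain ⟨d, hd, hP1, hP0, hPeq, hdeq⟩ := hP
  have est := bandEstimates (Winv := Winv) (φ := φ) hte htm hd hP1 hP0 hΩ.semiclassical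
  have hl := lamVal_mem (lam0 := lam0)
  have hD : ∀ (i : Set.Ioo (0 : ℝ) lam0) (X : Phase), defect b Winv te tm Ω i X
      = Ω i X • incl b - ((tau te tm X.1 ^ 2 : ℝ) : ℂ) • Mper b Winv X.2
        + ((lamVal lam0 i : ℝ) : ℂ) • sigmaSymbol b Winv te tm X := fun i X =>
    defect_eq te tm Ω i X
  have hDs := est.defect_symbol hl hD
  have hT1 := fun i => tempered_weylAmplitude hl hDs est.symbol_P i
  have hG := UniformSymbol.weyl hl hDs est.symbol_P
  have hT2 := fun i => tempered_weylAmplitude hl est.symbol_JP hG i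
  have hR := est.sandwich_symbol hl hD
  have hmem : ∀ i : Set.Ioo (0 : ℝ) lam0, (i : ℝ) ∈ Set.Ico 0 lam0 := fun i => ⟨i.2.1.le, i.2.2⟩
  obtain ⟨R, hRdef⟩ : ∃ R : ℝ → Phase → Hcell b →L[ℂ] Hcell b, R = fun lam =>
      weyl lam (fun X => (incl b).comp (P lam X)) (weyl lam (defect b Winv te tm Ω lam) (P lam)) :=
    ⟨_, rfl⟩
  have hReq : ∀ i : Set.Ioo (0 : ℝ) lam0, IsEquivariant b (R i) := fun i => by
    rw [hRdef]
    exact weyl_equivariant (hT2 i) (hPeq i (hmem i))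
      (weyl_defect_equivariant hW te tm (hΩ.periodic i (hmem i)) (hPeq i (hmem i)) (hT1 i))
  have hR0 : UniformSymbol (ordWeight (lamVal lam0) 0 2) fun i => R i := by
    rw [hRdef]
    exact hR
  have hM := fun k => Mper_comp_bandProj hband ((0 : E3), k)
  have hM' := fun k => bandProj_comp_Mper hW hband ((0 : E3), k)
  have hid := fun k => bandProj_idem hband ((0 : E3), k)
  have hπ : IsSymbol 1 (bandProj b Winv φ) := hd ▸ hP1.coeff 0
  have hJπ : IsSymbol 0 fun X => (incl b).comp (bandProj b Winv φ X) := by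
    have := hP0.coeff 0
    rw [hd] at this
    exact this
  have hlead : UniformSymbol (ordWeight (lamVal lam0) 1 2) fun i X =>
      R i X - (c 0 X - (Omega0 te tm om X : ℂ)) • (incl b).comp (bandProj b Winv φ X) := by
    refine (est.sandwich_leading hl hD hM hid).congr fun i X => ?_
    rw [hRdef, Omega0, Complex.ofReal_mul]
    rfl
  have hom : Differentiable ℝ fun X : Phase => (om X.2 : ℂ) :=
    ((Complex.ofRealCLM.contDiff.comp ((contDiff_om hband hπ hJπ).comp contDiff_snd)).differentiable
      (by simp : (∞ : WithTop ℕ∞) ≠ 0))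
  have hsub : (∀ X, c 0 X = (Omega0 te tm om X : ℂ)) →
      UniformSymbol (ordWeight (lamVal lam0) 2 2) fun i X =>
        R i X - ((lamVal lam0 i : ℂ) * (c 1 X - (Omega1 b te tm φ X : ℂ)))
          • (incl b).comp (bandProj b Winv φ X) := fun hc => by
    refine (est.sandwich_subleading hl hD hM hM' hid hom
      (fun X => bandProj_sigmaSymbol_bandProj (te := te) (tm := tm) (φ := φ) hW X)
      (fun X => by rw [hc, Omega0, Complex.ofReal_mul])
      -- Any member of (0, λ₀) serves as the index i₀.
      ⟨lam0 / 2, by constructor <;> linarith⟩).congr fun i X => ?_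
    rw [hRdef, sub_eq_add_neg (c 1 X)]
    rfl
  refine ⟨R, fun lam hlam => ⟨?_, hReq ⟨lam, hlam⟩, ?_⟩, fun hbig => ?_, fun hc => ?_⟩
  · have h := (hR0.of_equivariant (fun i => (hl i).1) hReq).reindex
      (fun _ : Unit => (⟨lam, hlam⟩ : Set.Ioo (0 : ℝ) lam0))
    exact isSymbol_of_uniformSymbol (h.mono 1 zero_le_one fun _ X => by simp [ordWeight])
  · refine ⟨weyl lam (defect b Winv te tm Ω lam) (P lam),
      isWeylProduct_weyl hlam.1 (hT1 ⟨lam, hlam⟩), ?_⟩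
    rw [hRdef]
    exact isWeylProduct_weyl hlam.1 (hT2 ⟨lam, hlam⟩)
  · obtain ⟨C, hC⟩ := hbig 0
    have hRb : ∀ i : Set.Ioo (0 : ℝ) lam0, ∀ X, ‖R i X‖ ≤ C * (i : ℝ) ^ 2 := fun i X => by
      simpa using hC i i.2 X
    have hc0 : ∀ X, c 0 X = (Omega0 te tm om X : ℂ) := fun X => by
      obtain ⟨C', -, hC'⟩ := hlead.bound
      -- For c₀ the bound is only needed to first order, so Cλ² is weakened to |C|λ₀λ.
      refine sub_eq_zero.1 (eq_zero_of_norm_sub_smul_le (N := 0) (u := fun lam => R lam X)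
        (C' := C' * (1 + ‖X.2‖) ^ 2) (C := |C| * lam0) hlam0 (incl_bandProj_ne_zero hband X)
        (fun lam hlam => ?_) fun lam hlam => (hRb ⟨lam, hlam⟩ X).trans ?_)
      · have h1 := hC' ⟨lam, hlam⟩ X
        rw [ordWeight] at h1
        rw [pow_zero, one_mul]
        exact h1.trans_eq (by ring)
      · have := hlam.1
        have := hlam.2.le
        calc C * lam ^ 2 ≤ |C| * lam ^ 2 := by gcongr; exact le_abs_self C
          _ = |C| * lam * lam := by ring
          _ ≤ |C| * lam0 * lam := by gcongr
          _ = _ := by ring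
    refine ⟨hc0, fun X => ?_⟩
    obtain ⟨C', -, hC'⟩ := (hsub hc0).bound
    refine sub_eq_zero.1 (eq_zero_of_norm_sub_smul_le (N := 1) (u := fun lam => R lam X)
      (C' := C' * (1 + ‖X.2‖) ^ 2) (C := C) hlam0 (incl_bandProj_ne_zero hband X)
      (fun lam hlam => ?_) fun lam hlam => hRb ⟨lam, hlam⟩ X)
    have h1 := hC' ⟨lam, hlam⟩ X
    rw [ordWeight] at h1
    rw [pow_one]
    exact h1.trans_eq (by ring)
  -- With both coefficients matched, R is O(λ²) up to a growth (1 + |k|)², which equivariance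
  -- removes.
  · have h := hsub hc.1
    have h2 : UniformSymbol (ordWeight (lamVal lam0) 2 2) fun i => R i := h.congr fun i X => by
      rw [hc.2, sub_self, mul_zero, zero_smul, sub_zero]
    exact symbolBigO_of_uniformSymbol (h2.of_equivariant (fun i => (hl i).1) hReq)

theorem IsSymbol.exists_bound {V : Type*} [NormedAddCommGroup V] [NormedSpace ℝ V] {f : Phase → V}
    (hf : IsSymbol 0 f) (n : ℕ) : ∃ C : ℝ, 0 ≤ C ∧ ∀ X, ‖iteratedFDeriv ℝ n f X‖ ≤ C := by
  obtain ⟨C, hC⟩ := hf.2 n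
  exact ⟨max C 0, le_max_right _ _, fun X => (by simpa using hC X : _ ≤ C).trans (le_max_left _ _)⟩

/-- From N = 2 on the remainder vanishes identically; the constant for N = 0 uses λ < λ₀. -/
theorem isScalarSemiclassical_affine {lam0 : ℝ} (hlam0 : 0 < lam0) {f₀ f₁ : Phase → ℂ}
    (h₀ : IsSymbol 0 f₀) (h₁ : IsSymbol 0 f₁) (p₀ : IsPeriodicScalar b f₀)
    (p₁ : IsPeriodicScalar b f₁) :
    IsScalarSemiclassical b lam0 (fun lam X => f₀ X + lam * f₁ X)
      (fun n => if n = 0 then f₀ else if n = 1 then f₁ else 0) := by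
  have hsm : ∀ lam : ℝ, (fun X => f₀ X + (lam : ℂ) * f₁ X) = f₀ + lam • f₁ := fun lam => by
    funext X
    simp
  have hsum : ∀ (lam : ℝ) (n : ℕ) (X : Phase), iteratedFDeriv ℝ n (f₀ + lam • f₁) X
      = iteratedFDeriv ℝ n f₀ X + lam • iteratedFDeriv ℝ n f₁ X := fun lam n X => by
    have i₀ : ContDiffAt ℝ n f₀ X := (h₀.1.of_le (by exact_mod_cast le_top)).contDiffAt
    have i₁ : ContDiffAt ℝ n f₁ X := (h₁.1.of_le (by exact_mod_cast le_top)).contDiffAt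
    have h : ContDiffAt ℝ n (lam • f₁) X := i₁.const_smul lam
    rw [iteratedFDeriv_add_apply i₀ h, iteratedFDeriv_const_smul_apply i₁]
  have hzero : IsSymbol 0 (0 : Phase → ℂ) := ⟨contDiff_const, fun n => ⟨0, fun X => by
    rw [show (0 : Phase → ℂ) = fun _ => 0 from rfl, iteratedFDeriv_fun_zero]
    simp⟩⟩
  refine ⟨⟨fun lam _ => ?_, fun n => ?_, fun N n => ?_⟩, fun lam _ g hg r k => ?_, fun n => ?_⟩
  · rw [hsm]
    refine ⟨h₀.1.add (h₁.1.const_smul lam), fun n => ?_⟩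
    obtain ⟨C₀, -, hC₀⟩ := h₀.exists_bound n
    obtain ⟨C₁, -, hC₁⟩ := h₁.exists_bound n
    refine ⟨C₀ + |lam| * C₁, fun X => ?_⟩
    rw [hsum, Real.rpow_zero, mul_one]
    refine (norm_add_le _ _).trans (add_le_add (hC₀ X) ?_)
    rw [norm_smul, Real.norm_eq_abs]
    exact mul_le_mul_of_nonneg_left (hC₁ X) (abs_nonneg _)
  · split_ifs
    exacts [h₀, h₁, hzero]
  · obtain ⟨C₀, hC₀', hC₀⟩ := h₀.exists_bound n
    obtain ⟨C₁, hC₁', hC₁⟩ := h₁.exists_bound n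
    match N with
    | 0 =>
      refine ⟨C₀ + lam0 * C₁, fun lam hlam X => ?_⟩
      simp only [Finset.range_zero, Finset.sum_empty, sub_zero, pow_zero, mul_one, Real.rpow_zero]
      rw [hsm, hsum]
      refine (norm_add_le _ _).trans (add_le_add (hC₀ X) ?_)
      rw [norm_smul, Real.norm_of_nonneg hlam.1]
      exact mul_le_mul hlam.2.le (hC₁ X) (norm_nonneg _) hlam0.le
    | 1 =>
      refine ⟨C₁, fun lam hlam X => ?_⟩
      have e : (fun Y => f₀ Y + (lam : ℂ) * f₁ Y - ∑ j ∈ Finset.range 1,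
          lam ^ j • (if j = 0 then f₀ else if j = 1 then f₁ else 0) Y) = lam • f₁ := by
        funext Y
        simp
      rw [e, iteratedFDeriv_const_smul_apply
        (h₁.1.of_le (by exact_mod_cast le_top)).contDiffAt, norm_smul, Real.norm_of_nonneg hlam.1,
        Real.rpow_zero, mul_one, pow_one, mul_comm]
      exact mul_le_mul_of_nonneg_right (hC₁ X) hlam.1
    | N + 2 =>
      refine ⟨0, fun lam hlam X => ?_⟩
      have e : (fun Y => f₀ Y + (lam : ℂ) * f₁ Y - ∑ j ∈ Finset.range (N + 2),
          lam ^ j • (if j = 0 then f₀ else if j = 1 then f₁ else 0) Y) = fun _ => 0 := by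
        funext Y
        rw [Finset.sum_range_succ', Finset.sum_range_succ']
        simp [add_comm]
      rw [e, iteratedFDeriv_fun_zero]
      simp
  · rw [p₀ g hg, p₁ g hg]
  · split_ifs
    exacts [p₀, p₁, fun _ _ _ _ => rfl]

theorem IsSymbol.ofReal {m : ℝ} {f : Phase → ℝ} (hf : IsSymbol m f) :
    IsSymbol m fun X => (f X : ℂ) :=
  ⟨Complex.ofRealCLM.contDiff.comp hf.1, fun n => by
    obtain ⟨C, hC⟩ := hf.2 n
    exact ⟨C, fun X => by
      rw [show (fun X => (f X : ℂ)) = Complex.ofRealLI ∘ f from rfl,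
        Complex.ofRealLI.norm_iteratedFDeriv_comp_left (hf.1.contDiffAt)
          (by exact_mod_cast le_top)]
      exact hC X⟩⟩

end Final

end

end RayOptics

/-! ### The theorem -/

theorem lemma4 (b : Module.Basis (Fin 3) ℝ E3) (Winv : E3 → Mat6)
    (hW : IsMaterialWeight b Winv)
    (te tm : E3 → ℝ) (hte : IsModulation te) (htm : IsModulation tm)
    (hχ : (∀ᵐ y, (Winv y).toBlocks₁₂ = 0) ∨ te = tm)
    (om : E3 → ℝ) (φ : E3 → Dom b) (hband : IsIsolatedBand b Winv om φ)
    (lam0 : ℝ) (hlam0 : 0 < lam0)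
    (P : ℝ → Phase → Hcell b →L[ℂ] Dom b) (hP : IsBandSymbol b Winv φ lam0 P) :
    -- `Ω = Ω₀ + λ Ω₁` is a periodic symbol and satisfies `π_λ ♯ (Ω - 𝓜_λ) ♯ π_λ = O(λ²)`
    (IsSymbol 0 (Omega0 te tm om) ∧ IsSymbol 0 (Omega1 b te tm φ) ∧
      IsPeriodicScalar b (fun X => (Omega0 te tm om X : ℂ)) ∧
      IsPeriodicScalar b (fun X => (Omega1 b te tm φ X : ℂ)) ∧
      ∃ R : ℝ → Phase → Hcell b →L[ℂ] Hcell b,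
        IsSandwich b Winv te tm lam0 P
          (fun lam X => ((Omega0 te tm om X + lam * Omega1 b te tm φ X : ℝ) : ℂ)) R ∧
        SymbolBigO lam0 0 2 R) ∧
    -- the relation characterizes `Ω` up to `O(λ²)`
    (∀ (Ω : ℝ → Phase → ℂ) (c : ℕ → Phase → ℂ), IsScalarSemiclassical b lam0 Ω c →
      ∃ R : ℝ → Phase → Hcell b →L[ℂ] Hcell b,
        IsSandwich b Winv te tm lam0 P Ω R ∧
        (SymbolBigO lam0 0 2 R ↔
          (∀ X, c 0 X = (Omega0 te tm om X : ℂ)) ∧ (∀ X, c 1 X = (Omega1 b te tm φ X : ℂ)))) ∧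
    -- the first-order term vanishes for equal modulations
    (te = tm → ∀ X, Omega1 b te tm φ X = 0) := by
  have hchar := fun (Ω : ℝ → Phase → ℂ) (c : ℕ → Phase → ℂ)
    (hΩ : IsScalarSemiclassical b lam0 Ω c) => exists_sandwich hW hte htm hband hlam0 hP hΩ
  refine ⟨?_, hchar, fun h X => ?_⟩
  · obtain ⟨d, hd, hP1, hP0, -, hdeq⟩ := hP
    have hπ : IsSymbol 1 (bandProj b Winv φ) := hd ▸ hP1.coeff 0
    have hJπ : IsSymbol 0 fun X => (incl b).comp (bandProj b Winv φ X) := by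
      have := hP0.coeff 0
      rw [hd] at this
      exact this
    have heq : IsEquivariant b fun X => (incl b).comp (bandProj b Winv φ X) := by
      have := hdeq 0
      rw [hd] at this
      exact this
    have hper := fun j g (hg : g ∈ dualLattice b) k => poynting_periodic hW hband heq j hg k
    have s0 := isSymbol_Omega0 hte htm hband (contDiff_om hband hπ hJπ)
    have s1 := isSymbol_Omega1 hte htm (contDiff_poynting hW hband hJπ) hper
    have p0 : IsPeriodicScalar b (fun X => (Omega0 te tm om X : ℂ)) := fun g hg r k => by
      simp only [Omega0]
      rw [hband.periodic g hg]
    have p1 : IsPeriodicScalar b (fun X => (Omega1 b te tm φ X : ℂ)) := fun g hg r k => by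
      simp only [Omega1, hper _ g hg]
    refine ⟨s0, s1, p0, p1, ?_⟩
    -- Existence is the characterization applied to the affine symbol Ω₀ + λΩ₁, whose coefficients
    -- match by construction.
    obtain ⟨R, hR, hiff⟩ := hchar _ _
      (isScalarSemiclassical_affine hlam0 s0.ofReal s1.ofReal p0 p1)
    refine ⟨R, ?_, hiff.2 ⟨fun X => rfl, fun X => rfl⟩⟩
    simpa only [Complex.ofReal_add, Complex.ofReal_mul] using hR
  · subst h
    simp [Omega1, gradLog_self hte]
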